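/- Let $0<\beta\le 1$, $\mu>0$, $\alpha>1$, $\gamma\ge 0$, $0<\kappa<1$ and $w\ne 0$. Write $E_\beta(z)=\sum_{k\ge 0} z^k/\Gamma(\beta k+1)$ for the Mittag-Leffler function and consider the one-dimensional fractional Riesz–Bessel equation $$\partial_t^\beta u(t,x)=-\mu\,(I-\Delta)^{\gamma/2}(-\Delta)^{\alpha/2}u(t,x),\quad t>0,\ x\in\mathbb R,\qquad u(0,x)=\eta(x),$$ where $\partial_t^\beta$ is the Caputo–Djrbashian derivative and $\eta$ is a measurable, stationary, zero-mean, real Gaussian process with covariance function $$\operatorname{Cov}(\eta(x),\eta(y))=\frac{\cos(w(x-y))}{(1+(x-y)^2)^{\kappa/2}},\qquad x,y\in\mathbb R.$$ Let $G(t,x)$, $t>0$, be the Green function of the equation, that is, the inverse Fourier transform of $\lambda\mapsto E_\beta\big(-\mu|\lambda|^\alpha(1+\lambda^2)^{\gamma/2}t^\beta\big)$. Then $G(t,\cdot)$ is integrable with $\int_{\mathbb R}G(t,x)e^{ix\lambda}\,dx=\widehat G(t,\lambda):=E_\beta\big(-\mu|\lambda|^\alpha(1+\lambda^2)^{\gamma/2}t^\beta\big)$,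 for every $\lambda$ the function $\widehat G(\cdot,\lambda)$ solves $\partial_t^\beta \widehat G=-\mu|\lambda|^\alpha(1+\lambda^2)^{\gamma/2}\widehat G$, $\widehat G(0,\lambda)=1$, and the integral defining the Green function solution $$u(t,x)=\int_{\mathbb R}G(t,x-y)\,\eta(y)\,dy,\qquad t>0,\ x\in\mathbb R,$$ converges almost surely for all $t>0$ and $x\in\mathbb R$. As $\varepsilon\to 0+$, the finite-dimensional distributions of the random fields $$U_\varepsilon(t,x)=\varepsilon^{-\beta/(2\alpha)}\,u\!\left(\frac t\varepsilon,\frac x{\varepsilon^{\beta/\alpha}}\right),\qquad t>0,\ x\in\mathbb R,$$ converge weakly to those of the real-valued zero-mean Gaussian random field $$U_0(t,x)=\sqrt{\frac{c_2(\kappa)}{|w|^{1-\kappa}}\bigl(1-\theta_\kappa(|w|)\bigr)}\int_{\mathbb R}e^{i\lambda x}E_\beta\bigl(-\mu t^\beta|\lambda|^\alpha\bigr)\,W(d\lambda),$$ where $W$ is a complex Gaussian white noise random measure on $\mathbb R$ (zero mean, $\mathbb E\,W(A)\overline{W(B)}=|A\cap B|$, $W(-A)=\overline{W(A)}$). Its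 covariance function is $$\operatorname{Cov}(U_0(t,x),U_0(t',x'))=\frac{2c_2(\kappa)\bigl(1-\theta_\kappa(|w|)\bigr)}{|w|^{1-\kappa}}\int_0^\infty\cos(\lambda(x-x'))\,E_\beta(-\mu t^\beta\lambda^\alpha)\,E_\beta(-\mu t'^\beta\lambda^\alpha)\,d\lambda ,$$ the integral being absolutely convergent. Here $$c_1(\kappa)=\frac{2^{(1-\kappa)/2}}{\sqrt\pi\,\Gamma(\kappa/2)},\qquad c_2(\kappa)=\frac1{2\Gamma(\kappa)\cos(\kappa\pi/2)},\qquad 1-\theta_\kappa(u)=\frac{c_1(\kappa)}{c_2(\kappa)}\,K_{\frac{\kappa-1}2}(u)\,u^{\frac{1-\kappa}2}\quad(u>0),$$ and $K_\nu(z)=\frac12\int_0^\infty s^{\nu-1}\exp\!\big(-\tfrac12(s+\tfrac1s)z\big)\,ds$ is the modified Bessel function of the second kind. -/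

import Mathlib

open MeasureTheory ProbabilityTheory Filter Topology

noncomputable section

/-- The Mittag-Leffler function `E_β(z) = ∑ₖ zᵏ / Γ(βk + 1)` (for real `z`). -/
def mittagLeffler (β z : ℝ) : ℝ :=
  ∑' k : ℕ, z ^ k / Real.Gamma (β * k + 1)

/-- The Fourier symbol `μ |l|^α (1 + l²)^(γ/2)` of the operator `μ (I - Δ)^(γ/2) (-Δ)^(α/2)`
on the line. -/
def frbeSymbol (μ α γ l : ℝ) : ℝ :=
  μ * (|l| ^ α * (1 + l ^ 2) ^ (γ / 2))

/-- The spatial Fourier transform of the Green function,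
`E_β(-μ |l|^α (1 + l²)^(γ/2) t^β)`. -/
def greenFourier (β μ α γ t l : ℝ) : ℝ :=
  mittagLeffler β (-(frbeSymbol μ α γ l * t ^ β))

/-- The Green function `G(t, x)` of `∂_t^β + μ (I - Δ)^(γ/2) (-Δ)^(α/2)` on the line: the inverse
Fourier transform of `greenFourier` (which is even in `l`, so that the exponential
`e^{-ilx}` reduces to a cosine). -/
def greenFunction (β μ α γ t x : ℝ) : ℝ :=
  (2 * Real.pi)⁻¹ * ∫ l : ℝ, Real.cos (l * x) * greenFourier β μ α γ t l

/-- `v` has Caputo-Djrbashian derivative `d` of order `β ∈ (0, 1]` at the time `t`, that is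
`d = Γ(1-β)⁻¹ (d/dt ∫₀ᵗ v(τ) (t-τ)^(-β) dτ - v(0) t^(-β))` for `β < 1` and `d = v'(t)` for
`β = 1`; the differentiability is part of the definition. -/
def HasCaputoDerivAt (β : ℝ) (v : ℝ → ℝ) (d t : ℝ) : Prop :=
  if β = 1 then HasDerivAt v d t
  else HasDerivAt (fun s : ℝ => ∫ τ in (0 : ℝ)..s, v τ / (s - τ) ^ β)
    (Real.Gamma (1 - β) * d + v 0 / t ^ β) t

/-- `G` is the Green function of `∂_t^β + μ (I - Δ)^(γ/2) (-Δ)^(α/2)`: its spatial Fourier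
transform exists, is `greenFourier`, and solves the Fourier transformed equation with initial
value `1` (the Fourier transform of the Dirac mass). -/
structure IsGreenFunction (β μ α γ : ℝ) (G : ℝ → ℝ → ℝ) : Prop where
  integrable : ∀ t : ℝ, 0 < t → Integrable (G t)
  fourier : ∀ t : ℝ, 0 < t → ∀ l : ℝ,
    ∫ x : ℝ, (G t x : ℂ) * Complex.exp (Complex.I * x * l) = (greenFourier β μ α γ t l : ℂ)
  initial : ∀ l : ℝ, greenFourier β μ α γ 0 l = 1
  equation : ∀ l t : ℝ, 0 < t →
    HasCaputoDerivAt β (fun s => greenFourier β μ α γ s l)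
      (-(frbeSymbol μ α γ l * greenFourier β μ α γ t l)) t

/-- The Green function solution `u(t, x) = ∫ G(t, x - y) η(y) dy` of the initial value problem
with the random initial condition `η`. -/
def frbeSolution {Ω : Type*} (β μ α γ : ℝ) (η : ℝ → Ω → ℝ) (t x : ℝ) (ω : Ω) : ℝ :=
  ∫ y : ℝ, greenFunction β μ α γ t (x - y) * η y ω

/-- The rescaled field `ε^(-β/(2α)) u(t/ε, x/ε^(β/α))`. -/
def rescaledSolution {Ω : Type*} (β μ α γ : ℝ) (η : ℝ → Ω → ℝ) (ε t x : ℝ) (ω : Ω) : ℝ :=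
  (ε ^ (β / (2 * α)))⁻¹ * frbeSolution β μ α γ η (t / ε) (x / ε ^ (β / α)) ω

/-- The cyclic long-range dependent covariance function `cos(wx) / (1 + x²)^(κ/2)`. -/
def cyclicCov (κ w x : ℝ) : ℝ :=
  Real.cos (w * x) / (1 + x ^ 2) ^ (κ / 2)

/-- `η` is a measurable zero-mean Gaussian process on the line, with the stationary covariance
function `cyclicCov κ w`. -/
structure IsCyclicInitialCondition {Ω : Type*} [MeasurableSpace Ω] (P : Measure Ω)
    (κ w : ℝ) (η : ℝ → Ω → ℝ) : Prop where
  measurable : Measurable (Function.uncurry η)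
  gaussian : IsGaussianProcess η P
  mean_zero : ∀ x : ℝ, ∫ ω, η x ω ∂P = 0
  cov_eq : ∀ x y : ℝ, covariance (η x) (η y) P = cyclicCov κ w (x - y)

/-- The modified Bessel function of the second kind,
`K_ν(z) = ½ ∫₀^∞ s^(ν-1) exp(-½ (s + 1/s) z) ds` for `z > 0`. -/
def besselK (ν z : ℝ) : ℝ :=
  (1 / 2) * ∫ s in Set.Ioi (0 : ℝ), s ^ (ν - 1) * Real.exp (-(1 / 2) * (s + 1 / s) * z)

/-- `c₁(κ) = 2^((1-κ)/2) / (√π Γ(κ/2))`. -/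
def c₁ (κ : ℝ) : ℝ :=
  2 ^ ((1 - κ) / 2) / (√Real.pi * Real.Gamma (κ / 2))

/-- `c₂(κ) = (2 Γ(κ) cos(κπ/2))⁻¹`. -/
def c₂ (κ : ℝ) : ℝ :=
  (2 * Real.Gamma κ * Real.cos (κ * Real.pi / 2))⁻¹

/-- The function `θ_κ`, given by `1 - θ_κ(u) = (c₁(κ) / c₂(κ)) K_{(κ-1)/2}(u) u^((1-κ)/2)`, so
that `c₂(κ) (1 - θ_κ(|l|)) / |l|^(1-κ)` is the spectral density of `(1 + x²)^(-κ/2)`. -/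
def theta (κ u : ℝ) : ℝ :=
  1 - c₁ κ / c₂ κ * besselK ((κ - 1) / 2) u * u ^ ((1 - κ) / 2)

/-- The constant `c₂(κ) (1 - θ_κ(|w|)) / |w|^(1-κ)`. -/
def limitConst (κ w : ℝ) : ℝ :=
  c₂ κ / |w| ^ (1 - κ) * (1 - theta κ |w|)

/-- The index sets of a white noise on the line: Borel sets of finite Lebesgue measure. -/
abbrev FiniteBorel : Type :=
  {A : Set ℝ // MeasurableSet A ∧ volume A < ⊤}

/-- `W` is a complex Gaussian white noise random measure on the line, with Lebesgue control measure
and the symmetry `W(-A) = conj W(A)` under which the integrals of functions with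
`h(-l) = conj h(l)` are real. (Additivity follows from the covariance.) -/
structure IsWhiteNoise {Ω : Type*} [MeasurableSpace Ω] (P : Measure Ω)
    (W : Set ℝ → Ω → ℂ) : Prop where
  gaussian : IsGaussianProcess (fun A : FiniteBorel => W A.1) P
  mean_zero : ∀ A : FiniteBorel, ∫ ω, W A.1 ω ∂P = 0
  cov_eq : ∀ A B : FiniteBorel,
    ∫ ω, W A.1 ω * (starRingEnd ℂ) (W B.1 ω) ∂P = ((volume (A.1 ∩ B.1)).toReal : ℂ)
  symm : ∀ A : FiniteBorel,
    ∀ᵐ ω ∂P, W ((fun l : ℝ => -l) ⁻¹' A.1) ω = (starRingEnd ℂ) (W A.1 ω)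

/-- The integral `∑_z z W(s = z)` of a simple function `s` with respect to `W`. -/
def simpleIntegral {Ω : Type*} (W : Set ℝ → Ω → ℂ) (s : SimpleFunc ℝ ℂ) (ω : Ω) : ℂ :=
  ∑ z ∈ s.range, z * W (s ⁻¹' {z}) ω

/-- `X = ∫ h(l) W(dl)`: the random variable `X` is the mean-square limit of the integrals of
square integrable simple functions that converge to `h` in `L²(ℝ)`. -/
def IsWienerIntegral {Ω : Type*} [MeasurableSpace Ω] (P : Measure Ω)
    (W : Set ℝ → Ω → ℂ) (h : ℝ → ℂ) (X : Ω → ℂ) : Prop :=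
  MemLp h 2 volume ∧ MemLp X 2 P ∧ ∃ s : ℕ → SimpleFunc ℝ ℂ,
    (∀ n, MemLp (s n) 2 volume) ∧
    Tendsto (fun n => eLpNorm (fun l => s n l - h l) 2 volume) atTop (𝓝 0) ∧
    Tendsto (fun n => eLpNorm (fun ω => simpleIntegral W (s n) ω - X ω) 2 P) atTop (𝓝 0)

end

/-! The rescaled fields and the limit field are centred Gaussian, so weak convergence of
finite-dimensional laws reduces to convergence of covariances
(`tendstoInDistribution_of_tendsto_covariance`). Spectrally, Cov(u(t,x), u(t',x')) = ∫ cos(l(x-x'))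
Ĝ(t,l) Ĝ(t',l) φ(l) dl (`integral_frbeSolution_mul`), where φ = `cyclicDensity` is the spectral
density of η. Substituting ε^(β/α) l for l turns the exponent of the Mittag-Leffler function into μ
t^β |l|^α (1 + ε^(2β/α) l²)^(γ/2). The last factor tends to 1, and φ is eventually seen only at
frequency 0. There it is continuous, because its singularities sit at ±w ≠ 0, and its value is
`limitConst`; hence white noise in the limit. `tendsto_scaled_integral` cuts at |l| = δ: dominated
convergence inside, where φ is bounded, and O(ε^(β - β/α)) outside, which vanishes since α > 1.

The analysis of E_β rests on two facts. First, x ↦ E_β(-x) is completely monotone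
(`completelyMonotone_mlSeq`): its coefficients k!/Γ(βk+1) are limits of Euler products, each factor
of which preserves complete monotonicity. Second, termwise Beta integrals give one identity for a
fractional integral of E_β(-Lτ^β) (`integral_mittagLeffler_mul_sub_rpow`), which yields both the
Caputo equation and E_β(-x) ≤ C/x. Monotonicity upgrades the latter to decay of all derivatives
(`mlDeriv_decay`). These bounds permit two integrations by parts in the integral defining G, so
G(t,x) = O(1/(1+x²)) is integrable and Fourier inversion applies.

On the probabilistic side, ∫ h η is Gaussian because it lies in the L² closure of the span of the
η(y). The limit field comes from the isometric extension of the white noise integral, and it is real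
because its kernel is Hermitian. -/

/-! ### Entire exponential series and complete monotonicity. -/

section ExponentialSeries

/-- The exponential generating series `∑ₖ aₖ (-x)ᵏ / k!`. -/
noncomputable def expSeries (a : ℕ → ℝ) (x : ℝ) : ℝ :=
  ∑' k : ℕ, a k * ((-x) ^ k / k.factorial)

/-- The exponential generating series of `a` converges absolutely on the whole line. -/
def EntireSeq (a : ℕ → ℝ) : Prop :=
  ∀ A : ℝ, 0 ≤ A → Summable fun k : ℕ => |a k| * (A ^ k / k.factorial)

lemma EntireSeq.summable {a : ℕ → ℝ} (h : EntireSeq a) (x : ℝ) :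
    Summable fun k : ℕ => a k * ((-x) ^ k / k.factorial) := by
  refine Summable.of_norm ((h |x| (abs_nonneg x)).congr fun k => ?_)
  simp

lemma EntireSeq.mono {a b : ℕ → ℝ} (h : EntireSeq a) (hb : ∀ k, |b k| ≤ |a k|) :
    EntireSeq b := fun A hA =>
  Summable.of_nonneg_of_le (fun k => by positivity)
    (fun k => mul_le_mul_of_nonneg_right (hb k) (by positivity)) (h A hA)

/-- Majorant of the termwise differentiated series: `k ≤ 2 ^ k` absorbs the factor `k` into the
larger radius `2 * (A + 1)`. -/
lemma EntireSeq.mul_nat {a : ℕ → ℝ} (h : EntireSeq a) (A : ℝ) (hA : 0 ≤ A) :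
    Summable fun k : ℕ => |a k| * (k * A ^ (k - 1) / k.factorial) := by
  refine Summable.of_nonneg_of_le (fun k => by positivity) (fun k => ?_)
    (h (2 * (A + 1)) (by positivity))
  have h2 : (k : ℝ) ≤ 2 ^ k := by exact_mod_cast Nat.lt_two_pow_self.le
  have h3 : A ^ (k - 1) ≤ (A + 1) ^ k :=
    (pow_le_pow_left₀ hA (by linarith) _).trans
      (pow_le_pow_right₀ (by linarith) (Nat.sub_le k 1))
  gcongr
  rw [mul_pow]
  gcongr

lemma EntireSeq.shift {a : ℕ → ℝ} (h : EntireSeq a) : EntireSeq fun k => a (k + 1) := by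
  intro A hA
  refine ((summable_nat_add_iff 1).2 (h.mul_nat A hA)).congr fun k => ?_
  rw [Nat.factorial_succ]
  push_cast
  field_simp

lemma EntireSeq.shift_iter {a : ℕ → ℝ} (h : EntireSeq a) (j : ℕ) :
    EntireSeq fun k => a (k + j) := by
  induction j with
  | zero => simpa using h
  | succ j ih => simpa only [add_assoc, add_comm 1 j] using ih.shift

lemma hasDerivAt_expSeries {a : ℕ → ℝ} (h : EntireSeq a) (x : ℝ) :
    HasDerivAt (expSeries a) (-expSeries (fun k => a (k + 1)) x) x := by
  have hR : 0 ≤ |x| + 1 := by positivity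
  have key := hasDerivAt_tsum_of_isPreconnected (h.mul_nat (|x| + 1) hR)
    (Metric.isOpen_ball (x := (0 : ℝ)) (ε := |x| + 1))
    (convex_ball (0 : ℝ) (|x| + 1)).isPreconnected
    (g := fun (k : ℕ) (y : ℝ) => a k * ((-y) ^ k / k.factorial))
    (g' := fun (k : ℕ) (y : ℝ) => a k * ((k * (-y) ^ (k - 1) * (-1)) / k.factorial))
    (fun k y _ => by
      have h1 : HasDerivAt (fun y : ℝ => -y) (-1) y := hasDerivAt_neg y
      exact ((h1.pow k).div_const _).const_mul _)
    (fun k y hy => by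
      have hy' : |y| ≤ |x| + 1 := by simpa using (mem_ball_zero_iff.1 hy).le
      simp only [norm_mul, norm_div, Real.norm_eq_abs, abs_pow, abs_neg, abs_one, mul_one,
        Nat.abs_cast]
      gcongr)
    (Metric.mem_ball_self (by positivity)) (h.summable 0)
    (show x ∈ Metric.ball (0 : ℝ) (|x| + 1) by simp)
  convert! key using 1
  have hs : Summable fun k : ℕ => a k * ((k * (-x) ^ (k - 1) * (-1)) / k.factorial) := by
    refine Summable.of_norm ((h.mul_nat |x| (abs_nonneg x)).congr fun k => ?_)
    simp
  rw [hs.tsum_eq_zero_add, expSeries, ← tsum_neg]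
  simp only [CharP.cast_eq_zero, zero_mul, zero_div, mul_zero, zero_add]
  refine tsum_congr fun k => ?_
  rw [Nat.factorial_succ]
  push_cast
  field_simp

lemma expSeries_zero (a : ℕ → ℝ) : expSeries a 0 = a 0 := by
  rw [expSeries, tsum_eq_single 0]
  · simp
  · intro k hk
    simp [hk]

lemma EntireSeq.div_add {a : ℕ → ℝ} (h : EntireSeq a) {m : ℕ} (hm : 1 ≤ m) :
    EntireSeq fun k => a k / (m + k) := by
  refine h.mono fun k => ?_
  have : (1 : ℝ) ≤ m + k := by exact_mod_cast (by omega : 1 ≤ m + k)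
  rw [abs_div, abs_of_nonneg (by linarith : (0 : ℝ) ≤ m + k)]
  exact div_le_self (abs_nonneg _) this

/-- The operator m + x d/dx multiplies the k-th coefficient by m + k and so undoes the division; the
second series is minus the derivative of the first. -/
lemma expSeries_div_add {a : ℕ → ℝ} (h : EntireSeq a) {m : ℕ} (hm : 1 ≤ m) (x : ℝ) :
    m * expSeries (fun k => a k / (m + k)) x
      - x * expSeries (fun k => a (k + 1) / (m + (k + 1 : ℕ))) x = expSeries a x := by
  have hb := h.div_add hm
  have hs : Summable fun k : ℕ => (k : ℝ) * (a k / (m + k)) * ((-x) ^ k / k.factorial) := by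
    refine Summable.of_norm_bounded (h |x| (abs_nonneg x)) fun k => ?_
    have h0 : (0 : ℝ) < m + k := by exact_mod_cast (by omega : 0 < m + k)
    have h1 : (k : ℝ) / (m + k) ≤ 1 := by
      rw [div_le_one h0]; linarith [(Nat.cast_nonneg m : (0 : ℝ) ≤ m)]
    have h2 : ‖(k : ℝ) * (a k / (m + k)) * ((-x) ^ k / k.factorial)‖
        = (k / (m + k)) * (|a k| * (|x| ^ k / k.factorial)) := by
      simp only [norm_mul, norm_div, Real.norm_eq_abs, abs_pow, abs_neg, Nat.abs_cast,
        abs_of_pos h0]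
      ring
    rw [h2]
    exact mul_le_of_le_one_left (by positivity) h1
  have h1 : x * expSeries (fun k => a (k + 1) / (m + (k + 1 : ℕ))) x
      = -∑' k : ℕ, (k : ℝ) * (a k / (m + k)) * ((-x) ^ k / k.factorial) := by
    rw [hs.tsum_eq_zero_add, expSeries, ← tsum_mul_left]
    simp only [CharP.cast_eq_zero, zero_mul, zero_add]
    rw [← tsum_neg]
    refine tsum_congr fun k => ?_
    rw [Nat.factorial_succ, pow_succ]
    push_cast
    field_simp
  rw [h1, sub_neg_eq_add, expSeries, expSeries, ← tsum_mul_left,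
    ← ((hb.summable x).mul_left _).tsum_add hs]
  refine tsum_congr fun k => ?_
  have h0 : (m + k : ℝ) ≠ 0 := by exact_mod_cast (by omega : m + k ≠ 0)
  field_simp

/-- If f is the divided series, `expSeries_div_add` says (x^m f)' = x^(m-1) · `expSeries a` ≥ 0.
Since x^m f vanishes at 0, it is nonnegative on the half line; at x = 0 itself, f is read off from
the constant coefficient. -/
lemma expSeries_div_add_nonneg {a : ℕ → ℝ} (h : EntireSeq a)
    (hp : ∀ x, 0 ≤ x → 0 ≤ expSeries a x) {m : ℕ} (hm : 1 ≤ m) {x : ℝ} (hx : 0 ≤ x) :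
    0 ≤ expSeries (fun k => a k / (m + k)) x := by
  have hb := h.div_add hm
  have hd : ∀ y, HasDerivAt (fun y => y ^ m * expSeries (fun k => a k / (m + k)) y)
      (y ^ (m - 1) * expSeries a y) y := by
    intro y
    convert! (hasDerivAt_pow m y).mul (hasDerivAt_expSeries hb y) using 1
    rw [← expSeries_div_add h hm y]
    obtain ⟨n, rfl⟩ : ∃ n, m = n + 1 := ⟨m - 1, by omega⟩
    simp only [Nat.add_sub_cancel]
    ring
  have hmono : MonotoneOn (fun y => y ^ m * expSeries (fun k => a k / (m + k)) y)
      (Set.Ici 0) := by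
    refine monotoneOn_of_hasDerivWithinAt_nonneg (convex_Ici 0)
      (fun y _ => (hd y).continuousAt.continuousWithinAt)
      (fun y _ => (hd y).hasDerivWithinAt) fun y hy => ?_
    rw [interior_Ici] at hy
    exact mul_nonneg (pow_nonneg (le_of_lt hy) _) (hp y (le_of_lt hy))
  rcases hx.eq_or_lt with rfl | hx'
  · have h0 := hp 0 le_rfl
    rw [expSeries_zero] at h0 ⊢
    positivity
  · have := hmono (Set.mem_Ici.2 le_rfl) (Set.mem_Ici.2 hx) hx
    simp only [zero_pow (by omega : m ≠ 0), zero_mul] at this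
    exact nonneg_of_mul_nonneg_right this (by positivity)

/-- The function `expSeries a` is entire and all its derivatives alternate in sign on the
half line. -/
structure CompletelyMonotone (a : ℕ → ℝ) : Prop where
  entire : EntireSeq a
  nonneg : ∀ (j : ℕ) (x : ℝ), 0 ≤ x → 0 ≤ expSeries (fun k => a (k + j)) x

lemma completelyMonotone_pow {c : ℝ} (hc : 0 ≤ c) : CompletelyMonotone fun k => c ^ k where
  entire := fun A _ => (Real.summable_pow_div_factorial (c * A)).congr fun k => by
    rw [abs_of_nonneg (by positivity), mul_pow]; ring
  nonneg := fun j x _ => by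
    have : expSeries (fun k => c ^ (k + j)) x = c ^ j * Real.exp (-(c * x)) := by
      rw [expSeries, Real.exp_eq_exp_ℝ, NormedSpace.exp_eq_tsum_div, ← tsum_mul_left]
      refine tsum_congr fun k => ?_
      rw [show -(c * x) = c * -x by ring, mul_pow, pow_add]
      ring
    rw [this]
    positivity

/-- The multiplier is b + (1-b) m/(m+k), and m/(m+k) is the k-th moment of m y^(m-1) dy on [0,1]. On
functions it therefore acts as a convex combination of the identity and an average over dilations.
-/
lemma CompletelyMonotone.mul_mixture {a : ℕ → ℝ} (h : CompletelyMonotone a) {b : ℝ}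
    (hb : 0 ≤ b) (hb' : b ≤ 1) {m : ℕ} (hm : 1 ≤ m) :
    CompletelyMonotone fun k => a k * ((m + b * k) / (m + k)) where
  entire := by
    refine h.entire.mono fun k => ?_
    have h0 : (0 : ℝ) < m + k := by exact_mod_cast (by omega : 0 < m + k)
    rw [abs_mul]
    refine mul_le_of_le_one_right (abs_nonneg _) ?_
    rw [abs_of_nonneg (by positivity), div_le_one h0]
    nlinarith [(Nat.cast_nonneg k : (0 : ℝ) ≤ k)]
  nonneg := fun j x hx => by
    have ha := h.entire.shift_iter j
    have hd := ha.div_add (m := m + j) (by omega)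
    -- After j derivatives the denominator parameter becomes m + j while the weight stays (1-b) m.
    have : expSeries (fun k => a (k + j) * ((m + b * (k + j : ℕ)) / (m + (k + j : ℕ)))) x
        = b * expSeries (fun k => a (k + j)) x
          + (1 - b) * m * expSeries (fun k => a (k + j) / ((m + j : ℕ) + k)) x := by
      simp only [expSeries]
      rw [← tsum_mul_left, ← tsum_mul_left, ← ((ha.summable x).mul_left _).tsum_add
        ((hd.summable x).mul_left _)]
      refine tsum_congr fun k => ?_
      have h0 : (m + j + k : ℝ) ≠ 0 := by exact_mod_cast (by omega : m + j + k ≠ 0)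
      have h1 : (m + (k + j) : ℝ) ≠ 0 := by exact_mod_cast (by omega : m + (k + j) ≠ 0)
      push_cast
      field_simp
      ring
    rw [this]
    have h1 := h.nonneg j x hx
    have h2 := expSeries_div_add_nonneg ha (h.nonneg j) (m := m + j) (by omega) hx
    have h3 : 0 ≤ 1 - b := by linarith
    positivity

/-- The limiting coefficients dominate the approximants, so the series converge pointwise and the
signs survive. -/
lemma CompletelyMonotone.of_tendsto {a : ℕ → ℝ} {A : ℕ → ℕ → ℝ} (ha : EntireSeq a)
    (hA : ∀ N, CompletelyMonotone (A N)) (hle : ∀ᶠ N in atTop, ∀ k, |A N k| ≤ |a k|)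
    (hlim : ∀ k, Tendsto (fun N => A N k) atTop (𝓝 (a k))) : CompletelyMonotone a where
  entire := ha
  nonneg := fun j x hx => by
    refine ge_of_tendsto' (x := atTop) (f := fun N => expSeries (fun k => A N (k + j)) x) ?_
      (fun N => (hA N).nonneg j x hx)
    refine tendsto_tsum_of_dominated_convergence (ha.shift_iter j |x| (abs_nonneg x))
      (fun k => (hlim _).mul_const _) ?_
    filter_upwards [hle] with N hN k
    simp only [norm_mul, norm_div, Real.norm_eq_abs, abs_pow, abs_neg, Nat.abs_cast]
    exact mul_le_mul_of_nonneg_right (hN _) (by positivity)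

end ExponentialSeries

/-! ### Gamma function inequalities from log-convexity. -/

section Gamma

/-- By the functional equation the slope of log Γ over [a-1, a] is log(a-1); convexity bounds the
slope over [a, a+d] below by it. -/
lemma Real.Gamma_mul_rpow_le {a d : ℝ} (ha : 1 < a) (hd : 0 ≤ d) :
    Real.Gamma a * (a - 1) ^ d ≤ Real.Gamma (a + d) := by
  rcases hd.eq_or_lt with rfl | hd'
  · simp
  have h := Real.convexOn_log_Gamma.slope_mono_adjacent (x := a - 1) (y := a) (z := a + d)
    (Set.mem_Ioi.2 (by linarith)) (Set.mem_Ioi.2 (by linarith)) (by linarith) (by linarith)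
  have hG1 := Real.Gamma_pos_of_pos (show 0 < a - 1 by linarith)
  have hGa := Real.Gamma_pos_of_pos (show 0 < a by linarith)
  have hGad := Real.Gamma_pos_of_pos (show 0 < a + d by linarith)
  have h1 : Real.log (Real.Gamma a) = Real.log (a - 1) + Real.log (Real.Gamma (a - 1)) := by
    rw [← Real.log_mul (by linarith) hG1.ne', ← Real.Gamma_add_one (by linarith)]
    congr 2; ring
  simp only [Function.comp_apply, h1, sub_sub_cancel, div_one, add_sub_cancel_left,
    add_sub_cancel_right] at h
  rw [le_div_iff₀ hd', ← h1] at h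
  rw [← Real.log_le_log_iff (by positivity) hGad, Real.log_mul hGa.ne' (by positivity),
    Real.log_rpow (by linarith)]
  linarith

/-- Companion bound: the slope over [a, a+d] is at most the slope log(a+d) over [a+d, a+d+1]. -/
lemma Real.Gamma_add_le {a d : ℝ} (ha : 0 < a) (hd : 0 ≤ d) :
    Real.Gamma (a + d) ≤ Real.Gamma a * (a + d) ^ d := by
  rcases hd.eq_or_lt with rfl | hd'
  · simp
  have h := Real.convexOn_log_Gamma.slope_mono_adjacent (x := a) (y := a + d) (z := a + d + 1)
    (Set.mem_Ioi.2 (by linarith)) (Set.mem_Ioi.2 (by linarith)) (by linarith) (by linarith)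
  have hGa := Real.Gamma_pos_of_pos (show 0 < a by linarith)
  have hGad := Real.Gamma_pos_of_pos (show 0 < a + d by linarith)
  have h1 : Real.log (Real.Gamma (a + d + 1)) =
      Real.log (a + d) + Real.log (Real.Gamma (a + d)) := by
    rw [← Real.log_mul (by linarith) hGad.ne', ← Real.Gamma_add_one (by linarith)]
  simp only [Function.comp_apply, h1, add_sub_cancel_left, div_one,
    add_sub_cancel_right] at h
  rw [div_le_iff₀ hd'] at h
  rw [← Real.log_le_log_iff hGad (by positivity), Real.log_mul hGa.ne' (by positivity),
    Real.log_rpow (by linarith)]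
  linarith

lemma prod_add_eq_Gamma_div {s : ℝ} (hs : 0 ≤ s) (n : ℕ) :
    ∏ j ∈ Finset.range n, ((j + 1 : ℕ) + s) = Real.Gamma (n + 1 + s) / Real.Gamma (1 + s) := by
  have h0 := (Real.Gamma_pos_of_pos (show 0 < 1 + s by linarith)).ne'
  induction n with
  | zero => simp [h0]
  | succ n ih =>
    rw [Finset.prod_range_succ, ih, show ((n + 1 : ℕ) + 1 + s : ℝ) = (n + 1 + s) + 1 by
      push_cast; ring, Real.Gamma_add_one (by positivity)]
    push_cast
    ring

end Gamma

/-! ### Complete monotonicity of the Mittag-Leffler function. -/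

section MittagLeffler

/-- The moments `k! / Γ(βk + 1)` of the Mittag-Leffler distribution. -/
noncomputable def mlSeq (β : ℝ) (k : ℕ) : ℝ := k.factorial / Real.Gamma (β * k + 1)

lemma mittagLeffler_neg (β x : ℝ) : mittagLeffler β (-x) = expSeries (mlSeq β) x := by
  refine tsum_congr fun k => ?_
  have : (k.factorial : ℝ) ≠ 0 := by positivity
  rw [mlSeq]
  field_simp

lemma mlSeq_pos {β : ℝ} (hβ : 0 < β) (k : ℕ) : 0 < mlSeq β k :=
  div_pos (by positivity) (Real.Gamma_pos_of_pos (by positivity))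

lemma summable_pow_div_Gamma {β : ℝ} (hβ : 0 < β) {A : ℝ} (hA : 0 ≤ A) :
    Summable fun k : ℕ => A ^ k / Real.Gamma (β * k + 1) := by
  have hG : ∀ k : ℕ, 0 < Real.Gamma (β * k + 1) := fun k =>
    Real.Gamma_pos_of_pos (by positivity)
  have hpos : Summable fun k : ℕ => (A + 1) ^ k / Real.Gamma (β * k + 1) := by
    refine summable_of_ratio_test_tendsto_lt_one (l := 0) one_pos
      (.of_forall fun k => (div_pos (by positivity) (hG k)).ne') ?_
    have hlim : Tendsto (fun k : ℕ => (A + 1) * (β * k) ^ (-β)) atTop (𝓝 0) := by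
      rw [← mul_zero (A + 1)]
      refine Tendsto.const_mul _ ((tendsto_rpow_neg_atTop hβ).comp ?_)
      exact tendsto_natCast_atTop_atTop.const_mul_atTop hβ
    refine tendsto_of_tendsto_of_tendsto_of_le_of_le' tendsto_const_nhds hlim
      (.of_forall fun k => by positivity) ?_
    filter_upwards [eventually_ge_atTop 1] with k hk
    have hk' : (1 : ℝ) ≤ k := by exact_mod_cast hk
    have hbk : 0 < β * k := by positivity
    have h := Real.Gamma_mul_rpow_le (a := β * k + 1) (d := β) (by linarith) hβ.le
    rw [add_sub_cancel_right] at h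
    have hk1 : β * (k + 1 : ℕ) + 1 = β * k + 1 + β := by push_cast; ring
    have h1 := hG k
    have h2 := hG (k + 1)
    rw [Real.norm_of_nonneg (by positivity), Real.norm_of_nonneg (by positivity),
      Real.rpow_neg hbk.le, pow_succ, div_div_div_eq, ← div_eq_mul_inv,
      div_le_div_iff₀ (by positivity) (by positivity), hk1]
    calc (A + 1) ^ k * (A + 1) * Real.Gamma (β * k + 1) * (β * k) ^ β
        = ((A + 1) * (A + 1) ^ k) * (Real.Gamma (β * k + 1) * (β * k) ^ β) := by ring
      _ ≤ ((A + 1) * (A + 1) ^ k) * Real.Gamma (β * k + 1 + β) := by gcongr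
      _ = _ := by ring
  refine Summable.of_nonneg_of_le (fun k => div_nonneg (by positivity) (hG k).le)
    (fun k => ?_) hpos
  exact div_le_div_of_nonneg_right (pow_le_pow_left₀ hA (by linarith) _) (hG k).le

lemma entireSeq_mlSeq {β : ℝ} (hβ : 0 < β) : EntireSeq (mlSeq β) := by
  intro A hA
  refine (summable_pow_div_Gamma hβ hA).congr fun k => ?_
  rw [abs_of_pos (mlSeq_pos hβ k), mlSeq]
  field_simp

/-- Euler product approximations of `mlSeq`. -/
noncomputable def mlApprox (β : ℝ) (N k : ℕ) : ℝ :=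
  ((N : ℝ) ^ (1 - β)) ^ k * ∏ j ∈ Finset.range N, (((j + 1 : ℕ) + β * k) / ((j + 1 : ℕ) + k))

lemma completelyMonotone_mlApprox {β : ℝ} (hβ : 0 < β) (hβ' : β ≤ 1) (N : ℕ) :
    CompletelyMonotone (mlApprox β N) := by
  suffices h : ∀ n : ℕ, CompletelyMonotone fun k => ((N : ℝ) ^ (1 - β)) ^ k *
      ∏ j ∈ Finset.range n, (((j + 1 : ℕ) + β * k) / ((j + 1 : ℕ) + k)) from h N
  intro n
  induction n with
  | zero => simpa using completelyMonotone_pow (c := (N : ℝ) ^ (1 - β)) (by positivity)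
  | succ n ih =>
    simp only [Finset.prod_range_succ, ← mul_assoc]
    exact ih.mul_mixture hβ.le hβ' (by omega)

/-- Both products are Gamma quotients, and their denominators Γ(1+βk), Γ(1+k) form `mlSeq`. What
remains is a correction factor, at most 1 and tending to 1 by the two Gamma inequalities. -/
lemma mlApprox_eq {β : ℝ} (hβ : 0 < β) (N k : ℕ) :
    mlApprox β N k = mlSeq β k * ((N : ℝ) ^ ((1 - β) * k) *
      (Real.Gamma (N + 1 + β * k) / Real.Gamma (N + 1 + k))) := by
  have h1 := (Real.Gamma_pos_of_pos (show 0 < 1 + β * k by positivity)).ne'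
  have h2 := (Real.Gamma_pos_of_pos (show 0 < (N : ℝ) + 1 + k by positivity)).ne'
  rw [mlApprox, Finset.prod_div_distrib, prod_add_eq_Gamma_div (by positivity),
    prod_add_eq_Gamma_div (by positivity), mlSeq, Real.rpow_mul_natCast (by positivity),
    add_comm (1 : ℝ) (k : ℝ), Real.Gamma_nat_eq_factorial, add_comm (β * k) 1]
  field_simp

lemma mlApprox_le {β : ℝ} (hβ : 0 < β) (hβ' : β ≤ 1) {N : ℕ} (hN : 1 ≤ N) (k : ℕ) :
    mlApprox β N k ≤ mlSeq β k := by
  rw [mlApprox_eq hβ]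
  refine mul_le_of_le_one_right (mlSeq_pos hβ k).le ?_
  have hN' : (1 : ℝ) ≤ N := by exact_mod_cast hN
  have hbk : 0 ≤ β * k := by positivity
  have hd : 0 ≤ (1 - β) * k := mul_nonneg (by linarith) (by positivity)
  have h := Real.Gamma_mul_rpow_le (a := N + 1 + β * k) (d := (1 - β) * k) (by linarith) hd
  rw [show (N : ℝ) + 1 + β * k + (1 - β) * k = N + 1 + k by ring] at h
  have hG : 0 < Real.Gamma (N + 1 + k) := Real.Gamma_pos_of_pos (by positivity)
  have hG' : 0 < Real.Gamma (N + 1 + β * k) := Real.Gamma_pos_of_pos (by positivity)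
  rw [← mul_div_assoc, div_le_one hG, mul_comm]
  refine le_trans ?_ h
  gcongr
  linarith

lemma tendsto_mlApprox {β : ℝ} (hβ : 0 < β) (hβ' : β ≤ 1) (k : ℕ) :
    Tendsto (fun N => mlApprox β N k) atTop (𝓝 (mlSeq β k)) := by
  have hd : 0 ≤ (1 - β) * k := mul_nonneg (by linarith) (by positivity)
  have hlow : Tendsto (fun N : ℕ => mlSeq β k * ((N : ℝ) / (N + (1 + k))) ^ ((1 - β) * k)) atTop
      (𝓝 (mlSeq β k)) := by
    have h1 : Tendsto (fun N : ℕ => (N : ℝ) / (N + (1 + k))) atTop (𝓝 1) :=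
      tendsto_natCast_div_add_atTop _
    simpa using (h1.rpow_const (p := (1 - β) * k) (Or.inr hd)).const_mul (mlSeq β k)
  refine tendsto_of_tendsto_of_tendsto_of_le_of_le' hlow tendsto_const_nhds ?_ ?_
  · filter_upwards [eventually_ge_atTop 1] with N hN
    rw [mlApprox_eq hβ]
    have hN' : (1 : ℝ) ≤ N := by exact_mod_cast hN
    have hbk : 0 ≤ β * k := by positivity
    have h := Real.Gamma_add_le (a := N + 1 + β * k) (d := (1 - β) * k) (by linarith) hd
    rw [show (N : ℝ) + 1 + β * k + (1 - β) * k = N + (1 + k) by ring] at h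
    have hG : 0 < Real.Gamma (N + (1 + k)) := Real.Gamma_pos_of_pos (by positivity)
    have hs := mlSeq_pos hβ k
    gcongr
    rw [Real.div_rpow (by positivity) (by positivity), ← mul_div_assoc, add_assoc (N : ℝ) 1 k,
      div_le_div_iff₀ (by positivity) hG, mul_assoc]
    gcongr
  · filter_upwards [eventually_ge_atTop 1] with N hN using mlApprox_le hβ hβ' hN k

/-- Pollard's theorem, obtained from the Euler products without a representing measure. -/
lemma completelyMonotone_mlSeq {β : ℝ} (hβ : 0 < β) (hβ' : β ≤ 1) :
    CompletelyMonotone (mlSeq β) := by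
  refine CompletelyMonotone.of_tendsto (entireSeq_mlSeq hβ)
    (completelyMonotone_mlApprox hβ hβ') ?_ (tendsto_mlApprox hβ hβ')
  filter_upwards [eventually_ge_atTop 1] with N hN k
  have h0 : 0 ≤ mlApprox β N k := by
    refine mul_nonneg (by positivity) (Finset.prod_nonneg fun j _ => by positivity)
  rw [abs_of_nonneg h0, abs_of_pos (mlSeq_pos hβ k)]
  exact mlApprox_le hβ hβ' hN k

/-- The derivative of order `j` of `x ↦ E_β(-x)`, up to the sign `(-1)ʲ`. -/
noncomputable def mlDeriv (β : ℝ) (j : ℕ) (x : ℝ) : ℝ := expSeries (fun k => mlSeq β (k + j)) x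

lemma mlDeriv_zero (β x : ℝ) : mlDeriv β 0 x = mittagLeffler β (-x) := by
  rw [mittagLeffler_neg]; rfl

lemma hasDerivAt_mlDeriv {β : ℝ} (hβ : 0 < β) (j : ℕ) (x : ℝ) :
    HasDerivAt (mlDeriv β j) (-mlDeriv β (j + 1) x) x := by
  have := hasDerivAt_expSeries ((entireSeq_mlSeq hβ).shift_iter j) x
  simp only [add_assoc, add_comm 1 j] at this
  exact this

lemma continuous_mlDeriv {β : ℝ} (hβ : 0 < β) (j : ℕ) : Continuous (mlDeriv β j) :=
  continuous_iff_continuousAt.2 fun x => (hasDerivAt_mlDeriv hβ j x).continuousAt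

lemma mlDeriv_nonneg {β : ℝ} (hβ : 0 < β) (hβ' : β ≤ 1) (j : ℕ) {x : ℝ} (hx : 0 ≤ x) :
    0 ≤ mlDeriv β j x := (completelyMonotone_mlSeq hβ hβ').nonneg j x hx

lemma antitoneOn_mlDeriv {β : ℝ} (hβ : 0 < β) (hβ' : β ≤ 1) (j : ℕ) :
    AntitoneOn (mlDeriv β j) (Set.Ici 0) := by
  refine antitoneOn_of_hasDerivWithinAt_nonpos (convex_Ici 0)
    (continuous_mlDeriv hβ j).continuousOn
    (fun y _ => (hasDerivAt_mlDeriv hβ j y).hasDerivWithinAt) fun y hy => ?_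
  rw [interior_Ici] at hy
  exact neg_nonpos.2 (mlDeriv_nonneg hβ hβ' _ (le_of_lt hy))

lemma mlDeriv_le_zero_arg {β : ℝ} (hβ : 0 < β) (hβ' : β ≤ 1) (j : ℕ) {x : ℝ} (hx : 0 ≤ x) :
    mlDeriv β j x ≤ mlDeriv β j 0 :=
  antitoneOn_mlDeriv hβ hβ' j (Set.mem_Ici.2 le_rfl) (Set.mem_Ici.2 hx) hx

/-- Mean value inequality on [x/2, x]: the derivative of order j+1 is smallest in size at x, and the
total drop cannot exceed the value at x/2 because the value at x is nonnegative. -/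
lemma mlDeriv_succ_mul_le {β : ℝ} (hβ : 0 < β) (hβ' : β ≤ 1) (j : ℕ) {x : ℝ} (hx : 0 ≤ x) :
    x / 2 * mlDeriv β (j + 1) x ≤ mlDeriv β j (x / 2) := by
  have hc := Convex.mul_sub_le_image_sub_of_le_deriv (convex_Icc (x / 2) x)
    (f := fun y => -mlDeriv β j y) (C := mlDeriv β (j + 1) x)
    ((continuous_mlDeriv hβ j).neg.continuousOn)
    (fun y _ => (hasDerivAt_mlDeriv hβ j y).neg.differentiableAt.differentiableWithinAt)
    (fun y hy => by
      rw [interior_Icc] at hy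
      rw [(hasDerivAt_mlDeriv hβ j y).fun_neg.deriv, neg_neg]
      exact antitoneOn_mlDeriv hβ hβ' _ (Set.mem_Ici.2 (by linarith [hy.1])) (Set.mem_Ici.2 hx)
        hy.2.le)
    (x / 2) (Set.left_mem_Icc.2 (by linarith)) x (Set.right_mem_Icc.2 (by linarith))
    (by linarith)
  have := mlDeriv_nonneg hβ hβ' j hx
  linarith

end MittagLeffler

/-! ### Scaled Beta integrals on the real line. -/

section Beta

lemma integral_rpow_mul_sub_rpow {u v s : ℝ} (hu : 0 < u) (hv : 0 < v) (hs : 0 < s) :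
    ∫ x in (0 : ℝ)..s, x ^ (u - 1) * (s - x) ^ (v - 1)
      = s ^ (u + v - 1) * (Real.Gamma u * Real.Gamma v / Real.Gamma (u + v)) := by
  have h := Complex.betaIntegral_scaled (u : ℂ) (v : ℂ) hs
  rw [Complex.betaIntegral_eq_Gamma_mul_div _ _ (by simpa) (by simpa), ← Complex.ofReal_add,
    Complex.Gamma_ofReal, Complex.Gamma_ofReal, Complex.Gamma_ofReal] at h
  have h1 : ∫ x in (0 : ℝ)..s, ((x ^ (u - 1) * (s - x) ^ (v - 1) : ℝ) : ℂ)
      = ∫ x in (0 : ℝ)..s, (x : ℂ) ^ ((u : ℂ) - 1) * ((s : ℂ) - x) ^ ((v : ℂ) - 1) := by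
    refine intervalIntegral.integral_congr fun x hx => ?_
    rw [Set.uIcc_of_le hs.le] at hx
    have e1 := Complex.ofReal_cpow hx.1 (u - 1)
    have e2 := Complex.ofReal_cpow (sub_nonneg.2 hx.2) (v - 1)
    push_cast at e1 e2 ⊢
    rw [e1, e2]
  have h2 := Complex.ofReal_cpow hs.le (u + v - 1)
  rw [intervalIntegral.integral_ofReal] at h1
  rw [← h1] at h
  push_cast at h2 h
  rw [← h2] at h
  exact_mod_cast h

/-- A nonintegrable function has Bochner integral 0 by convention, whereas the Beta value is
positive. -/
lemma integrableOn_rpow_mul_sub_rpow {u v s : ℝ} (hu : 0 < u) (hv : 0 < v) (hs : 0 < s) :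
    IntegrableOn (fun x : ℝ => x ^ (u - 1) * (s - x) ^ (v - 1)) (Set.Ioc 0 s) := by
  by_contra hcon
  have h := integral_rpow_mul_sub_rpow hu hv hs
  rw [intervalIntegral.integral_of_le hs.le, integral_undef hcon] at h
  have h1 := Real.Gamma_pos_of_pos hu
  have h2 := Real.Gamma_pos_of_pos hv
  have h3 := Real.Gamma_pos_of_pos (add_pos hu hv)
  have : 0 < s ^ (u + v - 1) * (Real.Gamma u * Real.Gamma v / Real.Gamma (u + v)) := by
    positivity
  linarith

end Beta

/-! ### Fractional integrals of E_β and the Caputo equation. -/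

section FractionalIntegral

lemma mittagLeffler_mul_rpow {β : ℝ} (L : ℝ) {τ : ℝ} (hτ : 0 ≤ τ) :
    mittagLeffler β (-(L * τ ^ β)) = ∑' k : ℕ, (-L) ^ k * τ ^ (β * k) / Real.Gamma (β * k + 1) := by
  refine tsum_congr fun k => ?_
  rw [← neg_mul, mul_pow, Real.rpow_mul_natCast hτ]

lemma summable_pow_div_Gamma_add {β c : ℝ} (hβ : 0 < β) (hc : 0 < c) {A : ℝ} (hA : 0 ≤ A) :
    Summable fun k : ℕ => A ^ k / Real.Gamma (β * k + 1 + c) := by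
  refine Summable.of_norm_bounded_eventually_nat (summable_pow_div_Gamma hβ hA) ?_
  have hlim : Tendsto (fun k : ℕ => β * (k : ℝ)) atTop atTop :=
    tendsto_natCast_atTop_atTop.const_mul_atTop hβ
  filter_upwards [hlim.eventually_ge_atTop 1] with k hk
  have h0 := Real.Gamma_pos_of_pos (show 0 < β * k + 1 by linarith)
  have h1 := Real.Gamma_mul_rpow_le (a := β * k + 1) (by linarith) hc.le
  rw [add_sub_cancel_right] at h1
  have h2 : 1 ≤ (β * k) ^ c := Real.one_le_rpow hk hc.le
  have h3 : Real.Gamma (β * k + 1) ≤ Real.Gamma (β * k + 1 + c) := by nlinarith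
  rw [Real.norm_of_nonneg (div_nonneg (by positivity) (h0.le.trans h3))]
  gcongr

/-- Fractional integrals of the Mittag-Leffler function, termwise. -/
lemma hasSum_integral_mittagLeffler {β c : ℝ} (hβ : 0 < β) (hc : 0 < c) (L : ℝ) {s : ℝ}
    (hs : 0 < s) :
    HasSum (fun k : ℕ => Real.Gamma c * ((-L) ^ k * s ^ (β * k + c) / Real.Gamma (β * k + 1 + c)))
      (∫ τ in (0 : ℝ)..s, mittagLeffler β (-(L * τ ^ β)) * (s - τ) ^ (c - 1)) := by
  -- The exponent is kept as `(β * k + 1) - 1` to match the Beta integral with parameters βk + 1 and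
  -- c.
  set F : ℕ → ℝ → ℝ := fun k τ =>
    (-L) ^ k / Real.Gamma (β * k + 1) * (τ ^ ((β * k + 1) - 1) * (s - τ) ^ (c - 1)) with hF
  have hbk : ∀ k : ℕ, 0 < β * k + 1 := fun k => by positivity
  have hint : ∀ k, Integrable (F k) (volume.restrict (Set.Ioc 0 s)) := fun k =>
    (integrableOn_rpow_mul_sub_rpow (hbk k) hc hs).const_mul _
  have hval : ∀ k : ℕ, ∫ τ in Set.Ioc 0 s, (τ ^ ((β * k + 1) - 1) * (s - τ) ^ (c - 1))
      = s ^ (β * k + c) * (Real.Gamma (β * k + 1) * Real.Gamma c / Real.Gamma (β * k + 1 + c)) := by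
    intro k
    rw [← intervalIntegral.integral_of_le hs.le, integral_rpow_mul_sub_rpow (hbk k) hc hs]
    congr 2
    ring
  have hnorm : ∀ k : ℕ, ∫ τ in Set.Ioc 0 s, ‖F k τ‖
      = Real.Gamma c * s ^ c * ((|L| * s ^ β) ^ k / Real.Gamma (β * k + 1 + c)) := by
    intro k
    have hG := Real.Gamma_pos_of_pos (hbk k)
    have : ∀ τ ∈ Set.Ioc 0 s, ‖F k τ‖ =
        |L| ^ k / Real.Gamma (β * k + 1) * (τ ^ ((β * k + 1) - 1) * (s - τ) ^ (c - 1)) := by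
      intro τ hτ
      have h1 : 0 ≤ τ ^ ((β * k + 1) - 1) * (s - τ) ^ (c - 1) :=
        mul_nonneg (Real.rpow_nonneg hτ.1.le _) (Real.rpow_nonneg (sub_nonneg.2 hτ.2) _)
      rw [hF]
      simp only [norm_mul, norm_div, norm_pow, norm_neg, Real.norm_eq_abs, abs_of_pos hG]
      rw [← abs_mul, abs_of_nonneg h1]
    rw [setIntegral_congr_fun measurableSet_Ioc this, integral_const_mul, hval, mul_pow,
      ← Real.rpow_mul_natCast hs.le, Real.rpow_add hs]
    field_simp
  have h := hasSum_integral_of_summable_integral_norm hint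
    (((summable_pow_div_Gamma_add hβ hc (A := |L| * s ^ β) (by positivity)).mul_left
      (Real.Gamma c * s ^ c)).congr fun k => (hnorm k).symm)
  have hsum : ∫ τ in Set.Ioc 0 s, ∑' k, F k τ
      = ∫ τ in (0 : ℝ)..s, mittagLeffler β (-(L * τ ^ β)) * (s - τ) ^ (c - 1) := by
    rw [intervalIntegral.integral_of_le hs.le]
    refine setIntegral_congr_fun measurableSet_Ioc fun τ hτ => ?_
    simp only [hF]
    rw [mittagLeffler_mul_rpow L hτ.1.le, ← tsum_mul_right]
    refine tsum_congr fun k => ?_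
    rw [add_sub_cancel_right]
    ring
  rw [hsum] at h
  convert! h using 2 with k
  rw [integral_const_mul, hval]
  have hG := Real.Gamma_pos_of_pos (hbk k)
  field_simp

/-- In the termwise expansions, term k+1 of the left side is -Γ(1-β) L times term k of the plain
integral; term 0 is the explicit power of s. Differentiation in s gives the Caputo equation, and
positivity at s = 1 gives the decay of E_β. -/
lemma integral_mittagLeffler_mul_sub_rpow {β : ℝ} (hβ : 0 < β) (hβ' : β < 1) (L : ℝ) {s : ℝ}
    (hs : 0 < s) :
    ∫ τ in (0 : ℝ)..s, mittagLeffler β (-(L * τ ^ β)) * (s - τ) ^ ((1 - β) - 1)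
      = s ^ (1 - β) / (1 - β)
        - Real.Gamma (1 - β) * L * ∫ τ in (0 : ℝ)..s, mittagLeffler β (-(L * τ ^ β)) := by
  have h1 := hasSum_integral_mittagLeffler hβ (sub_pos.2 hβ') L hs
  have h2 := hasSum_integral_mittagLeffler hβ one_pos L hs
  simp only [sub_self, Real.rpow_zero, mul_one, Real.Gamma_one, one_mul] at h2
  have hb : (1 - β) ≠ 0 := by linarith
  have hG := (Real.Gamma_pos_of_pos (sub_pos.2 hβ')).ne'
  rw [← h1.tsum_eq, h1.summable.tsum_eq_zero_add,
    sub_eq_add_neg (s ^ (1 - β) / (1 - β)), ← neg_mul, ← h2.tsum_eq,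
    ← tsum_mul_left]
  congr 1
  · simp only [pow_zero, CharP.cast_eq_zero, mul_zero, zero_add, one_mul]
    rw [add_comm (1 : ℝ) (1 - β), Real.Gamma_add_one hb]
    field_simp
  · refine tsum_congr fun k => ?_
    push_cast
    rw [pow_succ, show β * ((k : ℝ) + 1) + (1 - β) = β * k + 1 by ring,
      show β * ((k : ℝ) + 1) + 1 + (1 - β) = β * k + 1 + 1 by ring]
    ring

lemma continuous_mittagLeffler_neg {β : ℝ} (hβ : 0 < β) :
    Continuous fun x => mittagLeffler β (-x) := by
  simpa only [← mlDeriv_zero] using continuous_mlDeriv hβ 0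

lemma mittagLeffler_zero (β : ℝ) : mittagLeffler β 0 = 1 := by
  have := mittagLeffler_neg β 0
  rw [neg_zero, expSeries_zero] at this
  simp [this, mlSeq]

lemma mittagLeffler_one (x : ℝ) : mittagLeffler 1 x = Real.exp x := by
  rw [mittagLeffler, Real.exp_eq_exp_ℝ, NormedSpace.exp_eq_tsum_div]
  refine tsum_congr fun k => ?_
  rw [one_mul, Real.Gamma_nat_eq_factorial]

/-- For β < 1 the derivative of s^(1-β)/(1-β) is exactly the subtracted term v(0) t^(-β), with v(0)
= 1; for β = 1 the function is an exponential. -/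
lemma hasCaputoDerivAt_mittagLeffler {β : ℝ} (hβ : 0 < β) (hβ' : β ≤ 1) (L : ℝ) {t : ℝ}
    (ht : 0 < t) :
    HasCaputoDerivAt β (fun s => mittagLeffler β (-(L * s ^ β)))
      (-(L * mittagLeffler β (-(L * t ^ β)))) t := by
  rw [HasCaputoDerivAt]
  split_ifs with h1
  · subst h1
    simp only [mittagLeffler_one, Real.rpow_one]
    have := (((hasDerivAt_id t).const_mul L).neg).exp
    convert! this using 1
    simp
    ring
  · have hβ1 : β < 1 := lt_of_le_of_ne hβ' h1
    have hcont : Continuous fun s : ℝ => mittagLeffler β (-(L * s ^ β)) :=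
      (continuous_mittagLeffler_neg hβ).comp
        (continuous_const.mul (Real.continuous_rpow_const hβ.le))
    have hd1 : HasDerivAt (fun s : ℝ => ∫ τ in (0 : ℝ)..s, mittagLeffler β (-(L * τ ^ β)))
        (mittagLeffler β (-(L * t ^ β))) t :=
      intervalIntegral.integral_hasDerivAt_right (hcont.intervalIntegrable _ _)
        hcont.stronglyMeasurable.stronglyMeasurableAtFilter hcont.continuousAt
    have hd2 : HasDerivAt (fun s : ℝ => s ^ (1 - β) / (1 - β)) (t ^ (-β)) t := by
      convert! (Real.hasDerivAt_rpow_const (p := 1 - β) (Or.inl ht.ne')).div_const (1 - β) using 1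
      have : (1 - β) ≠ 0 := by linarith
      rw [show 1 - β - 1 = -β by ring]
      field_simp
    have hd := hd2.sub (hd1.const_mul (Real.Gamma (1 - β) * L))
    have heq : (fun s : ℝ => ∫ τ in (0 : ℝ)..s, mittagLeffler β (-(L * τ ^ β)) / (s - τ) ^ β)
        =ᶠ[𝓝 t] (fun s : ℝ => s ^ (1 - β) / (1 - β) - Real.Gamma (1 - β) * L *
          ∫ τ in (0 : ℝ)..s, mittagLeffler β (-(L * τ ^ β))) := by
      filter_upwards [lt_mem_nhds ht] with s hs
      rw [← integral_mittagLeffler_mul_sub_rpow hβ hβ1 L hs]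
      refine intervalIntegral.integral_congr fun τ hτ => ?_
      rw [Set.uIcc_of_le hs.le] at hτ
      rw [show 1 - β - 1 = -β by ring, Real.rpow_neg (sub_nonneg.2 hτ.2), div_eq_mul_inv]
    refine (hd.congr_of_eventuallyEq heq).congr_deriv ?_
    rw [Real.zero_rpow hβ.ne', mul_zero, neg_zero, mittagLeffler_zero, Real.rpow_neg ht.le]
    ring

end FractionalIntegral

/-! ### Polynomial decay of E_β(-x) and its derivatives. -/

section Decay

/-- For β < 1 the fractional integral at s = 1 is nonnegative, so x ∫₀¹ E_β(-xτ^β) dτ is bounded.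
Since τ^β ≤ 1, monotonicity bounds that integral below by E_β(-x). -/
lemma mlDeriv_zero_mul_le {β : ℝ} (hβ : 0 < β) (hβ' : β ≤ 1) :
    ∃ C : ℝ, 0 < C ∧ ∀ x : ℝ, 0 ≤ x → x * mlDeriv β 0 x ≤ C := by
  rcases hβ'.eq_or_lt with rfl | hβ1
  · refine ⟨1, one_pos, fun x hx => ?_⟩
    rw [mlDeriv_zero, mittagLeffler_one, Real.exp_neg, ← div_eq_mul_inv,
      div_le_one (Real.exp_pos x)]
    linarith [Real.add_one_le_exp x]
  · have hG := Real.Gamma_pos_of_pos (sub_pos.2 hβ1)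
    have hb : 0 < 1 - β := sub_pos.2 hβ1
    refine ⟨1 / (1 - β) / Real.Gamma (1 - β), by positivity, fun x hx => ?_⟩
    have h := integral_mittagLeffler_mul_sub_rpow hβ hβ1 x one_pos
    rw [Real.one_rpow] at h
    have hnn : 0 ≤ ∫ τ in (0 : ℝ)..1, mittagLeffler β (-(x * τ ^ β)) * (1 - τ) ^ ((1 - β) - 1) := by
      refine intervalIntegral.integral_nonneg zero_le_one fun τ hτ => ?_
      rw [← mlDeriv_zero]
      exact mul_nonneg (mlDeriv_nonneg hβ hβ' 0 (mul_nonneg hx (Real.rpow_nonneg hτ.1 _)))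
        (Real.rpow_nonneg (sub_nonneg.2 hτ.2) _)
    have hcont : Continuous fun s : ℝ => mittagLeffler β (-(x * s ^ β)) :=
      (continuous_mittagLeffler_neg hβ).comp
        (continuous_const.mul (Real.continuous_rpow_const hβ.le))
    have hlow : mlDeriv β 0 x ≤ ∫ τ in (0 : ℝ)..1, mittagLeffler β (-(x * τ ^ β)) := by
      have : ∫ τ in (0 : ℝ)..1, mlDeriv β 0 x ≤
          ∫ τ in (0 : ℝ)..1, mittagLeffler β (-(x * τ ^ β)) := by
        refine intervalIntegral.integral_mono_on zero_le_one (by simp)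
          (hcont.intervalIntegrable _ _) fun τ hτ => ?_
        rw [← mlDeriv_zero]
        have h1 : τ ^ β ≤ 1 := Real.rpow_le_one hτ.1 hτ.2 hβ.le
        have h0 : 0 ≤ τ ^ β := Real.rpow_nonneg hτ.1 _
        exact antitoneOn_mlDeriv hβ hβ' 0 (Set.mem_Ici.2 (mul_nonneg hx h0)) (Set.mem_Ici.2 hx)
          (mul_le_of_le_one_right hx h1)
      simpa using this
    rw [h] at hnn
    rw [le_div_iff₀ hG]
    have : x * mlDeriv β 0 x * Real.Gamma (1 - β) ≤ Real.Gamma (1 - β) * x *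
        ∫ τ in (0 : ℝ)..1, mittagLeffler β (-(x * τ ^ β)) := by
      rw [mul_comm (x * _), ← mul_assoc]
      gcongr
    linarith

/-- Polynomial decay of the derivatives of `x ↦ E_β(-x)`. -/
lemma mlDeriv_decay {β : ℝ} (hβ : 0 < β) (hβ' : β ≤ 1) (j : ℕ) :
    ∃ C : ℝ, 0 < C ∧ ∀ x : ℝ, 0 ≤ x → x ^ (j + 1) * mlDeriv β j x ≤ C := by
  induction j with
  | zero => simpa using mlDeriv_zero_mul_le hβ hβ'
  | succ j ih =>
    obtain ⟨C, hC, h⟩ := ih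
    refine ⟨2 ^ (j + 2) * C, by positivity, fun x hx => ?_⟩
    have h1 := mlDeriv_succ_mul_le hβ hβ' j hx
    have h2 := h (x / 2) (by positivity)
    calc x ^ (j + 1 + 1) * mlDeriv β (j + 1) x
        = 2 ^ (j + 2) * ((x / 2) ^ (j + 1) * (x / 2 * mlDeriv β (j + 1) x)) := by
          rw [div_pow]; field_simp; ring
      _ ≤ 2 ^ (j + 2) * ((x / 2) ^ (j + 1) * mlDeriv β j (x / 2)) := by gcongr
      _ ≤ _ := by gcongr

lemma mlDeriv_bound {β : ℝ} (hβ : 0 < β) (hβ' : β ≤ 1) (j : ℕ) :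
    ∃ C : ℝ, 0 < C ∧ ∀ x : ℝ, 0 ≤ x →
      mlDeriv β j x ≤ C ∧ x ^ (j + 1) * mlDeriv β j x ≤ C := by
  obtain ⟨C, hC, h⟩ := mlDeriv_decay hβ hβ' j
  refine ⟨max C (mlDeriv β j 0), lt_max_of_lt_left hC, fun x hx => ⟨?_, ?_⟩⟩
  · exact (mlDeriv_le_zero_arg hβ hβ' j hx).trans (le_max_right _ _)
  · exact (h x hx).trans (le_max_left _ _)

end Decay

/-! ### The symbol on the half line and its logarithmic derivative. -/

section RadialSymbol

/-- The symbol `c l^α (1 + l²)^(γ/2)` on the half line. -/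
noncomputable def radialSymbol (c α γ l : ℝ) : ℝ := c * (l ^ α * (1 + l ^ 2) ^ (γ / 2))

/-- The logarithmic derivative of `radialSymbol`. -/
noncomputable def radialLogDeriv (α γ l : ℝ) : ℝ := α / l + γ * l / (1 + l ^ 2)

/-- The derivative of `radialLogDeriv`. -/
noncomputable def radialLogDeriv' (α γ l : ℝ) : ℝ :=
  -α / l ^ 2 + γ * (1 - l ^ 2) / (1 + l ^ 2) ^ 2

lemma greenFourier_eq (β μ α γ t l : ℝ) :
    greenFourier β μ α γ t l = mlDeriv β 0 (radialSymbol (μ * t ^ β) α γ |l|) := by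
  rw [greenFourier, mlDeriv_zero, frbeSymbol, radialSymbol, sq_abs]
  congr 2
  ring

variable {c α γ l : ℝ}

lemma radialSymbol_nonneg (hc : 0 ≤ c) (hl : 0 ≤ l) : 0 ≤ radialSymbol c α γ l := by
  have := Real.rpow_nonneg hl α
  unfold radialSymbol
  positivity

lemma rpow_le_radialSymbol (hc : 0 ≤ c) (hγ : 0 ≤ γ) (hl : 0 ≤ l) :
    c * l ^ α ≤ radialSymbol c α γ l := by
  have h1 : 1 ≤ (1 + l ^ 2) ^ (γ / 2) := Real.one_le_rpow (by nlinarith) (by positivity)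
  have h2 := Real.rpow_nonneg hl α
  exact mul_le_mul_of_nonneg_left (le_mul_of_one_le_right h2 h1) hc

lemma radialSymbol_le (hc : 0 ≤ c) (hγ : 0 ≤ γ) (hl : 0 ≤ l) (hl1 : l ≤ 1) :
    radialSymbol c α γ l ≤ c * 2 ^ (γ / 2) * l ^ α := by
  have h2 := Real.rpow_nonneg hl α
  have h1 : (1 + l ^ 2) ^ (γ / 2) ≤ 2 ^ (γ / 2) :=
    Real.rpow_le_rpow (by positivity) (by nlinarith) (by positivity)
  calc radialSymbol c α γ l ≤ c * (l ^ α * 2 ^ (γ / 2)) := by unfold radialSymbol; gcongr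
    _ = _ := by ring

lemma hasDerivAt_radialSymbol (hl : 0 < l) :
    HasDerivAt (radialSymbol c α γ) (radialSymbol c α γ l * radialLogDeriv α γ l) l := by
  have hp : 0 < 1 + l ^ 2 := by positivity
  have h1 := Real.hasDerivAt_rpow_const (x := l) (p := α) (Or.inl hl.ne')
  have h2 : HasDerivAt (fun l : ℝ => 1 + l ^ 2) (2 * l) l := by
    simpa using (hasDerivAt_pow 2 l).const_add 1
  have h3 := h2.rpow_const (p := γ / 2) (Or.inl hp.ne')
  refine ((h1.mul h3).const_mul c).congr_deriv ?_
  rw [radialSymbol, radialLogDeriv, Real.rpow_sub_one hl.ne', Real.rpow_sub_one hp.ne']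
  field_simp

lemma hasDerivAt_radialLogDeriv (hl : 0 < l) :
    HasDerivAt (radialLogDeriv α γ) (radialLogDeriv' α γ l) l := by
  have hp : 0 < 1 + l ^ 2 := by positivity
  have h1 := (hasDerivAt_inv hl.ne').const_mul α
  have h2 : HasDerivAt (fun l : ℝ => 1 + l ^ 2) (2 * l) l := by
    simpa using (hasDerivAt_pow 2 l).const_add 1
  have h3 : HasDerivAt (fun l : ℝ => γ * l) γ l := by
    simpa using (hasDerivAt_id l).const_mul γ
  refine (h1.add (h3.div h2 hp.ne')).congr_deriv ?_
  rw [radialLogDeriv']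
  field_simp
  ring

lemma radialLogDeriv_nonneg (hα : 0 ≤ α) (hγ : 0 ≤ γ) (hl : 0 < l) :
    0 ≤ radialLogDeriv α γ l := by
  unfold radialLogDeriv; positivity

lemma radialLogDeriv_le (hγ : 0 ≤ γ) (hl : 0 < l) :
    radialLogDeriv α γ l ≤ (α + γ) / l := by
  have : γ * l / (1 + l ^ 2) ≤ γ / l := by
    rw [div_le_div_iff₀ (by positivity) hl]
    nlinarith
  rw [radialLogDeriv, add_div]
  linarith

lemma abs_radialLogDeriv'_le (hα : 0 ≤ α) (hγ : 0 ≤ γ) (hl : 0 < l) :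
    |radialLogDeriv' α γ l| ≤ (α + γ) / l ^ 2 := by
  have h1 : |γ * (1 - l ^ 2) / (1 + l ^ 2) ^ 2| ≤ γ / l ^ 2 := by
    rw [abs_div, abs_of_pos (by positivity : 0 < (1 + l ^ 2) ^ 2), abs_mul, abs_of_nonneg hγ,
      div_le_div_iff₀ (by positivity) (by positivity), mul_assoc]
    have : |1 - l ^ 2| ≤ 1 + l ^ 2 := by rw [abs_le]; constructor <;> nlinarith [sq_nonneg l]
    have h2 : |1 - l ^ 2| * l ^ 2 ≤ (1 + l ^ 2) ^ 2 := by nlinarith [sq_nonneg l]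
    gcongr
  have h2 : |-α / l ^ 2| = α / l ^ 2 := by
    rw [abs_div, abs_neg, abs_of_nonneg hα, abs_of_pos (by positivity : 0 < l ^ 2)]
  rw [add_div, radialLogDeriv']
  exact (abs_add_le _ _).trans (by rw [h2]; linarith)

end RadialSymbol

/-! ### First and second derivatives of the radial Fourier profile. -/

section RadialProfile

/-- The derivative on the half line of `l ↦ E_β(-c l^α (1 + l²)^(γ/2))`. -/
noncomputable def radialProfile' (β c α γ l : ℝ) : ℝ :=
  -mlDeriv β 1 (radialSymbol c α γ l) * (radialSymbol c α γ l * radialLogDeriv α γ l)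

/-- The second derivative on the half line of `l ↦ E_β(-c l^α (1 + l²)^(γ/2))`. -/
noncomputable def radialProfile'' (β c α γ l : ℝ) : ℝ :=
  mlDeriv β 2 (radialSymbol c α γ l) * (radialSymbol c α γ l * radialLogDeriv α γ l) ^ 2
    - mlDeriv β 1 (radialSymbol c α γ l) * (radialSymbol c α γ l *
      (radialLogDeriv α γ l ^ 2 + radialLogDeriv' α γ l))

variable {β c α γ : ℝ}

lemma hasDerivAt_radialProfile (hβ : 0 < β) {l : ℝ} (hl : 0 < l) :
    HasDerivAt (fun l => mlDeriv β 0 (radialSymbol c α γ l)) (radialProfile' β c α γ l) l :=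
  (hasDerivAt_mlDeriv hβ 0 _).comp l (hasDerivAt_radialSymbol hl)

lemma hasDerivAt_radialProfile' (hβ : 0 < β) {l : ℝ} (hl : 0 < l) :
    HasDerivAt (radialProfile' β c α γ) (radialProfile'' β c α γ l) l := by
  have hX := hasDerivAt_radialSymbol (c := c) (α := α) (γ := γ) hl
  have h1 := ((hasDerivAt_mlDeriv hβ 1 _).comp l hX).neg
  refine (h1.mul (hX.mul (hasDerivAt_radialLogDeriv hl))).congr_deriv ?_
  simp only [radialProfile'', Function.comp_apply, Pi.neg_apply, Pi.mul_apply]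
  ring

/-- Bounds of the symbol-weighted derivatives of the Mittag-Leffler function. -/
lemma exists_mlDeriv_weighted_bound (hβ : 0 < β) (hβ' : β ≤ 1) :
    ∃ C : ℝ, 0 < C ∧ ∀ x : ℝ, 0 ≤ x →
      x * mlDeriv β 1 x ≤ C ∧ x * mlDeriv β 1 x ≤ C * x ∧
      x ^ 2 * mlDeriv β 2 x ≤ C ∧ x ^ 2 * mlDeriv β 2 x ≤ C * x := by
  obtain ⟨C1, hC1, h1⟩ := mlDeriv_bound hβ hβ' 1
  obtain ⟨C2, hC2, h2⟩ := mlDeriv_bound hβ hβ' 2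
  have key : ∀ x : ℝ, 0 ≤ x → x * mlDeriv β 1 x ≤ C1 ∧ x ^ 2 * mlDeriv β 2 x ≤ C2 ∧
      x ^ 2 * mlDeriv β 2 x ≤ C2 * x := by
    intro x hx
    obtain ⟨a1, b1⟩ := h1 x hx
    obtain ⟨a2, b2⟩ := h2 x hx
    norm_num at b1 b2
    have p1 := mlDeriv_nonneg hβ hβ' 1 hx
    have p2 := mlDeriv_nonneg hβ hβ' 2 hx
    -- Boundedness of the derivatives settles x ≤ 1, their decay settles x ≥ 1.
    rcases le_total x 1 with h | h
    · have hx2 : x ^ 2 ≤ x := by nlinarith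
      refine ⟨(mul_le_of_le_one_left p1 h).trans a1,
        (mul_le_of_le_one_left p2 (hx2.trans h)).trans a2, ?_⟩
      rw [mul_comm C2]
      exact mul_le_mul hx2 a2 p2 hx
    · have e1 : x * mlDeriv β 1 x ≤ x ^ 2 * mlDeriv β 1 x := by
        gcongr; nlinarith
      have e2 : x ^ 2 * mlDeriv β 2 x ≤ x ^ 3 * mlDeriv β 2 x :=
        mul_le_mul_of_nonneg_right (pow_le_pow_right₀ h (by norm_num)) p2
      refine ⟨e1.trans b1, e2.trans b2, (e2.trans b2).trans (le_mul_of_one_le_right hC2.le h)⟩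
  refine ⟨max C1 C2, lt_max_of_lt_left hC1, fun x hx => ?_⟩
  obtain ⟨k1, k2, k3⟩ := key x hx
  refine ⟨k1.trans (le_max_left _ _), ?_, k2.trans (le_max_right _ _), k3.trans ?_⟩
  · rw [mul_comm]
    exact mul_le_mul_of_nonneg_right ((h1 x hx).1.trans (le_max_left _ _)) hx
  · exact mul_le_mul_of_nonneg_right (le_max_right _ _) hx

/-- Each derivative of the logarithm of the symbol X costs 1/l, and the weighted derivatives X E'
and X² E'' are O(min(1, X)). Near 0 one uses X = O(l^α), elsewhere the constant bound. -/
lemma exists_radialProfile_bounds (hβ : 0 < β) (hβ' : β ≤ 1) (hc : 0 < c) (hα : 1 < α)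
    (hγ : 0 ≤ γ) :
    ∃ K : ℝ, 0 < K ∧ ∀ l : ℝ, 0 < l →
      (l ≤ 1 → |radialProfile' β c α γ l| ≤ K * l ^ (α - 1) ∧
        |radialProfile'' β c α γ l| ≤ K * l ^ (α - 2)) ∧
      |radialProfile' β c α γ l| ≤ K * l⁻¹ ∧ |radialProfile'' β c α γ l| ≤ K * l ^ (-2 : ℝ) := by
  obtain ⟨C, hC, hb⟩ := exists_mlDeriv_weighted_bound hβ hβ'
  set D : ℝ := α + γ with hD
  have hD1 : 1 < D := by linarith
  set E : ℝ := 1 + c * 2 ^ (γ / 2) with hE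
  have hE1 : 1 ≤ E := by
    have : 0 ≤ c * 2 ^ (γ / 2) := by positivity
    linarith
  -- The 3 adds the weights 1 and 2 of the two terms in `F2`; D² also covers the single D in `F1`. E
  -- bounds X / l^α on (0,1] and, being at least 1, is harmless in the other estimates.
  refine ⟨3 * C * D ^ 2 * E, by positivity, fun l hl => ?_⟩
  set X := radialSymbol c α γ l with hX
  have hX0 : 0 ≤ X := radialSymbol_nonneg hc.le hl.le
  obtain ⟨b1, b2, b3, b4⟩ := hb X hX0
  have m1 := mlDeriv_nonneg hβ hβ' 1 hX0
  have m2 := mlDeriv_nonneg hβ hβ' 2 hX0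
  have q0 := radialLogDeriv_nonneg (by linarith : 0 ≤ α) hγ hl
  have q1 : radialLogDeriv α γ l ≤ D / l := radialLogDeriv_le hγ hl
  have q2 : |radialLogDeriv' α γ l| ≤ D / l ^ 2 := abs_radialLogDeriv'_le (by linarith) hγ hl
  have qs : radialLogDeriv α γ l ^ 2 ≤ D ^ 2 / l ^ 2 := by
    rw [← div_pow]; exact pow_le_pow_left₀ q0 q1 2
  have q3 : |radialLogDeriv α γ l ^ 2 + radialLogDeriv' α γ l| ≤ 2 * D ^ 2 / l ^ 2 := by
    have : D / l ^ 2 ≤ D ^ 2 / l ^ 2 := by gcongr; nlinarith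
    calc _ ≤ |radialLogDeriv α γ l ^ 2| + |radialLogDeriv' α γ l| := abs_add_le _ _
      _ ≤ D ^ 2 / l ^ 2 + D ^ 2 / l ^ 2 := by
        rw [abs_of_nonneg (sq_nonneg _)]; linarith
      _ = _ := by ring
  have F1 : |radialProfile' β c α γ l| ≤ (X * mlDeriv β 1 X) * (D / l) := by
    rw [radialProfile', ← hX, abs_mul, abs_neg, abs_of_nonneg m1,
      abs_of_nonneg (mul_nonneg hX0 q0), mul_comm X, mul_assoc]
    calc _ = X * radialLogDeriv α γ l * mlDeriv β 1 X := by ring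
      _ ≤ X * (D / l) * mlDeriv β 1 X := by gcongr
      _ = _ := by ring
  have F2 : |radialProfile'' β c α γ l| ≤
      (X ^ 2 * mlDeriv β 2 X) * (D ^ 2 / l ^ 2) + (X * mlDeriv β 1 X) * (2 * D ^ 2 / l ^ 2) := by
    rw [radialProfile'', ← hX]
    refine (abs_sub _ _).trans (add_le_add ?_ ?_)
    · rw [abs_of_nonneg (by positivity), mul_pow]
      calc _ = (X ^ 2 * mlDeriv β 2 X) * radialLogDeriv α γ l ^ 2 := by ring
        _ ≤ _ := by gcongr
    · rw [abs_mul, abs_mul, abs_of_nonneg m1, abs_of_nonneg hX0]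
      calc _ = (X * mlDeriv β 1 X) * |radialLogDeriv α γ l ^ 2 + radialLogDeriv' α γ l| := by ring
        _ ≤ _ := by gcongr
  have hDD : D ≤ 3 * D ^ 2 := by nlinarith
  refine ⟨fun hl1 => ?_, ?_, ?_⟩
  · have hXle : X ≤ E * l ^ α := by
      refine (radialSymbol_le hc.le hγ hl.le hl1).trans ?_
      have := Real.rpow_nonneg hl.le α
      gcongr
      linarith
    constructor
    · rw [Real.rpow_sub_one hl.ne']
      calc _ ≤ (X * mlDeriv β 1 X) * (D / l) := F1
        _ ≤ (C * (E * l ^ α)) * (3 * D ^ 2 / l) := by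
          refine mul_le_mul (b2.trans (by gcongr)) (by gcongr) (by positivity) (by positivity)
        _ = _ := by ring
    · rw [Real.rpow_sub hl, Real.rpow_two]
      calc _ ≤ _ := F2
        _ ≤ (C * (E * l ^ α)) * (D ^ 2 / l ^ 2) + (C * (E * l ^ α)) * (2 * D ^ 2 / l ^ 2) := by
          refine add_le_add ?_ ?_
          · exact mul_le_mul_of_nonneg_right (b4.trans (by gcongr)) (by positivity)
          · exact mul_le_mul_of_nonneg_right (b2.trans (by gcongr)) (by positivity)
        _ = _ := by ring
  · calc _ ≤ (X * mlDeriv β 1 X) * (D / l) := F1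
      _ ≤ C * (3 * D ^ 2 / l) := by
        refine mul_le_mul b1 (by gcongr) (by positivity) hC.le
      _ = (3 * C * D ^ 2) * 1 * l⁻¹ := by rw [div_eq_mul_inv]; ring
      _ ≤ _ := by gcongr
  · rw [Real.rpow_neg hl.le, Real.rpow_two]
    calc _ ≤ _ := F2
      _ ≤ C * (D ^ 2 / l ^ 2) + C * (2 * D ^ 2 / l ^ 2) := by
        refine add_le_add ?_ ?_
        · exact mul_le_mul_of_nonneg_right b3 (by positivity)
        · exact mul_le_mul_of_nonneg_right b1 (by positivity)
      _ = (3 * C * D ^ 2) * 1 * (l ^ 2)⁻¹ := by rw [div_eq_mul_inv]; ring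
      _ ≤ _ := by gcongr

lemma measurable_radialProfile'' (hβ : 0 < β) : Measurable (radialProfile'' β c α γ) := by
  have h1 := (continuous_mlDeriv hβ 1).measurable
  have h2 := (continuous_mlDeriv hβ 2).measurable
  have hX : Measurable (radialSymbol c α γ) := by unfold radialSymbol; fun_prop
  have hq : Measurable (radialLogDeriv α γ) := by unfold radialLogDeriv; fun_prop
  have hq' : Measurable (radialLogDeriv' α γ) := by unfold radialLogDeriv'; fun_prop
  unfold radialProfile''
  fun_prop

/-- Here α > 1 is decisive: it makes l^(α-2) integrable at the origin. -/
lemma integrableOn_radialProfile'' (hβ : 0 < β) (hβ' : β ≤ 1) (hc : 0 < c) (hα : 1 < α)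
    (hγ : 0 ≤ γ) : IntegrableOn (radialProfile'' β c α γ) (Set.Ioi 0) := by
  obtain ⟨K, hK, hb⟩ := exists_radialProfile_bounds hβ hβ' hc hα hγ
  have hm := (measurable_radialProfile'' (c := c) (α := α) (γ := γ) hβ).aestronglyMeasurable
    (μ := volume)
  rw [← Set.Ioc_union_Ioi_eq_Ioi zero_le_one]
  refine IntegrableOn.union ?_ ?_
  · have h1 : IntegrableOn (fun l : ℝ => K * l ^ (α - 2)) (Set.Ioc 0 1) :=
      ((intervalIntegrable_iff_integrableOn_Ioc_of_le zero_le_one).1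
        (intervalIntegral.intervalIntegrable_rpow' (by linarith))).const_mul K
    refine Integrable.mono' h1 hm.restrict ?_
    refine (ae_restrict_iff' measurableSet_Ioc).2 (.of_forall fun l hl => ?_)
    exact ((hb l hl.1).1 hl.2).2
  · have h1 : IntegrableOn (fun l : ℝ => K * l ^ (-2 : ℝ)) (Set.Ioi 1) :=
      (integrableOn_Ioi_rpow_of_lt (by norm_num) one_pos).const_mul K
    refine Integrable.mono' h1 hm.restrict ?_
    refine (ae_restrict_iff' measurableSet_Ioi).2 (.of_forall fun l hl => ?_)
    exact (hb l (one_pos.trans hl)).2.2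

end RadialProfile

/-! ### Continuity, bounds and integrability of Ĝ. -/

section GreenFourier

variable {β μ α γ t : ℝ}

lemma continuous_greenFourier (hβ : 0 < β) (hα : 0 ≤ α) : Continuous (greenFourier β μ α γ t) := by
  have h1 : Continuous fun l : ℝ => |l| ^ α := (Real.continuous_rpow_const hα).comp continuous_abs
  have h2 : Continuous fun l : ℝ => (1 + l ^ 2) ^ (γ / 2) :=
    Continuous.rpow_const (by fun_prop) fun l => Or.inl (by positivity)
  exact (continuous_mittagLeffler_neg hβ).comp
    ((continuous_const.mul (h1.mul h2)).mul continuous_const)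

lemma greenFourier_nonneg (hβ : 0 < β) (hβ' : β ≤ 1) (hμ : 0 ≤ μ) (ht : 0 ≤ t) (l : ℝ) :
    0 ≤ greenFourier β μ α γ t l := by
  rw [greenFourier_eq]
  exact mlDeriv_nonneg hβ hβ' 0 (radialSymbol_nonneg (by positivity) (abs_nonneg l))

lemma greenFourier_neg (l : ℝ) : greenFourier β μ α γ t (-l) = greenFourier β μ α γ t l := by
  rw [greenFourier_eq, greenFourier_eq, abs_neg]

lemma mlDeriv_zero_le_one (hβ : 0 < β) (hβ' : β ≤ 1) {x : ℝ} (hx : 0 ≤ x) :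
    mlDeriv β 0 x ≤ 1 := by
  have h := mlDeriv_le_zero_arg hβ hβ' 0 hx
  rwa [mlDeriv_zero β 0, neg_zero, mittagLeffler_zero] at h

lemma greenFourier_le_one (hβ : 0 < β) (hβ' : β ≤ 1) (hμ : 0 ≤ μ) (ht : 0 ≤ t) (l : ℝ) :
    greenFourier β μ α γ t l ≤ 1 := by
  rw [greenFourier_eq]
  exact mlDeriv_zero_le_one hβ hβ' (radialSymbol_nonneg (by positivity) (abs_nonneg l))

/-- Decay of the Fourier transform of the Green function, uniformly in time. -/
lemma exists_greenFourier_decay (hβ : 0 < β) (hβ' : β ≤ 1) :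
    ∃ C : ℝ, 0 < C ∧ ∀ μ α γ t l : ℝ, 0 < μ → 0 ≤ γ → 0 < t →
      μ * t ^ β * |l| ^ α * greenFourier β μ α γ t l ≤ C := by
  obtain ⟨C, hC, hb⟩ := mlDeriv_zero_mul_le hβ hβ'
  refine ⟨C, hC, fun μ α γ t l hμ hγ ht => ?_⟩
  have hc : 0 ≤ μ * t ^ β := by positivity
  have h0 := radialSymbol_nonneg (α := α) (γ := γ) hc (abs_nonneg l)
  rw [greenFourier_eq]
  refine le_trans ?_ (hb _ h0)
  exact mul_le_mul_of_nonneg_right (rpow_le_radialSymbol hc hγ (abs_nonneg l))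
    (mlDeriv_nonneg hβ hβ' 0 h0)

lemma exists_greenFourier_le (hβ : 0 < β) (hβ' : β ≤ 1) (hμ : 0 < μ) (hα : 1 < α) (hγ : 0 ≤ γ)
    (ht : 0 < t) :
    ∃ K : ℝ, ∀ l : ℝ, greenFourier β μ α γ t l ≤ K * (1 + ‖l‖) ^ (-α) := by
  obtain ⟨C, hC, hb⟩ := exists_greenFourier_decay hβ hβ'
  have hc : 0 < μ * t ^ β := by positivity
  refine ⟨2 ^ α * (1 + C / (μ * t ^ β)), fun l => ?_⟩
  have hp : 0 < 1 + |l| := by positivity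
  rw [Real.norm_eq_abs, Real.rpow_neg hp.le, ← div_eq_mul_inv, le_div_iff₀ (by positivity)]
  have hg0 := greenFourier_nonneg (α := α) (γ := γ) hβ hβ' hμ.le ht.le l
  have hg1 := greenFourier_le_one (α := α) (γ := γ) hβ hβ' hμ.le ht.le l
  have hd := hb μ α γ t l hμ hγ ht
  have hq : 0 < C / (μ * t ^ β) := by positivity
  rcases le_total |l| 1 with h | h
  · have h2 : (1 + |l|) ^ α ≤ 2 ^ α := Real.rpow_le_rpow hp.le (by linarith) (by linarith)
    calc _ ≤ (1 : ℝ) * 2 ^ α := by gcongr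
      _ ≤ _ := by
        rw [mul_comm]
        exact mul_le_mul_of_nonneg_left (by linarith) (by positivity)
  · have h2 : (1 + |l|) ^ α ≤ 2 ^ α * |l| ^ α := by
      rw [← Real.mul_rpow (by norm_num) (abs_nonneg l)]
      exact Real.rpow_le_rpow hp.le (by linarith) (by linarith)
    have h3 : |l| ^ α * greenFourier β μ α γ t l ≤ C / (μ * t ^ β) := by
      rw [le_div_iff₀ hc]
      linarith
    calc _ ≤ greenFourier β μ α γ t l * (2 ^ α * |l| ^ α) := by gcongr
      _ = 2 ^ α * (|l| ^ α * greenFourier β μ α γ t l) := by ring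
      _ ≤ 2 ^ α * (C / (μ * t ^ β)) := by gcongr
      _ ≤ _ := by gcongr; linarith

lemma integrable_greenFourier (hβ : 0 < β) (hβ' : β ≤ 1) (hμ : 0 < μ) (hα : 1 < α) (hγ : 0 ≤ γ)
    (ht : 0 < t) : Integrable (greenFourier β μ α γ t) := by
  obtain ⟨K, hK⟩ := exists_greenFourier_le hβ hβ' hμ hα hγ ht
  refine Integrable.mono' ((integrable_one_add_norm (E := ℝ) (r := α) (by simpa)).const_mul K)
    (continuous_greenFourier hβ (by linarith)).aestronglyMeasurable (.of_forall fun l => ?_)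
  rw [Real.norm_of_nonneg (greenFourier_nonneg hβ hβ' hμ.le ht.le l)]
  exact hK l

lemma tendsto_greenFourier_atTop (hβ : 0 < β) (hβ' : β ≤ 1) (hμ : 0 < μ) (hα : 1 < α)
    (hγ : 0 ≤ γ) (ht : 0 < t) : Tendsto (greenFourier β μ α γ t) atTop (𝓝 0) := by
  obtain ⟨K, hK⟩ := exists_greenFourier_le hβ hβ' hμ hα hγ ht
  refine tendsto_of_tendsto_of_tendsto_of_le_of_le tendsto_const_nhds ?_
    (greenFourier_nonneg hβ hβ' hμ.le ht.le) hK
  rw [← mul_zero K]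
  refine Tendsto.const_mul K ((tendsto_rpow_neg_atTop (by linarith)).comp ?_)
  exact tendsto_atTop_add_const_left _ _ tendsto_norm_atTop_atTop

end GreenFourier

/-! ### Integrability of the Green function. -/

section GreenFunction

variable {β μ α γ t : ℝ}

/-- Two integrations by parts for the cosine transform. -/
lemma integral_cos_mul_radialProfile (hβ : 0 < β) (hβ' : β ≤ 1) (hμ : 0 < μ) (hα : 1 < α)
    (hγ : 0 ≤ γ) (ht : 0 < t) {x : ℝ} (hx : x ≠ 0) :
    ∫ l in Set.Ioi (0 : ℝ), (Real.cos (l * x) * mlDeriv β 0 (radialSymbol (μ * t ^ β) α γ l)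
      + Real.cos (l * x) / x ^ 2 * radialProfile'' β (μ * t ^ β) α γ l) = 0 := by
  set c := μ * t ^ β with hc'
  have hc : 0 < c := by positivity
  obtain ⟨K, hK, hb⟩ := exists_radialProfile_bounds hβ hβ' hc hα hγ
  have hFeq : ∀ l : ℝ, 0 ≤ l → mlDeriv β 0 (radialSymbol c α γ l) = greenFourier β μ α γ t l := by
    intro l hl
    rw [greenFourier_eq, abs_of_nonneg hl]
  have hx2 : 0 < x ^ 2 := by positivity
  -- Division by zero makes the logarithmic derivative 0 at the origin; the resulting value 0 agrees
  -- with the right limit of the derivative, since α > 1.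
  have hzero : radialProfile' β c α γ 0 = 0 := by
    simp [radialProfile', radialLogDeriv]
  -- Both integrations by parts at once: in the derivative of F sin(lx)/x + F' cos(lx)/x² the sine
  -- terms cancel. This primitive vanishes at 0 and at infinity.
  have key := integral_Ioi_of_hasDerivAt_of_tendsto (a := (0 : ℝ)) (m := 0)
    (f := fun l => Real.sin (l * x) / x * mlDeriv β 0 (radialSymbol c α γ l)
      + Real.cos (l * x) / x ^ 2 * radialProfile' β c α γ l)
    (f' := fun l => Real.cos (l * x) * mlDeriv β 0 (radialSymbol c α γ l)
      + Real.cos (l * x) / x ^ 2 * radialProfile'' β c α γ l) ?_ ?_ ?_ ?_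
  · rw [key]
    simp [hzero]
  · refine ContinuousWithinAt.add ?_ ?_
    · refine ContinuousWithinAt.congr (f := fun l => Real.sin (l * x) / x * greenFourier β μ α γ t l)
        ?_ (fun l hl => by rw [hFeq l hl]) (by rw [hFeq 0 le_rfl])
      exact (((Real.continuous_sin.comp (continuous_mul_const x)).div_const x).mul
        (continuous_greenFourier hβ (by linarith))).continuousWithinAt
    · refine ContinuousWithinAt.mul (by fun_prop) ?_
      rw [ContinuousWithinAt, hzero]
      have hlim : Tendsto (fun l : ℝ => K * l ^ (α - 1)) (𝓝[Set.Ici 0] 0) (𝓝 0) := by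
        have : ContinuousAt (fun l : ℝ => K * l ^ (α - 1)) 0 :=
          (continuous_const.mul (Real.continuous_rpow_const (by linarith))).continuousAt
        have h2 := this.tendsto.mono_left (nhdsWithin_le_nhds (s := Set.Ici 0))
        simpa [Real.zero_rpow (by linarith : α - 1 ≠ 0)] using h2
      refine squeeze_zero_norm' ?_ hlim
      filter_upwards [self_mem_nhdsWithin, mem_nhdsWithin_of_mem_nhds (Iic_mem_nhds one_pos)]
        with l hl hl1
      rcases (Set.mem_Ici.1 hl).eq_or_lt with rfl | hl0
      · rw [hzero, norm_zero]
        positivity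
      · exact ((hb l hl0).1 hl1).1
  · intro l hl
    have hs : HasDerivAt (fun l : ℝ => Real.sin (l * x) / x) (Real.cos (l * x)) l := by
      have := ((hasDerivAt_mul_const x (x := l)).sin).div_const x
      convert! this using 1
      field_simp
    have hcs : HasDerivAt (fun l : ℝ => Real.cos (l * x) / x ^ 2) (-(Real.sin (l * x) / x)) l := by
      have := ((hasDerivAt_mul_const x (x := l)).cos).div_const (x ^ 2)
      convert! this using 1
      field_simp
    refine ((hs.mul (hasDerivAt_radialProfile hβ hl)).add
      (hcs.mul (hasDerivAt_radialProfile' hβ hl))).congr_deriv ?_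
    ring
  · refine Integrable.add ?_ ?_
    · have h1 : IntegrableOn (fun l => Real.cos (l * x) * greenFourier β μ α γ t l) (Set.Ioi 0) :=
        ((integrable_greenFourier hβ hβ' hμ hα hγ ht).bdd_mul (c := 1) (by fun_prop)
          (.of_forall fun l => Real.abs_cos_le_one _)).integrableOn
      refine h1.congr_fun (fun l hl => ?_) measurableSet_Ioi
      simp only [hFeq l (le_of_lt hl)]
    · refine (integrableOn_radialProfile'' hβ hβ' hc hα hγ).bdd_mul (c := 1 / x ^ 2)
        (by fun_prop) (.of_forall fun l => ?_)
      rw [norm_div, Real.norm_of_nonneg hx2.le]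
      gcongr
      exact Real.abs_cos_le_one _
  · have h1 : Tendsto (fun l => Real.sin (l * x) / x * mlDeriv β 0 (radialSymbol c α γ l)) atTop
        (𝓝 0) := by
      have h2 := tendsto_greenFourier_atTop hβ hβ' hμ hα hγ ht
      have h3 := (h2.const_mul (1 / |x|))
      rw [mul_zero] at h3
      refine squeeze_zero_norm' ?_ h3
      filter_upwards [eventually_ge_atTop 0] with l hl
      rw [hFeq l hl, norm_mul, norm_div, Real.norm_of_nonneg
        (greenFourier_nonneg hβ hβ' hμ.le ht.le l), Real.norm_eq_abs x]
      have := greenFourier_nonneg (α := α) (γ := γ) hβ hβ' hμ.le ht.le l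
      gcongr
      exact Real.abs_sin_le_one _
    have h2 : Tendsto (fun l => Real.cos (l * x) / x ^ 2 * radialProfile' β c α γ l) atTop
        (𝓝 0) := by
      have h3 := (tendsto_inv_atTop_zero (𝕜 := ℝ)).const_mul (1 / x ^ 2 * K)
      rw [mul_zero] at h3
      refine squeeze_zero_norm' ?_ h3
      filter_upwards [eventually_gt_atTop 0] with l hl
      rw [norm_mul, norm_div, Real.norm_of_nonneg hx2.le, mul_assoc]
      gcongr
      · exact Real.abs_cos_le_one _
      · exact (hb l hl).2.1
    simpa using h1.add h2

/-- Sum of two estimates: |G| is bounded by the L¹ norm of Ĝ, and x²|G| by that of its second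
derivative through the integrated identity. -/
lemma exists_greenFunction_bound (hβ : 0 < β) (hβ' : β ≤ 1) (hμ : 0 < μ) (hα : 1 < α)
    (hγ : 0 ≤ γ) (ht : 0 < t) :
    ∃ K : ℝ, ∀ x : ℝ, |greenFunction β μ α γ t x| ≤ K * (1 + x ^ 2)⁻¹ := by
  set c := μ * t ^ β with hc'
  have hc : 0 < c := by positivity
  have hint := integrable_greenFourier hβ hβ' hμ hα hγ ht
  set A := ∫ l, greenFourier β μ α γ t l with hA
  set B := 2 * ∫ l in Set.Ioi (0 : ℝ), |radialProfile'' β c α γ l| with hB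
  have hA0 : 0 ≤ A := integral_nonneg (greenFourier_nonneg hβ hβ' hμ.le ht.le)
  have hB0 : 0 ≤ B := mul_nonneg zero_le_two (integral_nonneg fun l => abs_nonneg _)
  have hpi : (2 * Real.pi)⁻¹ ≤ 1 := inv_le_one_of_one_le₀ (by linarith [Real.pi_gt_three])
  have hpi0 : 0 ≤ (2 * Real.pi)⁻¹ := by positivity
  have h1 : ∀ x, |greenFunction β μ α γ t x| ≤ A := by
    intro x
    rw [greenFunction, abs_mul, abs_of_nonneg hpi0]
    refine (mul_le_of_le_one_left (abs_nonneg _) hpi).trans ?_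
    rw [← Real.norm_eq_abs]
    refine norm_integral_le_of_norm_le hint (.of_forall fun l => ?_)
    rw [norm_mul, Real.norm_of_nonneg (greenFourier_nonneg hβ hβ' hμ.le ht.le l)]
    exact mul_le_of_le_one_left (greenFourier_nonneg hβ hβ' hμ.le ht.le l)
      (Real.abs_cos_le_one _)
  have h2 : ∀ x, x ^ 2 * |greenFunction β μ α γ t x| ≤ B := by
    intro x
    rcases eq_or_ne x 0 with rfl | hx
    · simpa using hB0
    have hx2 : 0 < x ^ 2 := by positivity
    have hP := integrableOn_radialProfile'' hβ hβ' hc hα hγ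
    have hI2 : IntegrableOn (fun l => Real.cos (l * x) / x ^ 2 * radialProfile'' β c α γ l)
        (Set.Ioi 0) := by
      refine hP.bdd_mul (c := 1 / x ^ 2) (by fun_prop) (.of_forall fun l => ?_)
      rw [norm_div, Real.norm_of_nonneg hx2.le]
      gcongr
      exact Real.abs_cos_le_one _
    have hI1 : IntegrableOn (fun l => Real.cos (l * x) * mlDeriv β 0 (radialSymbol c α γ l))
        (Set.Ioi 0) := by
      have h1 : IntegrableOn (fun l => Real.cos (l * x) * greenFourier β μ α γ t l) (Set.Ioi 0) :=
        (hint.bdd_mul (c := 1) (by fun_prop)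
          (.of_forall fun l => Real.abs_cos_le_one _)).integrableOn
      refine h1.congr_fun (fun l hl => ?_) measurableSet_Ioi
      simp only [greenFourier_eq, abs_of_pos (Set.mem_Ioi.1 hl), hc']
    have hzero := integral_cos_mul_radialProfile hβ hβ' hμ hα hγ ht hx
    rw [integral_add hI1 hI2] at hzero
    have habs : ∫ l : ℝ, Real.cos (l * x) * greenFourier β μ α γ t l
        = 2 * ∫ l in Set.Ioi (0 : ℝ), Real.cos (l * x) * mlDeriv β 0 (radialSymbol c α γ l) := by
      rw [← integral_comp_abs (f := fun l => Real.cos (l * x) * mlDeriv β 0 (radialSymbol c α γ l))]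
      refine integral_congr_ae (.of_forall fun l => ?_)
      simp only [greenFourier_eq, hc']
      congr 1
      rcases abs_choice l with h | h <;> rw [h]
      rw [neg_mul, Real.cos_neg]
    have hbd : |∫ l in Set.Ioi (0 : ℝ), Real.cos (l * x) / x ^ 2 * radialProfile'' β c α γ l|
        ≤ 1 / x ^ 2 * ∫ l in Set.Ioi (0 : ℝ), |radialProfile'' β c α γ l| := by
      rw [← integral_const_mul, ← Real.norm_eq_abs]
      refine norm_integral_le_of_norm_le (hP.abs.const_mul _) (.of_forall fun l => ?_)
      rw [norm_mul, norm_div, Real.norm_of_nonneg hx2.le]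
      gcongr
      · exact Real.abs_cos_le_one _
      · exact le_of_eq (Real.norm_eq_abs _)
    rw [greenFunction, habs, eq_neg_of_add_eq_zero_left hzero, abs_mul, abs_of_nonneg hpi0, abs_mul,
      abs_neg, abs_two]
    calc _ ≤ x ^ 2 * (1 * (2 * (1 / x ^ 2 *
          ∫ l in Set.Ioi (0 : ℝ), |radialProfile'' β c α γ l|))) := by gcongr
      _ = B := by rw [hB]; field_simp
  refine ⟨A + B, fun x => ?_⟩
  rw [← div_eq_mul_inv, le_div_iff₀ (by positivity)]
  nlinarith [h1 x, h2 x]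

lemma continuous_greenFunction (hβ : 0 < β) (hβ' : β ≤ 1) (hμ : 0 < μ) (hα : 1 < α)
    (hγ : 0 ≤ γ) (ht : 0 < t) : Continuous (greenFunction β μ α γ t) := by
  refine continuous_const.mul (continuous_of_dominated (bound := greenFourier β μ α γ t)
    (fun x => ?_) (fun x => .of_forall fun l => ?_) (integrable_greenFourier hβ hβ' hμ hα hγ ht)
    (.of_forall fun l => by fun_prop))
  · exact ((by fun_prop : Continuous fun l : ℝ => Real.cos (l * x)).mul
      (continuous_greenFourier hβ (by linarith))).aestronglyMeasurable
  · rw [norm_mul, Real.norm_of_nonneg (greenFourier_nonneg hβ hβ' hμ.le ht.le l)]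
    exact mul_le_of_le_one_left (greenFourier_nonneg hβ hβ' hμ.le ht.le l)
      (Real.abs_cos_le_one _)

lemma integrable_greenFunction (hβ : 0 < β) (hβ' : β ≤ 1) (hμ : 0 < μ) (hα : 1 < α)
    (hγ : 0 ≤ γ) (ht : 0 < t) : Integrable (greenFunction β μ α γ t) := by
  obtain ⟨K, hK⟩ := exists_greenFunction_bound hβ hβ' hμ hα hγ ht
  exact Integrable.mono' (integrable_inv_one_add_sq.const_mul K)
    (continuous_greenFunction hβ hβ' hμ hα hγ ht).aestronglyMeasurable (.of_forall hK)

end GreenFunction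

/-! ### Fourier inversion for the Green function. -/

section Fourier

lemma integral_exp_mul_even {F : ℝ → ℝ} (hF : Integrable F) (heven : ∀ l, F (-l) = F l) (θ : ℝ) :
    ∫ l : ℝ, Complex.exp (Complex.I * l * θ) * (F l : ℂ)
      = ((∫ l : ℝ, Real.cos (l * θ) * F l : ℝ) : ℂ) := by
  have hnorm : ∀ s l : ℝ, ‖Complex.exp (Complex.I * l * s)‖ = 1 := fun s l => by
    rw [show Complex.I * l * s = ((l * s : ℝ) : ℂ) * Complex.I by push_cast; ring,
      Complex.norm_exp_ofReal_mul_I]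
  have hI : ∀ s : ℝ, Integrable fun l : ℝ => Complex.exp (Complex.I * l * s) * (F l : ℂ) :=
    fun s => hF.ofReal.bdd_mul (c := 1) (by fun_prop) (.of_forall fun l => (hnorm s l).le)
  have h1 : ∫ l : ℝ, Complex.exp (Complex.I * l * θ) * (F l : ℂ)
      = ∫ l : ℝ, Complex.exp (Complex.I * l * (-θ : ℝ)) * (F l : ℂ) := by
    rw [← integral_neg_eq_self]
    refine integral_congr_ae (.of_forall fun l => ?_)
    simp only [heven]
    push_cast
    congr 2
    ring
  have h2 : ∫ l : ℝ, Complex.exp (Complex.I * l * θ) * (F l : ℂ)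
      = (1 / 2) * ((∫ l : ℝ, Complex.exp (Complex.I * l * θ) * (F l : ℂ))
        + ∫ l : ℝ, Complex.exp (Complex.I * l * (-θ : ℝ)) * (F l : ℂ)) := by
    rw [← h1]; ring
  rw [h2, ← integral_add (hI θ) (hI (-θ)), ← integral_const_mul, ← integral_complex_ofReal]
  refine integral_congr_ae (.of_forall fun l => ?_)
  simp only
  push_cast
  rw [Complex.cos, show Complex.I * l * θ = l * θ * Complex.I by ring,
    show Complex.I * l * -θ = -(l * θ) * Complex.I by ring]
  ring

variable {β μ α γ t : ℝ}

-- Fourier inversion for the continuous integrable Ĝ. Its transform in the normalization e^(-2πi lξ)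
-- is 2π G(t, 2πξ), integrable by the quadratic decay of G; a change of variables removes the
-- factors 2π.
open scoped FourierTransform in
lemma fourier_greenFunction (hβ : 0 < β) (hβ' : β ≤ 1) (hμ : 0 < μ) (hα : 1 < α)
    (hγ : 0 ≤ γ) (ht : 0 < t) (l : ℝ) :
    ∫ x : ℝ, (greenFunction β μ α γ t x : ℂ) * Complex.exp (Complex.I * x * l)
      = (greenFourier β μ α γ t l : ℂ) := by
  set F : ℝ → ℂ := fun l => (greenFourier β μ α γ t l : ℂ) with hF
  have hint := integrable_greenFourier hβ hβ' hμ hα hγ ht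
  have hFc : Continuous F :=
    Complex.continuous_ofReal.comp (continuous_greenFourier hβ (by linarith))
  have hpi : (2 * Real.pi) ≠ 0 := by positivity
  have hG : ∀ ξ : ℝ, 𝓕 F ξ = (2 * Real.pi : ℝ) * (greenFunction β μ α γ t (2 * Real.pi * ξ) : ℂ) := by
    intro ξ
    have h := integral_exp_mul_even hint greenFourier_neg (-(2 * Real.pi * ξ))
    rw [Real.fourier_real_eq_integral_exp_smul]
    rw [greenFunction, ← Complex.ofReal_mul, ← mul_assoc, mul_inv_cancel₀ hpi, one_mul]
    simp only [mul_neg, Real.cos_neg] at h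
    rw [← h]
    refine integral_congr_ae (.of_forall fun l => ?_)
    simp only [hF, smul_eq_mul]
    push_cast
    congr 2
    ring
  have hGi := integrable_greenFunction hβ hβ' hμ hα hγ ht
  have hFi : Integrable (𝓕 F) := by
    have : Integrable fun ξ : ℝ =>
        (2 * Real.pi : ℝ) * (greenFunction β μ α γ t (2 * Real.pi * ξ) : ℂ) :=
      ((hGi.comp_mul_left' hpi).ofReal).const_mul _
    exact this.congr (.of_forall fun ξ => (hG ξ).symm)
  have hinv := congrFun (hFc.fourierInv_fourier_eq hint.ofReal hFi) l
  rw [Real.fourierInv_eq'] at hinv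
  rw [← show F l = (greenFourier β μ α γ t l : ℂ) from rfl, ← hinv]
  have h3 := Measure.integral_comp_mul_left
    (fun x : ℝ => (greenFunction β μ α γ t x : ℂ) * Complex.exp (Complex.I * x * l)) (2 * Real.pi)
  rw [abs_of_pos (by positivity)] at h3
  have h4 : ∫ x : ℝ, (greenFunction β μ α γ t x : ℂ) * Complex.exp (Complex.I * x * l)
      = (2 * Real.pi : ℝ) • ((2 * Real.pi)⁻¹ • ∫ x : ℝ, (greenFunction β μ α γ t x : ℂ) *
        Complex.exp (Complex.I * x * l)) := by
    rw [smul_smul, mul_inv_cancel₀ hpi, one_smul]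
  rw [h4, ← h3, ← integral_smul]
  refine integral_congr_ae (.of_forall fun ξ => ?_)
  simp only [hG, smul_eq_mul, Complex.real_smul]
  rw [mul_comm (Complex.exp _), ← mul_assoc]
  congr 2
  simp
  ring

theorem isGreenFunction_greenFunction (hβ : 0 < β) (hβ' : β ≤ 1) (hμ : 0 < μ) (hα : 1 < α)
    (hγ : 0 ≤ γ) : IsGreenFunction β μ α γ (greenFunction β μ α γ) where
  integrable := fun _ ht => integrable_greenFunction hβ hβ' hμ hα hγ ht
  fourier := fun _ ht l => fourier_greenFunction hβ hβ' hμ hα hγ ht l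
  initial := fun l => by
    rw [greenFourier, Real.zero_rpow hβ.ne', mul_zero, neg_zero, mittagLeffler_zero]
  equation := fun _ _ ht => hasCaputoDerivAt_mittagLeffler hβ hβ' _ ht

end Fourier

/-! ### Spectral densities of the initial condition. -/

section Spectral

lemma integral_cos_mul_exp_neg_mul_sq {b : ℝ} (hb : 0 < b) (x : ℝ) :
    ∫ l : ℝ, Real.cos (l * x) * Real.exp (-b * l ^ 2) = √(Real.pi / b) * Real.exp (-x ^ 2 / (4 * b)) := by
  have h1 := integral_exp_mul_even (F := fun l => Real.exp (-b * l ^ 2))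
    (integrable_exp_neg_mul_sq hb) (fun l => by simp) x
  have h2 := fourierIntegral_gaussian (b := (b : ℂ)) (by simpa using hb) (x : ℂ)
  rw [← Complex.ofReal_inj, ← h1]
  have h3 : ((Real.pi : ℂ) / b) ^ (1 / 2 : ℂ) = ((√(Real.pi / b) : ℝ) : ℂ) := by
    rw [Real.sqrt_eq_rpow, Complex.ofReal_cpow (by positivity)]
    push_cast
    rfl
  rw [h3] at h2
  push_cast
  rw [← h2]
  refine integral_congr_ae (.of_forall fun l => ?_)
  simp only
  congr 2
  ring

/-- The Gaussian mixture kernel whose integral over `s` is the spectral density. -/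
noncomputable def mixtureKernel (κ l s : ℝ) : ℝ :=
  Real.exp (-s) * s ^ (κ / 2 - 1) * ((√(4 * Real.pi * s))⁻¹ * Real.exp (-(4 * s)⁻¹ * l ^ 2))

/-- The spectral density of the covariance function `(1 + x²)^(-κ/2)`. -/
noncomputable def besselDensity (κ l : ℝ) : ℝ :=
  (Real.Gamma (κ / 2))⁻¹ * ∫ s in Set.Ioi (0 : ℝ), mixtureKernel κ l s

variable {κ : ℝ}

lemma mixtureKernel_nonneg (l : ℝ) {s : ℝ} (hs : 0 ≤ s) : 0 ≤ mixtureKernel κ l s := by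
  unfold mixtureKernel; positivity

lemma measurable_mixtureKernel : Measurable (Function.uncurry (mixtureKernel κ)) := by
  unfold mixtureKernel Function.uncurry
  fun_prop

lemma integral_cos_mul_mixtureKernel (x : ℝ) {s : ℝ} (hs : 0 < s) :
    ∫ l : ℝ, Real.cos (l * x) * mixtureKernel κ l s
      = Real.exp (-s) * s ^ (κ / 2 - 1) * Real.exp (-s * x ^ 2) := by
  have h := integral_cos_mul_exp_neg_mul_sq (b := (4 * s)⁻¹) (by positivity) x
  have h1 : ∀ l : ℝ, Real.cos (l * x) * mixtureKernel κ l s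
      = Real.exp (-s) * s ^ (κ / 2 - 1) * (√(4 * Real.pi * s))⁻¹ *
        (Real.cos (l * x) * Real.exp (-(4 * s)⁻¹ * l ^ 2)) := fun l => by
    rw [mixtureKernel]; ring
  simp only [h1]
  rw [integral_const_mul, h]
  have h2 : Real.pi / (4 * s)⁻¹ = 4 * Real.pi * s := by field_simp
  have h3 : -x ^ 2 / (4 * (4 * s)⁻¹) = -s * x ^ 2 := by field_simp
  have h4 : √(4 * Real.pi * s) ≠ 0 := by positivity
  rw [h2, h3]
  field_simp

/-- Integrating out l first removes a unit Gaussian mass and leaves the Gamma integrand e^(-s)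
s^(κ/2-1). -/
lemma integrable_mixtureKernel (hκ : 0 < κ) :
    Integrable (Function.uncurry (mixtureKernel κ))
      ((volume : Measure ℝ).prod (volume.restrict (Set.Ioi 0))) := by
  rw [integrable_prod_iff' measurable_mixtureKernel.aestronglyMeasurable]
  constructor
  · refine (ae_restrict_iff' measurableSet_Ioi).2 (.of_forall fun s hs => ?_)
    have hs' : 0 < s := hs
    exact ((integrable_exp_neg_mul_sq (b := (4 * s)⁻¹) (by positivity)).const_mul
      (√(4 * Real.pi * s))⁻¹).const_mul (Real.exp (-s) * s ^ (κ / 2 - 1))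
  · have h := Real.GammaIntegral_convergent (s := κ / 2) (by positivity)
    refine h.congr_fun (fun s hs => ?_) measurableSet_Ioi
    have h1 := integral_cos_mul_mixtureKernel (κ := κ) 0 hs
    simp only [mul_zero, Real.cos_zero, one_mul, ne_eq, OfNat.ofNat_ne_zero, not_false_eq_true,
      zero_pow, Real.exp_zero, mul_one] at h1
    simp only [Function.uncurry_apply_pair]
    rw [← h1]
    refine integral_congr_ae (.of_forall fun l => ?_)
    exact (Real.norm_of_nonneg (mixtureKernel_nonneg l (le_of_lt hs))).symm

lemma integrable_besselDensity (hκ : 0 < κ) : Integrable (besselDensity κ) :=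
  (integrable_mixtureKernel hκ).integral_prod_left.const_mul _

lemma besselDensity_nonneg (hκ : 0 < κ) (l : ℝ) : 0 ≤ besselDensity κ l := by
  refine mul_nonneg (inv_nonneg.2 (Real.Gamma_pos_of_pos (by positivity)).le) ?_
  exact setIntegral_nonneg measurableSet_Ioi fun s hs => mixtureKernel_nonneg l (le_of_lt hs)

lemma besselDensity_neg (l : ℝ) : besselDensity κ (-l) = besselDensity κ l := by
  simp [besselDensity, mixtureKernel]

/-- Subordination: Γ(κ/2) (1+x²)^(-κ/2) = ∫ s^(κ/2-1) e^(-s(1+x²)) ds, and e^(-sx²) is the cosine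
transform of a Gaussian density of variance 2s. -/
lemma integral_cos_mul_besselDensity (hκ : 0 < κ) (x : ℝ) :
    ∫ l : ℝ, Real.cos (l * x) * besselDensity κ l = ((1 + x ^ 2) ^ (κ / 2))⁻¹ := by
  have hG := Real.Gamma_pos_of_pos (show 0 < κ / 2 by positivity)
  have hI : Integrable (Function.uncurry fun l s => Real.cos (l * x) * mixtureKernel κ l s)
      ((volume : Measure ℝ).prod (volume.restrict (Set.Ioi 0))) := by
    refine (integrable_mixtureKernel hκ).bdd_mul (c := 1) (f := fun p : ℝ × ℝ => Real.cos (p.1 * x))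
      (by fun_prop) (.of_forall fun p => Real.abs_cos_le_one _)
  have h1 : ∀ l : ℝ, Real.cos (l * x) * besselDensity κ l
      = (Real.Gamma (κ / 2))⁻¹ * ∫ s in Set.Ioi (0 : ℝ), Real.cos (l * x) * mixtureKernel κ l s := by
    intro l
    rw [besselDensity, integral_const_mul]
    ring
  simp only [h1]
  rw [integral_const_mul, integral_integral_swap hI,
    setIntegral_congr_fun measurableSet_Ioi fun s hs => integral_cos_mul_mixtureKernel x hs]
  have h2 := Real.integral_rpow_mul_exp_neg_mul_Ioi (a := κ / 2) (r := 1 + x ^ 2) (by positivity)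
    (by positivity)
  have h3 : ∫ s in Set.Ioi (0 : ℝ), Real.exp (-s) * s ^ (κ / 2 - 1) * Real.exp (-s * x ^ 2)
      = ∫ s in Set.Ioi (0 : ℝ), s ^ (κ / 2 - 1) * Real.exp (-((1 + x ^ 2) * s)) := by
    refine integral_congr_ae (.of_forall fun s => ?_)
    simp only
    rw [mul_comm (Real.exp (-s)), mul_assoc, ← Real.exp_add]
    congr 2
    ring
  rw [h3, h2, Real.div_rpow zero_le_one (by positivity), Real.one_rpow]
  field_simp

/-- Away from 0 the bound e^(-y) ≤ 1/y with y = l²/(4s) gains a factor s, which turns the kernel's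
s^(κ/2-3/2) into s^(κ/2-1/2), dominated uniformly near w. -/
lemma continuousAt_besselDensity (hκ : 0 < κ) {w : ℝ} (hw : w ≠ 0) :
    ContinuousAt (besselDensity κ) w := by
  have hw2 : 0 < w ^ 2 / 2 := by positivity
  refine ContinuousAt.mul continuousAt_const ?_
  refine continuousAt_of_dominated (bound := fun s => (√(4 * Real.pi))⁻¹ * (4 / (w ^ 2 / 2)) *
      (Real.exp (-s) * s ^ ((κ / 2 + 1 / 2) - 1))) ?_ ?_ ?_ ?_
  · refine .of_forall fun l => Measurable.aestronglyMeasurable ?_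
    exact measurable_mixtureKernel.comp measurable_prodMk_left
  · have hnear : ∀ᶠ l in 𝓝 w, w ^ 2 / 2 < l ^ 2 :=
      (continuous_pow 2).continuousAt.eventually (lt_mem_nhds (by linarith))
    filter_upwards [hnear] with l hl
    refine (ae_restrict_iff' measurableSet_Ioi).2 (.of_forall fun s hs => ?_)
    have hs : 0 < s := hs
    rw [Real.norm_of_nonneg (mixtureKernel_nonneg l hs.le), mixtureKernel]
    have h1 : Real.exp (-(4 * s)⁻¹ * l ^ 2) ≤ 4 / (w ^ 2 / 2) * s := by
      have hy : 0 < (4 * s)⁻¹ * (w ^ 2 / 2) := by positivity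
      have h2 : Real.exp (-(4 * s)⁻¹ * l ^ 2) ≤ Real.exp (-((4 * s)⁻¹ * (w ^ 2 / 2))) := by
        rw [Real.exp_le_exp, neg_mul, neg_le_neg_iff]
        gcongr
      refine h2.trans ?_
      rw [Real.exp_neg]
      have h3 : (4 * s)⁻¹ * (w ^ 2 / 2) ≤ Real.exp ((4 * s)⁻¹ * (w ^ 2 / 2)) := by
        linarith [Real.add_one_le_exp ((4 * s)⁻¹ * (w ^ 2 / 2))]
      refine (inv_anti₀ hy h3).trans (le_of_eq ?_)
      field_simp
    have hsq : √(4 * Real.pi * s) = √(4 * Real.pi) * s ^ (1 / 2 : ℝ) := by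
      rw [Real.sqrt_mul (by positivity), Real.sqrt_eq_rpow s]
    have hpow : s ^ ((κ / 2 + 1 / 2) - 1) = s ^ (κ / 2 - 1) * (s / s ^ (1 / 2 : ℝ)) := by
      rw [← Real.rpow_one_sub' hs.le (by norm_num), ← Real.rpow_add hs]
      congr 1
      ring
    calc _ ≤ Real.exp (-s) * s ^ (κ / 2 - 1) * ((√(4 * Real.pi * s))⁻¹ * (4 / (w ^ 2 / 2) * s)) := by
          gcongr
      _ = _ := by rw [hsq, hpow, mul_inv]; ring
  · exact (Real.GammaIntegral_convergent (s := κ / 2 + 1 / 2) (by positivity)).const_mul _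
  · refine .of_forall fun s => ?_
    unfold mixtureKernel
    fun_prop

/-- The substitution s = |w| r / 2 turns s + w²/(4s) into (|w|/2)(r + 1/r), the exponent in
`besselK`. -/
lemma besselDensity_eq_limitConst (hκ : 0 < κ) (hκ' : κ < 1) {w : ℝ} (hw : w ≠ 0) :
    besselDensity κ w = limitConst κ w := by
  have ha : 0 < |w| := abs_pos.2 hw
  have hG := Real.Gamma_pos_of_pos (show 0 < κ / 2 by positivity)
  have hG' := Real.Gamma_pos_of_pos hκ
  have hcos : 0 < Real.cos (κ * Real.pi / 2) :=
    Real.cos_pos_of_mem_Ioo ⟨by nlinarith [Real.pi_pos], by nlinarith [Real.pi_pos]⟩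
  have hc2 : c₂ κ ≠ 0 := by unfold c₂; positivity
  have hpi := Real.pi_pos
  have hsub := integral_comp_mul_left_Ioi (fun s => mixtureKernel κ w s) 0
    (show 0 < |w| / 2 by positivity)
  rw [mul_zero] at hsub
  have hker : ∀ r ∈ Set.Ioi (0 : ℝ), mixtureKernel κ w (|w| / 2 * r)
      = (√(4 * Real.pi))⁻¹ * (|w| / 2) ^ ((κ - 1) / 2 - 1) *
        (r ^ ((κ - 1) / 2 - 1) * Real.exp (-(1 / 2) * (r + 1 / r) * |w|)) := by
    intro r hr
    have hr : 0 < r := hr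
    have hs : 0 < |w| / 2 * r := by positivity
    have hsq : √(4 * Real.pi * (|w| / 2 * r)) = √(4 * Real.pi) * (|w| / 2 * r) ^ (1 / 2 : ℝ) := by
      rw [Real.sqrt_mul (by positivity), Real.sqrt_eq_rpow (|w| / 2 * r)]
    have hpow : (|w| / 2 * r) ^ (κ / 2 - 1) * ((|w| / 2 * r) ^ (1 / 2 : ℝ))⁻¹
        = (|w| / 2) ^ ((κ - 1) / 2 - 1) * r ^ ((κ - 1) / 2 - 1) := by
      rw [← Real.mul_rpow (by positivity) hr.le, ← Real.rpow_neg hs.le, ← Real.rpow_add hs]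
      congr 1
      ring
    have hexp : Real.exp (-(|w| / 2 * r)) * Real.exp (-(4 * (|w| / 2 * r))⁻¹ * w ^ 2)
        = Real.exp (-(1 / 2) * (r + 1 / r) * |w|) := by
      rw [← Real.exp_add, ← sq_abs w]
      congr 1
      field_simp
      ring
    rw [mixtureKernel, hsq, mul_inv]
    calc _ = (√(4 * Real.pi))⁻¹ *
          ((|w| / 2 * r) ^ (κ / 2 - 1) * ((|w| / 2 * r) ^ (1 / 2 : ℝ))⁻¹) *
          (Real.exp (-(|w| / 2 * r)) * Real.exp (-(4 * (|w| / 2 * r))⁻¹ * w ^ 2)) := by ring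
      _ = _ := by rw [hpow, hexp]; ring
  rw [setIntegral_congr_fun measurableSet_Ioi hker, integral_const_mul, smul_eq_mul] at hsub
  have hI : ∫ s in Set.Ioi (0 : ℝ), mixtureKernel κ w s
      = |w| / 2 * ((√(4 * Real.pi))⁻¹ * (|w| / 2) ^ ((κ - 1) / 2 - 1) *
        (2 * besselK ((κ - 1) / 2) |w|)) := by
    rw [besselK, ← mul_assoc 2, mul_one_div_cancel two_ne_zero, one_mul, hsub, ← mul_assoc,
      mul_inv_cancel₀ (by positivity), one_mul]
  have h4 : √(4 * Real.pi) = 2 * √Real.pi := by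
    rw [Real.sqrt_mul (by norm_num), show (4 : ℝ) = 2 ^ 2 by norm_num, Real.sqrt_sq (by norm_num)]
  have hp1 : (|w| / 2) ^ ((κ - 1) / 2 - 1) * (|w| / 2)
      = |w| ^ ((κ - 1) / 2) * 2 ^ ((1 - κ) / 2) := by
    rw [← Real.rpow_add_one (by positivity), sub_add_cancel, Real.div_rpow ha.le zero_le_two,
      div_eq_mul_inv, ← Real.rpow_neg zero_le_two]
    congr 2
    ring
  have hp2 : |w| ^ ((1 - κ) / 2) / |w| ^ (1 - κ) = |w| ^ ((κ - 1) / 2) := by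
    rw [← Real.rpow_sub ha]
    congr 1
    ring
  rw [besselDensity, hI, h4, limitConst, theta, sub_sub_cancel, c₁]
  calc _ = ((|w| / 2) ^ ((κ - 1) / 2 - 1) * (|w| / 2)) *
        ((Real.Gamma (κ / 2))⁻¹ * (√Real.pi)⁻¹ * besselK ((κ - 1) / 2) |w|) := by
        field_simp
    _ = (|w| ^ ((1 - κ) / 2) / |w| ^ (1 - κ) * 2 ^ ((1 - κ) / 2)) *
        ((Real.Gamma (κ / 2))⁻¹ * (√Real.pi)⁻¹ * besselK ((κ - 1) / 2) |w|) := by rw [hp1, hp2]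
    _ = _ := by field_simp

/-- The spectral density of `cyclicCov κ w`. -/
noncomputable def cyclicDensity (κ w l : ℝ) : ℝ :=
  (1 / 2) * (besselDensity κ (l + w) + besselDensity κ (l - w))

lemma cyclicDensity_nonneg (hκ : 0 < κ) (w l : ℝ) : 0 ≤ cyclicDensity κ w l :=
  mul_nonneg (by norm_num) (add_nonneg (besselDensity_nonneg hκ _) (besselDensity_nonneg hκ _))

lemma integrable_cyclicDensity (hκ : 0 < κ) (w : ℝ) : Integrable (cyclicDensity κ w) :=
  (((integrable_besselDensity hκ).comp_add_right w).add
    ((integrable_besselDensity hκ).comp_sub_right w)).const_mul _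

/-- Modulation by cos(wx) averages the spectrum over the shifts by w and -w. -/
lemma integral_cos_mul_cyclicDensity (hκ : 0 < κ) (w x : ℝ) :
    ∫ l : ℝ, Real.cos (l * x) * cyclicDensity κ w l = cyclicCov κ w x := by
  have hb := integrable_besselDensity hκ
  have hI : ∀ v : ℝ, Integrable fun l => Real.cos ((l + v) * x) * besselDensity κ l := fun v =>
    hb.bdd_mul (c := 1) (by fun_prop) (.of_forall fun l => Real.abs_cos_le_one _)
  have hs : ∀ v : ℝ, ∫ l : ℝ, Real.cos (l * x) * besselDensity κ (l - v)
      = ∫ l : ℝ, Real.cos ((l + v) * x) * besselDensity κ l := by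
    intro v
    rw [← integral_add_right_eq_self (fun l => Real.cos (l * x) * besselDensity κ (l - v)) v]
    simp
  have hI' : ∀ v : ℝ, Integrable fun l => Real.cos (l * x) * besselDensity κ (l - v) := fun v =>
    (hb.comp_sub_right v).bdd_mul (c := 1) (by fun_prop)
      (.of_forall fun l => Real.abs_cos_le_one _)
  have h1 : ∀ l : ℝ, Real.cos (l * x) * cyclicDensity κ w l
      = (1 / 2) * (Real.cos (l * x) * besselDensity κ (l - -w)
        + Real.cos (l * x) * besselDensity κ (l - w)) := fun l => by
    rw [cyclicDensity, sub_neg_eq_add]; ring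
  simp only [h1]
  rw [integral_const_mul, integral_add (hI' _) (hI' _), hs, hs, ← integral_add (hI _) (hI _),
    ← integral_const_mul]
  have h2 : ∀ l : ℝ, (1 / 2 : ℝ) * (Real.cos ((l + -w) * x) * besselDensity κ l
      + Real.cos ((l + w) * x) * besselDensity κ l)
      = Real.cos (w * x) * (Real.cos (l * x) * besselDensity κ l) := fun l => by
    rw [show (l + -w) * x = l * x - w * x by ring, show (l + w) * x = l * x + w * x by ring,
      Real.cos_sub, Real.cos_add]
    ring
  simp only [h2]
  rw [integral_const_mul, integral_cos_mul_besselDensity hκ, cyclicCov]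
  exact (div_eq_mul_inv _ _).symm

lemma continuousAt_cyclicDensity (hκ : 0 < κ) {w : ℝ} (hw : w ≠ 0) :
    ContinuousAt (cyclicDensity κ w) 0 := by
  have h1 : ContinuousAt (fun l : ℝ => besselDensity κ (l + w)) 0 :=
    ContinuousAt.comp (g := besselDensity κ) (f := fun l : ℝ => l + w)
      (by rw [zero_add]; exact continuousAt_besselDensity hκ hw) (by fun_prop)
  have h2 : ContinuousAt (fun l : ℝ => besselDensity κ (l - w)) 0 :=
    ContinuousAt.comp (g := besselDensity κ) (f := fun l : ℝ => l - w)
      (by rw [zero_sub]; exact continuousAt_besselDensity hκ (neg_ne_zero.2 hw)) (by fun_prop)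
  exact continuousAt_const.mul (h1.add h2)

lemma cyclicDensity_zero (hκ : 0 < κ) (hκ' : κ < 1) {w : ℝ} (hw : w ≠ 0) :
    cyclicDensity κ w 0 = limitConst κ w := by
  rw [cyclicDensity, zero_add, zero_sub, besselDensity_neg, besselDensity_eq_limitConst hκ hκ' hw]
  ring

lemma limitConst_nonneg (hκ : 0 < κ) (hκ' : κ < 1) {w : ℝ} (hw : w ≠ 0) :
    0 ≤ limitConst κ w := by
  rw [← besselDensity_eq_limitConst hκ hκ' hw]
  exact besselDensity_nonneg hκ w

end Spectral

/-! ### Mean-square limits of Gaussian variables and processes. -/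

section MeanSquare

lemma tendsto_integral_mul_conj {Ω 𝕜 : Type*} [MeasurableSpace Ω] [RCLike 𝕜] {P : Measure Ω}
    {X Y : ℕ → Ω → 𝕜} {X₀ Y₀ : Ω → 𝕜} (hX : ∀ n, MemLp (X n) 2 P) (hX₀ : MemLp X₀ 2 P)
    (hY : ∀ n, MemLp (Y n) 2 P) (hY₀ : MemLp Y₀ 2 P)
    (hXlim : Tendsto (fun n => eLpNorm (X n - X₀) 2 P) atTop (𝓝 0))
    (hYlim : Tendsto (fun n => eLpNorm (Y n - Y₀) 2 P) atTop (𝓝 0)) :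
    Tendsto (fun n => ∫ ω, X n ω * (starRingEnd 𝕜) (Y n ω) ∂P) atTop
      (𝓝 (∫ ω, X₀ ω * (starRingEnd 𝕜) (Y₀ ω) ∂P)) := by
  have key : ∀ {A B : Ω → 𝕜} (hA : MemLp A 2 P) (hB : MemLp B 2 P),
      inner 𝕜 (hB.toLp B) (hA.toLp A) = ∫ ω, A ω * (starRingEnd 𝕜) (B ω) ∂P := by
    intro A B hA hB
    rw [L2.inner_def]
    refine integral_congr_ae ?_
    filter_upwards [hA.coeFn_toLp, hB.coeFn_toLp] with ω h1 h2
    rw [h1, h2, RCLike.inner_apply]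
  have h1 := (Lp.tendsto_Lp_iff_tendsto_eLpNorm'' X hX X₀ hX₀).2 hXlim
  have h2 := (Lp.tendsto_Lp_iff_tendsto_eLpNorm'' Y hY Y₀ hY₀).2 hYlim
  have h3 := Tendsto.inner (𝕜 := 𝕜) h2 h1
  simpa only [key] using h3

variable {Ω : Type*} [MeasurableSpace Ω] {P : Measure Ω}

lemma tendsto_eLpNorm_const_mul {X : ℕ → Ω → ℝ} {Z : Ω → ℝ} (c : ℝ)
    (h : Tendsto (fun n => eLpNorm (X n - Z) 2 P) atTop (𝓝 0)) :
    Tendsto (fun n => eLpNorm ((fun ω => c * X n ω) - fun ω => c * Z ω) 2 P) atTop (𝓝 0) := by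
  have h1 : ∀ n, eLpNorm ((fun ω => c * X n ω) - fun ω => c * Z ω) 2 P
      = ‖c‖ₑ * eLpNorm (X n - Z) 2 P := by
    intro n
    rw [← eLpNorm_const_smul]
    congr 1
    ext ω
    simp [mul_sub]
  simp only [h1]
  simpa using ENNReal.Tendsto.const_mul h (Or.inr (by simp))

variable [IsProbabilityMeasure P]

lemma tendsto_integral_of_L2 {X : ℕ → Ω → ℝ} {Z : Ω → ℝ} (hX : ∀ n, MemLp (X n) 2 P)
    (hZ : MemLp Z 2 P) (h : Tendsto (fun n => eLpNorm (X n - Z) 2 P) atTop (𝓝 0)) :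
    Tendsto (fun n => ∫ ω, X n ω ∂P) atTop (𝓝 (∫ ω, Z ω ∂P)) := by
  have := tendsto_integral_mul_conj hX hZ (Y := fun _ _ => (1 : ℝ)) (Y₀ := fun _ => (1 : ℝ))
    (fun _ => memLp_const 1) (memLp_const 1) h (by simp)
  simpa using this

lemma tendsto_variance_of_L2 {X : ℕ → Ω → ℝ} {Z : Ω → ℝ} (hX : ∀ n, MemLp (X n) 2 P)
    (hZ : MemLp Z 2 P) (h : Tendsto (fun n => eLpNorm (X n - Z) 2 P) atTop (𝓝 0)) :
    Tendsto (fun n => Var[X n; P]) atTop (𝓝 Var[Z; P]) := by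
  have h1 := tendsto_integral_mul_conj hX hZ hX hZ h h
  have h2 := tendsto_integral_of_L2 hX hZ h
  rw [variance_eq_sub hZ]
  simp only [fun n => variance_eq_sub (hX n)]
  refine Tendsto.sub ?_ (h2.pow 2)
  simpa [pow_two] using h1

/-- A mean-square limit of Gaussian random variables is Gaussian. -/
lemma hasGaussianLaw_of_tendsto_L2 {X : ℕ → Ω → ℝ} {Z : Ω → ℝ}
    (hX : ∀ n, HasGaussianLaw (X n) P) (hZ : MemLp Z 2 P)
    (h : Tendsto (fun n => eLpNorm (X n - Z) 2 P) atTop (𝓝 0)) : HasGaussianLaw Z P := by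
  have hX2 : ∀ n, MemLp (X n) 2 P := fun n => (hX n).memLp_two
  -- Mean-square convergence gives convergence in law, hence of characteristic functions. These are
  -- Gaussian, with converging means and variances, so uniqueness of limits identifies the limiting
  -- one.
  have hd := (tendstoInMeasure_of_tendsto_eLpNorm two_ne_zero
    (fun n => (hX2 n).aestronglyMeasurable) hZ.aestronglyMeasurable h).tendstoInDistribution
    fun n => (hX n).aemeasurable
  have hcf := ProbabilityMeasure.tendsto_iff_tendsto_charFun.1 hd.tendsto
  rw [hasGaussianLaw_iff_charFun_map_eq hZ.aestronglyMeasurable.aemeasurable]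
  intro t
  refine tendsto_nhds_unique (hcf t) ?_
  have hin : ∀ (Y : Ω → ℝ) (ω : Ω), inner ℝ t (Y ω) = t * Y ω := fun Y ω => by simp [mul_comm]
  simp only [ProbabilityMeasure.coe_mk, fun n => (hX n).charFun_map_eq t, hin]
  have h' := tendsto_eLpNorm_const_mul t h
  have hm := tendsto_integral_of_L2 (fun n => (hX2 n).const_mul t) (hZ.const_mul t) h'
  have hv := tendsto_variance_of_L2 (fun n => (hX2 n).const_mul t) (hZ.const_mul t) h'
  refine (Complex.continuous_exp.tendsto _).comp (Tendsto.sub ?_ ?_)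
  · exact ((Complex.continuous_ofReal.tendsto _).comp hm).mul_const _
  · exact ((Complex.continuous_ofReal.tendsto _).comp hv).div_const _

/-- A mean-square limit of Gaussian processes is a Gaussian process. -/
lemma isGaussianProcess_of_tendsto_L2 {T : Type*} {X : ℕ → T → Ω → ℝ} {Z : T → Ω → ℝ}
    (hX : ∀ n, IsGaussianProcess (X n) P) (hZ : ∀ t, MemLp (Z t) 2 P)
    (h : ∀ t, Tendsto (fun n => eLpNorm (X n t - Z t) 2 P) atTop (𝓝 0)) :
    IsGaussianProcess Z P where
  hasGaussianLaw I := by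
    classical
    have hmeas : AEMeasurable (fun ω => I.restrict (Z · ω)) P :=
      aemeasurable_pi_lambda _ fun i => (hZ i).aestronglyMeasurable.aemeasurable
    constructor
    refine isGaussian_of_isGaussian_map fun L => ?_
    rw [AEMeasurable.map_map_of_aemeasurable (by fun_prop) hmeas]
    have hL : ∀ x : I → ℝ, L x = ∑ i, L (Pi.single i 1) * x i := by
      intro x
      conv_lhs => rw [← Finset.univ_sum_single x, map_sum]
      refine Finset.sum_congr rfl fun i _ => ?_
      have : (Pi.single i (x i) : I → ℝ) = x i • Pi.single i 1 := by
        rw [← Pi.single_smul]; simp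
      rw [this, map_smul, smul_eq_mul, mul_comm]
    have hLZ : MemLp (L ∘ fun ω => I.restrict (Z · ω)) 2 P := by
      have : MemLp (fun ω => ∑ i : I, L (Pi.single i 1) * Z i ω) 2 P :=
        memLp_finsetSum _ fun i _ => (hZ i).const_mul _
      refine this.congr_norm (hmeas.aestronglyMeasurable |> L.continuous.comp_aestronglyMeasurable)
        (.of_forall fun ω => ?_)
      simp only [Function.comp_apply, hL (I.restrict (Z · ω)), Finset.restrict]
    refine (hasGaussianLaw_of_tendsto_L2 (X := fun n => L ∘ fun ω => I.restrict (X n · ω))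
      (fun n => ((hX n).hasGaussianLaw I).map L) hLZ ?_).isGaussian_map
    have hlim : Tendsto (fun n => ∑ i : I, eLpNorm ((fun ω => L (Pi.single i 1) * X n i ω)
        - fun ω => L (Pi.single i 1) * Z i ω) 2 P) atTop (𝓝 (∑ _i : I, 0)) :=
      tendsto_finsetSum _ fun i _ => tendsto_eLpNorm_const_mul _ (h i)
    rw [Finset.sum_const_zero] at hlim
    refine tendsto_of_tendsto_of_tendsto_of_le_of_le tendsto_const_nhds hlim
      (fun _ => zero_le) fun n => ?_
    have heq : (L ∘ fun ω => I.restrict (X n · ω)) - (L ∘ fun ω => I.restrict (Z · ω))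
        = ∑ i : I, ((fun ω => L (Pi.single i 1) * X n i ω)
          - fun ω => L (Pi.single i 1) * Z i ω) := by
      ext ω
      simp only [Pi.sub_apply, Function.comp_apply, hL (I.restrict (X n · ω)),
        hL (I.restrict (Z · ω)), Finset.sum_apply, Finset.restrict, Finset.sum_sub_distrib]
    rw [heq]
    refine eLpNorm_sum_le (fun i _ => ?_) one_le_two
    exact (((hX n).hasGaussianLaw_eval _).memLp_two.const_mul _).sub ((hZ i).const_mul _)
      |>.aestronglyMeasurable

end MeanSquare

/-! ### Integrals of the initial condition against integrable weights. -/

section ProcessIntegral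

variable {Ω : Type*} [MeasurableSpace Ω] {P : Measure Ω}
  {κ w : ℝ} {η : ℝ → Ω → ℝ}

namespace IsCyclicInitialCondition

lemma memLp (hη : IsCyclicInitialCondition P κ w η) (y : ℝ) : MemLp (η y) 2 P :=
  (hη.gaussian.hasGaussianLaw_eval y).memLp_two

lemma integrable_mul (hη : IsCyclicInitialCondition P κ w η) {X : Ω → ℝ} (hX : MemLp X 2 P)
    (y : ℝ) : Integrable (fun ω => X ω * η y ω) P :=
  hX.integrable_mul (hη.memLp y)

lemma measurable_comp_swap (hη : IsCyclicInitialCondition P κ w η) :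
    Measurable fun p : Ω × ℝ => η p.2 p.1 := hη.measurable.comp measurable_swap

variable [IsProbabilityMeasure P]

lemma integral_mul (hη : IsCyclicInitialCondition P κ w η) (y y' : ℝ) :
    ∫ ω, η y ω * η y' ω ∂P = cyclicCov κ w (y - y') := by
  have h := covariance_eq_sub (hη.memLp y) (hη.memLp y')
  rw [hη.cov_eq, hη.mean_zero, zero_mul, sub_zero] at h
  exact h.symm

lemma integral_sq (hη : IsCyclicInitialCondition P κ w η) (y : ℝ) :
    ∫ ω, η y ω ^ 2 ∂P = 1 := by
  have h := hη.integral_mul y y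
  simpa [← pow_two, cyclicCov] using h

lemma integral_norm_mul_le (hη : IsCyclicInitialCondition P κ w η) {X : Ω → ℝ}
    (hX : MemLp X 2 P) (y : ℝ) :
    ∫ ω, ‖X ω * η y ω‖ ∂P ≤ (∫ ω, X ω ^ 2 ∂P + 1) / 2 := by
  have hi := hX.integrable_sq
  have hi' := (hη.memLp y).integrable_sq
  rw [← hη.integral_sq y, ← integral_add hi hi', ← integral_div]
  refine integral_mono (hη.integrable_mul hX y).norm ((hi.add hi').div_const 2) fun ω => ?_
  simp only [Real.norm_eq_abs, abs_mul]
  nlinarith [sq_nonneg (|X ω| - |η y ω|), sq_abs (X ω), sq_abs (η y ω)]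

/-- Unit variance of η bounds E|X η(y)| uniformly in y, so integrability of h suffices for Fubini.
-/
lemma integrable_prod (hη : IsCyclicInitialCondition P κ w η) {X : Ω → ℝ} (hX : MemLp X 2 P)
    {h : ℝ → ℝ} (hh : Integrable h) :
    Integrable (fun p : Ω × ℝ => X p.1 * (h p.2 * η p.2 p.1)) (P.prod volume) := by
  have hm : AEStronglyMeasurable (fun p : Ω × ℝ => X p.1 * (h p.2 * η p.2 p.1))
      (P.prod volume) :=
    hX.aestronglyMeasurable.comp_fst.mul
      (hh.aestronglyMeasurable.comp_snd.mul hη.measurable_comp_swap.aestronglyMeasurable)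
  rw [integrable_prod_iff' hm]
  have hre : ∀ (ω : Ω) (y : ℝ), X ω * (h y * η y ω) = h y * (X ω * η y ω) := fun ω y => by ring
  simp only [hre]
  refine ⟨.of_forall fun y => (hη.integrable_mul hX y).const_mul _, ?_⟩
  have hm2 : AEStronglyMeasurable (fun y => ∫ ω, ‖h y * (X ω * η y ω)‖ ∂P) volume := by
    have := hm.norm.prod_swap.integral_prod_right'
    simpa only [Prod.swap, hre] using this
  refine Integrable.mono' (hh.norm.mul_const ((∫ ω, X ω ^ 2 ∂P + 1) / 2)) hm2
    (.of_forall fun y => ?_)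
  rw [Real.norm_of_nonneg (integral_nonneg fun ω => norm_nonneg _)]
  simp only [norm_mul (h y)]
  rw [integral_const_mul]
  exact mul_le_mul_of_nonneg_left (hη.integral_norm_mul_le hX y) (norm_nonneg _)

lemma ae_integrable (hη : IsCyclicInitialCondition P κ w η) {h : ℝ → ℝ} (hh : Integrable h) :
    ∀ᵐ ω ∂P, Integrable fun y => h y * η y ω := by
  have := (hη.integrable_prod (X := fun _ => 1) (memLp_const 1) hh).prod_right_ae
  simpa using this

lemma integral_mul_integral (hη : IsCyclicInitialCondition P κ w η) {X : Ω → ℝ}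
    (hX : MemLp X 2 P) {h : ℝ → ℝ} (hh : Integrable h) :
    ∫ ω, X ω * (∫ y, h y * η y ω) ∂P = ∫ y, h y * ∫ ω, X ω * η y ω ∂P := by
  have hI := hη.integrable_prod hX hh
  have := integral_integral_swap (f := fun ω y => X ω * (h y * η y ω)) hI
  simp only [integral_const_mul] at this
  rw [this]
  refine integral_congr_ae (.of_forall fun y => ?_)
  simp only
  rw [← integral_const_mul]
  exact integral_congr_ae (.of_forall fun ω => by simp only; ring)

lemma integral_integral_eq_zero (hη : IsCyclicInitialCondition P κ w η) {h : ℝ → ℝ}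
    (hh : Integrable h) : ∫ ω, (∫ y, h y * η y ω) ∂P = 0 := by
  have := hη.integral_mul_integral (X := fun _ => 1) (memLp_const 1) hh
  simpa [hη.mean_zero] using this

lemma aestronglyMeasurable_integral (hη : IsCyclicInitialCondition P κ w η) {h : ℝ → ℝ}
    (hh : Integrable h) : AEStronglyMeasurable (fun ω => ∫ y, h y * η y ω) P := by
  have := (hη.integrable_prod (X := fun _ => 1) (memLp_const 1) hh).integral_prod_left
  simpa using this.aestronglyMeasurable

lemma integrable_prod_prod (hη : IsCyclicInitialCondition P κ w η) {h h' : ℝ → ℝ}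
    (hh : Integrable h) (hh' : Integrable h') :
    Integrable (fun p : Ω × (ℝ × ℝ) => (h p.2.1 * η p.2.1 p.1) * (h' p.2.2 * η p.2.2 p.1))
      (P.prod (volume.prod volume)) := by
  have hm1 : Measurable fun p : Ω × (ℝ × ℝ) => η p.2.1 p.1 :=
    hη.measurable.comp (measurable_snd.fst.prodMk measurable_fst)
  have hm2 : Measurable fun p : Ω × (ℝ × ℝ) => η p.2.2 p.1 :=
    hη.measurable.comp (measurable_snd.snd.prodMk measurable_fst)
  have hm : AEStronglyMeasurable (fun p : Ω × (ℝ × ℝ) =>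
      (h p.2.1 * η p.2.1 p.1) * (h' p.2.2 * η p.2.2 p.1)) (P.prod (volume.prod volume)) :=
    ((hh.aestronglyMeasurable.comp_fst (ν := (volume : Measure ℝ))).comp_snd.mul
      hm1.aestronglyMeasurable).mul
    ((hh'.aestronglyMeasurable.comp_snd (μ := (volume : Measure ℝ))).comp_snd.mul
      hm2.aestronglyMeasurable)
  rw [integrable_prod_iff' hm]
  have hre : ∀ (ω : Ω) (q : ℝ × ℝ), (h q.1 * η q.1 ω) * (h' q.2 * η q.2 ω)
      = (h q.1 * h' q.2) * (η q.1 ω * η q.2 ω) := fun ω q => by ring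
  simp only [hre]
  refine ⟨.of_forall fun q => (hη.integrable_mul (hη.memLp q.1) q.2).const_mul _, ?_⟩
  have hm3 : AEStronglyMeasurable (fun q : ℝ × ℝ =>
      ∫ ω, ‖(h q.1 * h' q.2) * (η q.1 ω * η q.2 ω)‖ ∂P) (volume.prod volume) := by
    have := hm.norm.prod_swap.integral_prod_right'
    simpa only [Prod.swap, hre] using this
  refine Integrable.mono' (hh.mul_prod hh').norm hm3 (.of_forall fun q => ?_)
  rw [Real.norm_of_nonneg (integral_nonneg fun ω => norm_nonneg _)]
  simp only [norm_mul (h q.1 * h' q.2)]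
  rw [integral_const_mul]
  refine mul_le_of_le_one_right (norm_nonneg _) ?_
  have := hη.integral_norm_mul_le (hη.memLp q.1) q.2
  rwa [hη.integral_sq, show ((1 : ℝ) + 1) / 2 = 1 by norm_num] at this

lemma memLp_integral (hη : IsCyclicInitialCondition P κ w η) {h : ℝ → ℝ} (hh : Integrable h) :
    MemLp (fun ω => ∫ y, h y * η y ω) 2 P := by
  rw [memLp_two_iff_integrable_sq (hη.aestronglyMeasurable_integral hh)]
  have := (hη.integrable_prod_prod hh hh).integral_prod_left
  refine this.congr (.of_forall fun ω => ?_)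
  simp only
  rw [integral_prod_mul (fun y => h y * η y ω) (fun y => h y * η y ω), pow_two]

lemma integral_integral_mul_integral (hη : IsCyclicInitialCondition P κ w η) {h h' : ℝ → ℝ}
    (hh : Integrable h) (hh' : Integrable h') :
    ∫ ω, (∫ y, h y * η y ω) * (∫ y, h' y * η y ω) ∂P
      = ∫ q : ℝ × ℝ, (h q.1 * h' q.2) * cyclicCov κ w (q.1 - q.2) := by
  have := integral_integral_swap (f := fun (ω : Ω) (q : ℝ × ℝ) =>
    (h q.1 * η q.1 ω) * (h' q.2 * η q.2 ω)) (hη.integrable_prod_prod hh hh')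
  have hl : ∀ ω, ∫ q : ℝ × ℝ, (h q.1 * η q.1 ω) * (h' q.2 * η q.2 ω)
      = (∫ y, h y * η y ω) * (∫ y, h' y * η y ω) := fun ω =>
    integral_prod_mul (fun y => h y * η y ω) (fun y => h' y * η y ω)
  rw [← Measure.volume_eq_prod] at this
  simp only [hl] at this
  rw [this]
  refine integral_congr_ae (.of_forall fun q => ?_)
  simp only
  rw [← hη.integral_mul, ← integral_const_mul]
  exact integral_congr_ae (.of_forall fun ω => by simp only; ring)

/-- The integrals of a measurable Gaussian process are mean-square limits of linear combinations of
its values. -/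
lemma exists_tendsto_linearCombination (hη : IsCyclicInitialCondition P κ w η) {h : ℝ → ℝ}
    (hh : Integrable h) :
    ∃ c : ℕ → (ℝ →₀ ℝ), Tendsto (fun n => eLpNorm ((fun ω => (c n).sum fun y a => a * η y ω)
      - fun ω => ∫ y, h y * η y ω) 2 P) atTop (𝓝 0) := by
  set e : ℝ → Lp ℝ 2 P := fun y => (hη.memLp y).toLp (η y) with he
  set K : Submodule ℝ (Lp ℝ 2 P) := Submodule.span ℝ (Set.range e) with hK
  set Z : Lp ℝ 2 P := (hη.memLp_integral hh).toLp _ with hZ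
  -- The closed span is its double orthogonal complement: an X orthogonal to every η(y) is, by
  -- Fubini, orthogonal to ∫ h η. No Riemann sums or path regularity are needed.
  have hmem : Z ∈ K.topologicalClosure := by
    rw [← Submodule.orthogonal_orthogonal_eq_closure, Submodule.mem_orthogonal]
    intro X hX
    have hXL : MemLp X 2 P := Lp.memLp X
    have h0 : ∀ y, ∫ ω, X ω * η y ω ∂P = 0 := by
      intro y
      have := (Submodule.mem_orthogonal' K X).1 hX (e y) (Submodule.subset_span ⟨y, rfl⟩)
      rw [L2.inner_def] at this
      rw [← this]
      refine integral_congr_ae ?_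
      filter_upwards [(hη.memLp y).coeFn_toLp] with ω hω
      simp [he, hω, mul_comm]
    have h1 := hη.integral_mul_integral hXL hh
    simp only [h0, mul_zero, integral_zero] at h1
    rw [L2.inner_def, ← h1]
    refine integral_congr_ae ?_
    filter_upwards [(hη.memLp_integral hh).coeFn_toLp] with ω hω
    simp only [hZ, hω, RCLike.inner_apply, conj_trivial]
    ring
  obtain ⟨x, hxK, hx⟩ := mem_closure_iff_seq_limit.1 hmem
  choose c hc using fun n => Finsupp.mem_span_range_iff_exists_finsupp.1 (hxK n)
  refine ⟨c, ?_⟩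
  have h1 := (Lp.tendsto_Lp_iff_tendsto_eLpNorm x (fun ω => ∫ y, h y * η y ω)
    (hη.memLp_integral hh)).1 hx
  refine h1.congr fun n => eLpNorm_congr_ae ?_
  refine EventuallyEq.sub ?_ EventuallyEq.rfl
  rw [← hc n, Finsupp.sum]
  refine (Lp.coeFn_finsetSum _ _).trans ?_
  have : ∀ y ∈ (c n).support, ∀ᵐ ω ∂P, (c n y • e y : Lp ℝ 2 P) ω = c n y * η y ω := by
    intro y _
    filter_upwards [Lp.coeFn_smul (c n y) (e y), (hη.memLp y).coeFn_toLp] with ω h1 h2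
    rw [h1, Pi.smul_apply, smul_eq_mul, he, h2]
  filter_upwards [(Finset.eventually_all _).2 this] with ω hω
  rw [Finsupp.sum, Finset.sum_apply]
  exact Finset.sum_congr rfl hω

lemma isGaussianProcess_integral (hη : IsCyclicInitialCondition P κ w η) {T : Type*}
    {h : T → ℝ → ℝ} (hh : ∀ t, Integrable (h t)) :
    IsGaussianProcess (fun t ω => ∫ y, h t y * η y ω) P := by
  choose c hc using fun t => hη.exists_tendsto_linearCombination (hh t)
  refine isGaussianProcess_of_tendsto_L2 (X := fun n t ω => (c t n).sum fun y a => a * η y ω)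
    (fun n => ?_) (fun t => hη.memLp_integral (hh t)) hc
  refine hη.gaussian.of_isGaussianProcess fun t => ⟨(c t n).support,
    ∑ y : (c t n).support, c t n y • ContinuousLinearMap.proj y, fun ω => ?_⟩
  rw [Finsupp.sum, ← Finset.sum_coe_sort]
  simp [Finset.restrict]

end IsCyclicInitialCondition

end ProcessIntegral

/-! ### Spectral formula for the covariance of the solution. -/

section SpectralCovariance

lemma norm_exp_I_mul (y l : ℝ) : ‖Complex.exp (Complex.I * y * l)‖ = 1 := by
  rw [show Complex.I * y * l = ((y * l : ℝ) : ℂ) * Complex.I by push_cast; ring,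
    Complex.norm_exp_ofReal_mul_I]

lemma integral_mul_mul_cos {h h' : ℝ → ℝ} (hh : Integrable h) (hh' : Integrable h') (l : ℝ) :
    ∫ q : ℝ × ℝ, (h q.1 * h' q.2) * Real.cos (l * (q.1 - q.2))
      = ((∫ y : ℝ, (h y : ℂ) * Complex.exp (Complex.I * y * l)) *
        (starRingEnd ℂ) (∫ y : ℝ, (h' y : ℂ) * Complex.exp (Complex.I * y * l))).re := by
  have hI : ∀ {g : ℝ → ℝ}, Integrable g →
      Integrable fun y : ℝ => (g y : ℂ) * Complex.exp (Complex.I * y * l) := fun {g} hg =>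
    hg.ofReal.mul_bdd (c := 1) (by fun_prop) (.of_forall fun y => (norm_exp_I_mul y l).le)
  have hI' : Integrable fun y : ℝ =>
      (starRingEnd ℂ) ((h' y : ℂ) * Complex.exp (Complex.I * y * l)) :=
    (hI hh').mono
      (Complex.continuous_conj.comp_aestronglyMeasurable (hI hh').aestronglyMeasurable)
      (.of_forall fun y => (RCLike.norm_conj _).le)
  rw [← integral_conj, ← integral_prod_mul (μ := volume) (ν := volume)
    (fun y : ℝ => (h y : ℂ) * Complex.exp (Complex.I * y * l))
    (fun y : ℝ => (starRingEnd ℂ) ((h' y : ℂ) * Complex.exp (Complex.I * y * l))),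
    ← RCLike.re_eq_complex_re, ← integral_re ((hI hh).mul_prod hI'), Measure.volume_eq_prod]
  refine integral_congr_ae (.of_forall fun q => ?_)
  simp only [map_mul, Complex.conj_ofReal, ← Complex.exp_conj, Complex.conj_I]
  rw [show (h q.1 : ℂ) * Complex.exp (Complex.I * q.1 * l) *
      ((h' q.2 : ℂ) * Complex.exp (-Complex.I * q.2 * l))
      = ((h q.1 * h' q.2 : ℝ) : ℂ) * Complex.exp (((l * (q.1 - q.2) : ℝ) : ℂ) * Complex.I) by
    rw [show ((l * (q.1 - q.2) : ℝ) : ℂ) * Complex.I = Complex.I * q.1 * l + -Complex.I * q.2 * l by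
      push_cast; ring, Complex.exp_add]
    push_cast
    ring, RCLike.re_eq_complex_re, Complex.re_ofReal_mul, Complex.exp_ofReal_mul_I_re]

/-- Writing the covariance as the cosine transform of its density and exchanging integrals leaves,
at each frequency, a product of the Fourier transforms of h and h'. -/
lemma integral_mul_mul_cyclicCov {κ : ℝ} (hκ : 0 < κ) (w : ℝ) {h h' : ℝ → ℝ} (hh : Integrable h)
    (hh' : Integrable h') :
    ∫ q : ℝ × ℝ, (h q.1 * h' q.2) * cyclicCov κ w (q.1 - q.2)
      = ∫ l : ℝ, ((∫ y : ℝ, (h y : ℂ) * Complex.exp (Complex.I * y * l)) *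
        (starRingEnd ℂ) (∫ y : ℝ, (h' y : ℂ) * Complex.exp (Complex.I * y * l))).re *
          cyclicDensity κ w l := by
  have hI : Integrable (Function.uncurry fun (q : ℝ × ℝ) (l : ℝ) =>
      (h q.1 * h' q.2) * (Real.cos (l * (q.1 - q.2)) * cyclicDensity κ w l))
      ((volume.prod volume).prod volume) := by
    have h1 := ((hh.mul_prod hh').mul_prod (integrable_cyclicDensity hκ w)).bdd_mul (c := 1)
      (f := fun p : (ℝ × ℝ) × ℝ => Real.cos (p.2 * (p.1.1 - p.1.2))) (by fun_prop)
      (.of_forall fun p => Real.abs_cos_le_one _)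
    refine h1.congr (.of_forall fun p => ?_)
    simp only [Function.uncurry]
    ring
  simp only [← integral_cos_mul_cyclicDensity hκ, ← integral_const_mul]
  rw [Measure.volume_eq_prod, integral_integral_swap hI]
  refine integral_congr_ae (.of_forall fun l => ?_)
  simp only
  rw [← integral_mul_mul_cos hh hh', ← integral_mul_const, Measure.volume_eq_prod]
  exact integral_congr_ae (.of_forall fun q => by simp only; ring)

variable {β μ α γ t : ℝ}

lemma integrable_greenFunction_sub (hβ : 0 < β) (hβ' : β ≤ 1) (hμ : 0 < μ) (hα : 1 < α)
    (hγ : 0 ≤ γ) (ht : 0 < t) (x : ℝ) : Integrable fun y => greenFunction β μ α γ t (x - y) :=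
  (integrable_greenFunction hβ hβ' hμ hα hγ ht).comp_sub_left x

lemma fourier_greenFunction_sub (hβ : 0 < β) (hβ' : β ≤ 1) (hμ : 0 < μ) (hα : 1 < α)
    (hγ : 0 ≤ γ) (ht : 0 < t) (x l : ℝ) :
    ∫ y : ℝ, (greenFunction β μ α γ t (x - y) : ℂ) * Complex.exp (Complex.I * y * l)
      = Complex.exp (Complex.I * x * l) * (greenFourier β μ α γ t l : ℂ) := by
  have h := fourier_greenFunction hβ hβ' hμ hα hγ ht (-l)
  rw [greenFourier_neg] at h
  rw [← h, ← integral_const_mul, ← integral_sub_left_eq_self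
    (fun y : ℝ => Complex.exp (Complex.I * x * l) * ((greenFunction β μ α γ t y : ℂ) *
      Complex.exp (Complex.I * y * ((-l : ℝ) : ℂ)))) volume x]
  refine integral_congr_ae (.of_forall fun y => ?_)
  simp only
  rw [mul_left_comm, ← Complex.exp_add]
  congr 2
  push_cast
  ring

variable {Ω : Type*} [MeasurableSpace Ω] {P : Measure Ω} [IsProbabilityMeasure P]
  {κ w : ℝ} {η : ℝ → Ω → ℝ}

lemma integral_frbeSolution_mul (hβ : 0 < β) (hβ' : β ≤ 1) (hμ : 0 < μ) (hα : 1 < α)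
    (hγ : 0 ≤ γ) (hκ : 0 < κ) (hη : IsCyclicInitialCondition P κ w η) {t t' : ℝ} (ht : 0 < t)
    (ht' : 0 < t') (x x' : ℝ) :
    ∫ ω, frbeSolution β μ α γ η t x ω * frbeSolution β μ α γ η t' x' ω ∂P
      = ∫ l : ℝ, Real.cos (l * (x - x')) * greenFourier β μ α γ t l *
        greenFourier β μ α γ t' l * cyclicDensity κ w l := by
  have h1 := integrable_greenFunction_sub hβ hβ' hμ hα hγ ht x
  have h2 := integrable_greenFunction_sub hβ hβ' hμ hα hγ ht' x'
  simp only [frbeSolution]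
  rw [hη.integral_integral_mul_integral h1 h2, integral_mul_mul_cyclicCov hκ w h1 h2]
  refine integral_congr_ae (.of_forall fun l => ?_)
  simp only [fourier_greenFunction_sub hβ hβ' hμ hα hγ ht x l,
    fourier_greenFunction_sub hβ hβ' hμ hα hγ ht' x' l]
  congr 1
  simp only [map_mul, Complex.conj_ofReal, ← Complex.exp_conj, Complex.conj_I]
  rw [show Complex.exp (Complex.I * x * l) * (greenFourier β μ α γ t l : ℂ) *
      (Complex.exp (-Complex.I * x' * l) * (greenFourier β μ α γ t' l : ℂ))
      = ((greenFourier β μ α γ t l * greenFourier β μ α γ t' l : ℝ) : ℂ) *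
        Complex.exp (((l * (x - x') : ℝ) : ℂ) * Complex.I) by
    rw [show ((l * (x - x') : ℝ) : ℂ) * Complex.I = Complex.I * x * l + -Complex.I * x' * l by
      push_cast; ring, Complex.exp_add]
    push_cast
    ring, Complex.re_ofReal_mul, Complex.exp_ofReal_mul_I_re]
  ring

end SpectralCovariance

/-! ### Scaling limit of the spectral integrals. -/

section Scaling

variable {β μ α γ κ w : ℝ}

/-- The space exponent β/α is chosen so that (ε^(β/α))^α cancels ε^(-β); only the Bessel factor
still contains ε. -/
lemma greenFourier_scaling (hα : 1 < α) {ε t : ℝ} (hε : 0 < ε) (ht : 0 < t)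
    (l : ℝ) :
    greenFourier β μ α γ (t / ε) (ε ^ (β / α) * l)
      = mlDeriv β 0 (μ * t ^ β * |l| ^ α * (1 + (ε ^ (β / α) * l) ^ 2) ^ (γ / 2)) := by
  rw [greenFourier, mlDeriv_zero, frbeSymbol, abs_mul, abs_of_pos (by positivity),
    Real.mul_rpow (by positivity) (abs_nonneg l), ← Real.rpow_mul hε.le,
    div_mul_cancel₀ _ (by linarith), Real.div_rpow ht.le hε.le]
  have : ε ^ β ≠ 0 := by positivity
  congr 2
  field_simp

lemma limit_integrable (hβ : 0 < β) (hβ' : β ≤ 1) (hμ : 0 < μ) (hα : 1 < α) {t : ℝ}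
    (ht : 0 < t) : Integrable fun l : ℝ => mlDeriv β 0 (μ * t ^ β * |l| ^ α) := by
  refine (integrable_greenFourier (γ := 0) hβ hβ' hμ hα le_rfl ht).congr (.of_forall fun l => ?_)
  simp [greenFourier_eq, radialSymbol]

lemma continuous_limit_profile (hβ : 0 < β) (hα : 1 < α) (t : ℝ) :
    Continuous fun l : ℝ => mlDeriv β 0 (μ * t ^ β * |l| ^ α) :=
  (continuous_mlDeriv hβ 0).comp (continuous_const.mul
    ((Real.continuous_rpow_const (by linarith)).comp continuous_abs))

lemma tendsto_rpow_exponent_ratio (hβ : 0 < β) (hα : 1 < α) :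
    Tendsto (fun ε : ℝ => ε ^ (β / α)) (𝓝[>] 0) (𝓝 0) := by
  have hp : 0 < β / α := by positivity
  have := (Real.continuous_rpow_const hp.le).tendsto 0
  rw [Real.zero_rpow hp.ne'] at this
  exact this.mono_left nhdsWithin_le_nhds

/-- The scaled spectral integral away from the origin is negligible. -/
lemma tendsto_scaled_tail (hβ : 0 < β) (hβ' : β ≤ 1) (hμ : 0 < μ) (hα : 1 < α) (hγ : 0 ≤ γ)
    (hκ : 0 < κ) {t t' : ℝ} (ht : 0 < t) (ht' : 0 < t') (z : ℝ → ℝ) {δ : ℝ} (hδ : 0 < δ) :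
    Tendsto (fun ε : ℝ => (ε ^ (β / α))⁻¹ * ∫ l in {l : ℝ | δ < |l|}, Real.cos (l * z ε) *
      greenFourier β μ α γ (t / ε) l * greenFourier β μ α γ (t' / ε) l * cyclicDensity κ w l)
      (𝓝[>] 0) (𝓝 0) := by
  obtain ⟨C, hC, hb⟩ := exists_greenFourier_decay hβ hβ'
  set D : ℝ := C / (μ * t ^ β * δ ^ α) * ∫ l, cyclicDensity κ w l with hD
  -- The decay of one factor Ĝ(t/ε, ·) gains ε^β, the normalization loses ε^(-β/α), and α > 1 makes
  -- the gain prevail.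
  have hlim : Tendsto (fun ε : ℝ => ε ^ (β - β / α) * D) (𝓝[>] 0) (𝓝 0) := by
    have hp : 0 < β - β / α := by
      rw [sub_pos, div_lt_iff₀ (by linarith)]
      nlinarith
    have := (Real.continuous_rpow_const hp.le).tendsto 0
    rw [Real.zero_rpow hp.ne'] at this
    simpa using (this.mono_left nhdsWithin_le_nhds).mul_const D
  refine squeeze_zero_norm' ?_ hlim
  filter_upwards [self_mem_nhdsWithin] with ε hε
  have hε : 0 < ε := hε
  have hφ := integrable_cyclicDensity hκ w
  have hms : MeasurableSet {l : ℝ | δ < |l|} := measurableSet_lt measurable_const measurable_norm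
  have hbound : ‖∫ l in {l : ℝ | δ < |l|}, Real.cos (l * z ε) *
      greenFourier β μ α γ (t / ε) l * greenFourier β μ α γ (t' / ε) l * cyclicDensity κ w l‖
      ≤ ∫ l in {l : ℝ | δ < |l|}, C * ε ^ β / (μ * t ^ β * δ ^ α) * cyclicDensity κ w l := by
    refine norm_integral_le_of_norm_le (hφ.const_mul _).integrableOn ?_
    refine (ae_restrict_iff' hms).2 (.of_forall fun l hl => ?_)
    have hl : δ < |l| := hl
    have g0 := greenFourier_nonneg (α := α) (γ := γ) hβ hβ' hμ.le (div_pos ht hε).le l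
    have g0' := greenFourier_nonneg (α := α) (γ := γ) hβ hβ' hμ.le (div_pos ht' hε).le l
    have g1' := greenFourier_le_one (α := α) (γ := γ) hβ hβ' hμ.le (div_pos ht' hε).le l
    have p0 := cyclicDensity_nonneg hκ w l
    have hdec : greenFourier β μ α γ (t / ε) l ≤ C * ε ^ β / (μ * t ^ β * δ ^ α) := by
      have h1 := hb μ α γ (t / ε) l hμ hγ (div_pos ht hε)
      have h2 : δ ^ α ≤ |l| ^ α := Real.rpow_le_rpow hδ.le hl.le (by linarith)
      have h3 : μ * (t / ε) ^ β * δ ^ α * greenFourier β μ α γ (t / ε) l ≤ C := by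
        refine le_trans ?_ h1
        gcongr
      rw [Real.div_rpow ht.le hε.le] at h3
      rw [le_div_iff₀ (by positivity)]
      have he : 0 < ε ^ β := by positivity
      calc _ = (μ * (t ^ β / ε ^ β) * δ ^ α * greenFourier β μ α γ (t / ε) l) * ε ^ β := by
            field_simp
        _ ≤ _ := by gcongr
    rw [norm_mul, norm_mul, norm_mul, Real.norm_of_nonneg g0, Real.norm_of_nonneg g0',
      Real.norm_of_nonneg p0]
    calc _ ≤ 1 * (C * ε ^ β / (μ * t ^ β * δ ^ α)) * 1 * cyclicDensity κ w l := by
          gcongr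
          exact Real.abs_cos_le_one _
      _ = _ := by ring
  rw [norm_mul, norm_inv, Real.norm_of_nonneg (by positivity)]
  have hle : ∫ l in {l : ℝ | δ < |l|}, C * ε ^ β / (μ * t ^ β * δ ^ α) * cyclicDensity κ w l
      ≤ ∫ l, C * ε ^ β / (μ * t ^ β * δ ^ α) * cyclicDensity κ w l :=
    setIntegral_le_integral (hφ.const_mul _)
      (.of_forall fun l => mul_nonneg (by positivity) (cyclicDensity_nonneg hκ w l))
  calc _ ≤ (ε ^ (β / α))⁻¹ * (C * ε ^ β / (μ * t ^ β * δ ^ α) * ∫ l, cyclicDensity κ w l) := by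
        gcongr
        exact (hbound.trans hle).trans_eq (integral_const_mul _ _)
    _ = _ := by
      rw [hD, Real.rpow_sub hε]
      ring

/-- The scaled spectral integral near the origin. -/
lemma tendsto_scaled_core (hβ : 0 < β) (hβ' : β ≤ 1) (hμ : 0 < μ) (hα : 1 < α) (hγ : 0 ≤ γ)
    (hκ : 0 < κ) {t t' : ℝ} (ht : 0 < t) (ht' : 0 < t') (z : ℝ) {δ M : ℝ} (hδ : 0 < δ)
    (hcont : ContinuousAt (cyclicDensity κ w) 0)
    (hM : ∀ l, |l| ≤ δ → cyclicDensity κ w l ≤ M) :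
    Tendsto (fun ε : ℝ => (ε ^ (β / α))⁻¹ * ∫ l in {l : ℝ | δ < |l|}ᶜ,
      Real.cos (l * (z / ε ^ (β / α))) * greenFourier β μ α γ (t / ε) l *
      greenFourier β μ α γ (t' / ε) l * cyclicDensity κ w l) (𝓝[>] 0)
      (𝓝 (cyclicDensity κ w 0 * ∫ l : ℝ, Real.cos (l * z) * mlDeriv β 0 (μ * t ^ β * |l| ^ α) *
        mlDeriv β 0 (μ * t' ^ β * |l| ^ α))) := by
  have hms : MeasurableSet {l : ℝ | δ < |l|}ᶜ :=
    (measurableSet_lt measurable_const measurable_norm).compl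
  set F : ℝ → ℝ → ℝ := fun ε l => Set.indicator {l : ℝ | δ < |l|}ᶜ
      (fun l => Real.cos (l * (z / ε ^ (β / α))) * greenFourier β μ α γ (t / ε) l *
        greenFourier β μ α γ (t' / ε) l * cyclicDensity κ w l) (ε ^ (β / α) * l) with hF
  have hM0 : 0 ≤ M := (cyclicDensity_nonneg hκ w 0).trans (hM 0 (by simpa using hδ.le))
  have hsub : ∀ᶠ ε : ℝ in 𝓝[>] 0, ∫ l, F ε l = (ε ^ (β / α))⁻¹ * ∫ l in {l : ℝ | δ < |l|}ᶜ,
      Real.cos (l * (z / ε ^ (β / α))) * greenFourier β μ α γ (t / ε) l *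
      greenFourier β μ α γ (t' / ε) l * cyclicDensity κ w l := by
    filter_upwards [self_mem_nhdsWithin] with ε hε
    have hε : 0 < ε := hε
    have ha : 0 < ε ^ (β / α) := by positivity
    simp only [hF]
    rw [Measure.integral_comp_mul_left, integral_indicator hms, abs_of_pos (by positivity),
      smul_eq_mul]
  refine Tendsto.congr' hsub ?_
  rw [← integral_const_mul]
  -- The majorant uses only the profile at time t: the other factor Ĝ is at most 1, the density is
  -- at most M inside the cut, and the Bessel factor is at least 1.
  refine tendsto_integral_filter_of_dominated_convergence
    (fun l => M * mlDeriv β 0 (μ * t ^ β * |l| ^ α)) ?_ ?_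
    ((limit_integrable hβ hβ' hμ hα ht).const_mul M) ?_
  · refine .of_forall fun ε => ?_
    -- Measurability is shown for every real ε; when the scale vanishes the function is constant,
    -- and otherwise dilation preserves null sets.
    by_cases ha : ε ^ (β / α) = 0
    · simp only [hF, ha, zero_mul]
      exact aestronglyMeasurable_const
    have h1 : AEStronglyMeasurable (fun l => Real.cos (l * (z / ε ^ (β / α))) *
        greenFourier β μ α γ (t / ε) l * greenFourier β μ α γ (t' / ε) l *
        cyclicDensity κ w l) volume := by
      refine AEStronglyMeasurable.mul ?_ (integrable_cyclicDensity hκ w).aestronglyMeasurable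
      exact (((by fun_prop : Continuous fun l : ℝ => Real.cos (l * (z / ε ^ (β / α)))).mul
        (continuous_greenFourier hβ (by linarith))).mul
        (continuous_greenFourier hβ (by linarith))).aestronglyMeasurable
    exact (h1.indicator hms).comp_quasiMeasurePreserving
      (Measure.quasiMeasurePreserving_smul volume ha)
  · filter_upwards [self_mem_nhdsWithin] with ε hε
    have hε : 0 < ε := hε
    refine .of_forall fun l => ?_
    have hX0 : 0 ≤ μ * t ^ β * |l| ^ α := by positivity
    have hp := mlDeriv_nonneg hβ hβ' 0 hX0
    simp only [hF]
    by_cases hl : ε ^ (β / α) * l ∈ {l : ℝ | δ < |l|}ᶜ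
    · rw [Set.indicator_of_mem hl]
      have hl' : |ε ^ (β / α) * l| ≤ δ := by simpa using hl
      have g0 := greenFourier_nonneg (α := α) (γ := γ) hβ hβ' hμ.le (div_pos ht hε).le
        (ε ^ (β / α) * l)
      have g0' := greenFourier_nonneg (α := α) (γ := γ) hβ hβ' hμ.le (div_pos ht' hε).le
        (ε ^ (β / α) * l)
      have g1' := greenFourier_le_one (α := α) (γ := γ) hβ hβ' hμ.le (div_pos ht' hε).le
        (ε ^ (β / α) * l)
      have p0 := cyclicDensity_nonneg hκ w (ε ^ (β / α) * l)
      have hg : greenFourier β μ α γ (t / ε) (ε ^ (β / α) * l)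
          ≤ mlDeriv β 0 (μ * t ^ β * |l| ^ α) := by
        rw [greenFourier_scaling hα hε ht]
        have h1 : 1 ≤ (1 + (ε ^ (β / α) * l) ^ 2) ^ (γ / 2) :=
          Real.one_le_rpow (by nlinarith [sq_nonneg (ε ^ (β / α) * l)]) (by positivity)
        exact antitoneOn_mlDeriv hβ hβ' 0 (Set.mem_Ici.2 hX0)
          (Set.mem_Ici.2 (mul_nonneg hX0 (by linarith))) (le_mul_of_one_le_right hX0 h1)
      rw [norm_mul, norm_mul, norm_mul, Real.norm_of_nonneg g0, Real.norm_of_nonneg g0',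
        Real.norm_of_nonneg p0]
      calc _ ≤ 1 * mlDeriv β 0 (μ * t ^ β * |l| ^ α) * 1 * M := by
            gcongr
            · exact Real.abs_cos_le_one _
            · exact hM _ hl'
        _ = _ := by ring
    · rw [Set.indicator_of_notMem hl, norm_zero]
      positivity
  · refine .of_forall fun l => ?_
    have ha : Tendsto (fun ε : ℝ => ε ^ (β / α) * l) (𝓝[>] 0) (𝓝 0) := by
      simpa using (tendsto_rpow_exponent_ratio hβ hα).mul_const l
    have hg : ∀ {s : ℝ}, 0 < s → Tendsto (fun ε : ℝ => mlDeriv β 0 (μ * s ^ β * |l| ^ α *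
        (1 + (ε ^ (β / α) * l) ^ 2) ^ (γ / 2))) (𝓝[>] 0)
        (𝓝 (mlDeriv β 0 (μ * s ^ β * |l| ^ α))) := by
      intro s _
      have h1 : Tendsto (fun ε : ℝ => (1 + (ε ^ (β / α) * l) ^ 2) ^ (γ / 2)) (𝓝[>] 0) (𝓝 1) := by
        have h2 : Tendsto (fun ε : ℝ => 1 + (ε ^ (β / α) * l) ^ 2) (𝓝[>] 0) (𝓝 1) := by
          simpa using (ha.pow 2).const_add 1
        simpa using h2.rpow_const (p := γ / 2) (Or.inl one_ne_zero)
      have h3 := h1.const_mul (μ * s ^ β * |l| ^ α)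
      rw [mul_one] at h3
      exact ((continuous_mlDeriv hβ 0).tendsto _).comp h3
    have hφ : Tendsto (fun ε : ℝ => cyclicDensity κ w (ε ^ (β / α) * l)) (𝓝[>] 0)
        (𝓝 (cyclicDensity κ w 0)) := hcont.tendsto.comp ha
    have hmain := (((hg ht).mul (hg ht')).mul hφ).const_mul (Real.cos (l * z))
    rw [show cyclicDensity κ w 0 * (Real.cos (l * z) * mlDeriv β 0 (μ * t ^ β * |l| ^ α) *
        mlDeriv β 0 (μ * t' ^ β * |l| ^ α)) = Real.cos (l * z) *
        (mlDeriv β 0 (μ * t ^ β * |l| ^ α) * mlDeriv β 0 (μ * t' ^ β * |l| ^ α) *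
        cyclicDensity κ w 0) by ring]
    refine hmain.congr' ?_
    have hsmall : ∀ᶠ ε : ℝ in 𝓝[>] 0, |ε ^ (β / α) * l| ≤ δ := by
      have := ha.abs
      rw [abs_zero] at this
      exact (this.eventually (gt_mem_nhds hδ)).mono fun ε h => h.le
    filter_upwards [self_mem_nhdsWithin, hsmall] with ε hε hs
    have hε : 0 < ε := hε
    have hmem : ε ^ (β / α) * l ∈ {l : ℝ | δ < |l|}ᶜ := by simpa using hs
    have ha0 : ε ^ (β / α) ≠ 0 := by positivity
    simp only [hF]
    rw [Set.indicator_of_mem hmem, greenFourier_scaling hα hε ht,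
      greenFourier_scaling hα hε ht',
      show ε ^ (β / α) * l * (z / ε ^ (β / α)) = l * z by field_simp]
    ring

/-- Continuity supplies a bound on the density near 0 only. Elsewhere it need not be bounded, so the
tail relies on its integrability. -/
lemma tendsto_scaled_integral (hβ : 0 < β) (hβ' : β ≤ 1) (hμ : 0 < μ) (hα : 1 < α) (hγ : 0 ≤ γ)
    (hκ : 0 < κ) (hw : w ≠ 0) {t t' : ℝ} (ht : 0 < t) (ht' : 0 < t') (z : ℝ) :
    Tendsto (fun ε : ℝ => (ε ^ (β / α))⁻¹ * ∫ l : ℝ,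
      Real.cos (l * (z / ε ^ (β / α))) * greenFourier β μ α γ (t / ε) l *
      greenFourier β μ α γ (t' / ε) l * cyclicDensity κ w l) (𝓝[>] 0)
      (𝓝 (cyclicDensity κ w 0 * ∫ l : ℝ, Real.cos (l * z) * mlDeriv β 0 (μ * t ^ β * |l| ^ α) *
        mlDeriv β 0 (μ * t' ^ β * |l| ^ α))) := by
  have hcont := continuousAt_cyclicDensity hκ hw
  obtain ⟨δ, hδ, hM⟩ : ∃ δ > 0, ∀ l, |l| ≤ δ → cyclicDensity κ w l ≤ cyclicDensity κ w 0 + 1 := by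
    have h1 := hcont.eventually (gt_mem_nhds (lt_add_one (cyclicDensity κ w 0)))
    obtain ⟨δ, hδ, h⟩ := Metric.eventually_nhds_iff.1 h1
    refine ⟨δ / 2, by positivity, fun l hl => (h ?_).le⟩
    rw [Real.dist_eq, sub_zero]
    linarith
  have hms : MeasurableSet {l : ℝ | δ < |l|} := measurableSet_lt measurable_const measurable_norm
  have hsum := (tendsto_scaled_tail hβ hβ' hμ hα hγ hκ ht ht' (w := w)
    (fun ε => z / ε ^ (β / α)) hδ).add
    (tendsto_scaled_core hβ hβ' hμ hα hγ hκ ht ht' z hδ hcont hM)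
  rw [zero_add] at hsum
  refine hsum.congr' ?_
  filter_upwards [self_mem_nhdsWithin] with ε hε
  have hε : 0 < ε := hε
  rw [← mul_add, integral_add_compl hms]
  refine (integrable_cyclicDensity hκ w).bdd_mul (c := 1) ?_ (.of_forall fun l => ?_)
  · exact (((by fun_prop : Continuous fun l : ℝ => Real.cos (l * (z / ε ^ (β / α)))).mul
      (continuous_greenFourier hβ (by linarith))).mul
      (continuous_greenFourier hβ (by linarith))).aestronglyMeasurable
  · have g0 := greenFourier_nonneg (α := α) (γ := γ) hβ hβ' hμ.le (div_pos ht hε).le l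
    have g1 := greenFourier_le_one (α := α) (γ := γ) hβ hβ' hμ.le (div_pos ht hε).le l
    have g0' := greenFourier_nonneg (α := α) (γ := γ) hβ hβ' hμ.le (div_pos ht' hε).le l
    have g1' := greenFourier_le_one (α := α) (γ := γ) hβ hβ' hμ.le (div_pos ht' hε).le l
    rw [norm_mul, norm_mul, Real.norm_of_nonneg g0, Real.norm_of_nonneg g0']
    exact mul_le_one₀ (mul_le_one₀ (Real.abs_cos_le_one _) g0 g1) g0' g1'

end Scaling

/-! ### The Wiener integral with respect to white noise. -/

section WhiteNoise

/-- The fibre of a square integrable simple function over a nonzero value, as an index of the white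
noise; the fibre over zero is replaced by the empty set. -/
noncomputable def finiteFiber (s : SimpleFunc ℝ ℂ) (hs : MemLp s 2 volume) (z : ℂ) :
    FiniteBorel :=
  open Classical in
  if hz : z = 0 then ⟨∅, MeasurableSet.empty, by simp⟩
  else ⟨s ⁻¹' {z}, s.measurableSet_fiber z,
    SimpleFunc.measure_preimage_lt_top_of_memLp two_ne_zero ENNReal.ofNat_ne_top s hs z hz⟩

lemma mul_finiteFiber {s : SimpleFunc ℝ ℂ} (hs : MemLp s 2 volume) (V : Set ℝ → ℂ) (z : ℂ) :
    z * V (finiteFiber s hs z).1 = z * V (s ⁻¹' {z}) := by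
  by_cases hz : z = 0
  · simp [hz]
  · simp [finiteFiber, hz]

lemma simpleIntegral_eq {Ω : Type*} (W : Set ℝ → Ω → ℂ) {s : SimpleFunc ℝ ℂ}
    (hs : MemLp s 2 volume) (ω : Ω) :
    simpleIntegral W s ω = ∑ z ∈ s.range, z * W (finiteFiber s hs z).1 ω :=
  Finset.sum_congr rfl fun z _ => (mul_finiteFiber hs (fun A => W A ω) z).symm

lemma simpleFunc_eq_sum {s : SimpleFunc ℝ ℂ} (hs : MemLp s 2 volume) (l : ℝ) :
    s l = ∑ z ∈ s.range, z * (finiteFiber s hs z).1.indicator (fun _ => (1 : ℂ)) l := by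
  have h1 : ∀ z ∈ s.range, z * (finiteFiber s hs z).1.indicator (fun _ => (1 : ℂ)) l
      = z * (s ⁻¹' {z}).indicator (fun _ => (1 : ℂ)) l := fun z _ =>
    mul_finiteFiber hs (fun A => A.indicator (fun _ => (1 : ℂ)) l) z
  rw [Finset.sum_congr rfl h1, Finset.sum_eq_single (s l)]
  · simp
  · intro z _ hz
    rw [Set.indicator_of_notMem (by simpa using hz.symm), mul_zero]
  · intro h
    exact absurd (SimpleFunc.mem_range.2 ⟨l, rfl⟩) h

lemma memLp_sum_mul {X : Type*} [MeasurableSpace X] {m : Measure X} {V : FiniteBorel → X → ℂ}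
    (hV : ∀ A, MemLp (V A) 2 m) (S : Finset ℂ) (a : ℂ → FiniteBorel) :
    MemLp (fun x => ∑ z ∈ S, z * V (a z) x) 2 m :=
  memLp_finsetSum _ fun z _ => (hV (a z)).const_mul z

/-- Stated for any family with Gram matrix |A ∩ B|. Both the white noise and the indicator functions
are such families, and comparing the two instances gives the Itô isometry. -/
lemma integral_sum_mul_conj_sum {X : Type*} [MeasurableSpace X] {m : Measure X}
    {V : FiniteBorel → X → ℂ} (hV : ∀ A, MemLp (V A) 2 m)
    (hcov : ∀ A B, ∫ x, V A x * (starRingEnd ℂ) (V B x) ∂m = ((volume (A.1 ∩ B.1)).toReal : ℂ))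
    (S T : Finset ℂ) (a b : ℂ → FiniteBorel) :
    ∫ x, (∑ z ∈ S, z * V (a z) x) * (starRingEnd ℂ) (∑ y ∈ T, y * V (b y) x) ∂m
      = ∑ z ∈ S, ∑ y ∈ T, z * (starRingEnd ℂ) y * ((volume ((a z).1 ∩ (b y).1)).toReal : ℂ) := by
  have hI : ∀ A B, Integrable (fun x => V A x * (starRingEnd ℂ) (V B x)) m := fun A B =>
    (hV A).integrable_mul (hV B).star
  have h1 : ∀ x, (∑ z ∈ S, z * V (a z) x) * (starRingEnd ℂ) (∑ y ∈ T, y * V (b y) x)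
      = ∑ z ∈ S, ∑ y ∈ T, z * (starRingEnd ℂ) y * (V (a z) x * (starRingEnd ℂ) (V (b y) x)) := by
    intro x
    rw [map_sum, Finset.sum_mul_sum]
    refine Finset.sum_congr rfl fun z _ => Finset.sum_congr rfl fun y _ => ?_
    rw [map_mul]
    ring
  simp only [h1]
  rw [integral_finsetSum _ fun z _ => integrable_finsetSum _ fun y _ => (hI _ _).const_mul _]
  refine Finset.sum_congr rfl fun z _ => ?_
  rw [integral_finsetSum _ fun y _ => (hI _ _).const_mul _]
  refine Finset.sum_congr rfl fun y _ => ?_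
  rw [integral_const_mul, hcov]

lemma memLp_indicator_finiteBorel (A : FiniteBorel) :
    MemLp (A.1.indicator fun _ => (1 : ℂ)) 2 (volume : Measure ℝ) :=
  memLp_indicator_const 2 A.2.1 1 (Or.inr A.2.2.ne)

lemma integral_indicator_mul_conj (A B : FiniteBorel) :
    ∫ l : ℝ, A.1.indicator (fun _ => (1 : ℂ)) l * (starRingEnd ℂ) (B.1.indicator (fun _ => 1) l)
      = ((volume (A.1 ∩ B.1)).toReal : ℂ) := by
  have h : ∀ l : ℝ, A.1.indicator (fun _ => (1 : ℂ)) l *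
      (starRingEnd ℂ) (B.1.indicator (fun _ => 1) l) = (A.1 ∩ B.1).indicator (fun _ => 1) l := by
    intro l
    by_cases hA : l ∈ A.1 <;> by_cases hB : l ∈ B.1 <;> simp [hA, hB]
  simp only [h]
  rw [integral_indicator (A.2.1.inter B.2.1)]
  simp [Measure.real]

variable {Ω : Type*} [MeasurableSpace Ω] {P : Measure Ω} {W : Set ℝ → Ω → ℂ}

namespace IsWhiteNoise

lemma memLp (hW : IsWhiteNoise P W) (A : FiniteBorel) : MemLp (W A.1) 2 P :=
  (hW.gaussian.hasGaussianLaw_eval A).memLp_two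

lemma memLp_simpleIntegral (hW : IsWhiteNoise P W) {s : SimpleFunc ℝ ℂ}
    (hs : MemLp s 2 volume) : MemLp (simpleIntegral W s) 2 P := by
  have := memLp_sum_mul hW.memLp s.range (finiteFiber s hs)
  exact this.ae_eq (.of_forall fun ω => (simpleIntegral_eq W hs ω).symm)

/-- The Itô isometry for simple functions. -/
lemma integral_simpleIntegral_mul_conj (hW : IsWhiteNoise P W) {s r : SimpleFunc ℝ ℂ}
    (hs : MemLp s 2 volume) (hr : MemLp r 2 volume) :
    ∫ ω, simpleIntegral W s ω * (starRingEnd ℂ) (simpleIntegral W r ω) ∂P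
      = ∫ l, s l * (starRingEnd ℂ) (r l) := by
  have h1 := integral_sum_mul_conj_sum hW.memLp hW.cov_eq s.range r.range (finiteFiber s hs)
    (finiteFiber r hr)
  have h2 := integral_sum_mul_conj_sum memLp_indicator_finiteBorel integral_indicator_mul_conj
    s.range r.range (finiteFiber s hs) (finiteFiber r hr)
  simp only [← simpleIntegral_eq W hs, ← simpleIntegral_eq W hr] at h1
  simp only [← simpleFunc_eq_sum hs, ← simpleFunc_eq_sum hr] at h2
  rw [h1, h2]

lemma inner_toLp {X : Type*} [MeasurableSpace X] {m : Measure X} {A B : X → ℂ} (hA : MemLp A 2 m)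
    (hB : MemLp B 2 m) :
    inner ℂ (hB.toLp B) (hA.toLp A) = ∫ x, A x * (starRingEnd ℂ) (B x) ∂m := by
  rw [L2.inner_def]
  refine integral_congr_ae ?_
  filter_upwards [hA.coeFn_toLp, hB.coeFn_toLp] with x h1 h2
  rw [h1, h2, RCLike.inner_apply]

lemma norm_toLp_simpleIntegral_sub (hW : IsWhiteNoise P W) {s r : SimpleFunc ℝ ℂ}
    (hs : MemLp s 2 volume) (hr : MemLp r 2 volume) :
    ‖(hW.memLp_simpleIntegral hs).toLp _ - (hW.memLp_simpleIntegral hr).toLp _‖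
      = ‖hs.toLp s - hr.toLp r‖ := by
  have hin : ∀ {a b : SimpleFunc ℝ ℂ} (ha : MemLp a 2 volume) (hb : MemLp b 2 volume),
      inner ℂ ((hW.memLp_simpleIntegral ha).toLp _) ((hW.memLp_simpleIntegral hb).toLp _)
        = inner ℂ (ha.toLp a) (hb.toLp b) := by
    intro a b ha hb
    rw [inner_toLp, inner_toLp, hW.integral_simpleIntegral_mul_conj hb ha]
  have hsq : ∀ {a : SimpleFunc ℝ ℂ} (ha : MemLp a 2 volume),
      ‖(hW.memLp_simpleIntegral ha).toLp _‖ ^ 2 = ‖ha.toLp a‖ ^ 2 := by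
    intro a ha
    have := hin ha ha
    rw [inner_self_eq_norm_sq_to_K, inner_self_eq_norm_sq_to_K] at this
    exact_mod_cast this
  have h : ‖(hW.memLp_simpleIntegral hs).toLp _ - (hW.memLp_simpleIntegral hr).toLp _‖ ^ 2
      = ‖hs.toLp s - hr.toLp r‖ ^ 2 := by
    rw [norm_sub_sq (𝕜 := ℂ), norm_sub_sq (𝕜 := ℂ), hsq, hsq, hin]
  exact (pow_left_inj₀ (norm_nonneg _) (norm_nonneg _) two_ne_zero).1 h

/-- Square integrable simple functions whose integrals approximate the Wiener integral of `h`. -/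
structure Approximates (P : Measure Ω) (W : Set ℝ → Ω → ℂ) (h : ℝ → ℂ) (s : ℕ → SimpleFunc ℝ ℂ)
    (J : Ω → ℂ) : Prop where
  memLp_simple : ∀ n, MemLp (s n) 2 volume
  memLp_fun : MemLp h 2 volume
  memLp_limit : MemLp J 2 P
  tendsto_simple : Tendsto (fun n => eLpNorm (⇑(s n) - h) 2 volume) atTop (𝓝 0)
  tendsto_integral : Tendsto (fun n => eLpNorm (simpleIntegral W (s n) - J) 2 P) atTop (𝓝 0)

lemma Approximates.isWienerIntegral {h : ℝ → ℂ} {s : ℕ → SimpleFunc ℝ ℂ} {J : Ω → ℂ}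
    (H : Approximates P W h s J) : IsWienerIntegral P W h J :=
  ⟨H.memLp_fun, H.memLp_limit, s, H.memLp_simple, H.tendsto_simple, H.tendsto_integral⟩

/-- The isometry makes the integrals of simple approximants Cauchy, and L² is complete. -/
lemma exists_approximates (hW : IsWhiteNoise P W) {h : ℝ → ℂ} (hm : Measurable h)
    (hL : MemLp h 2 volume) : ∃ s J, Approximates P W h s J := by
  set s : ℕ → SimpleFunc ℝ ℂ := fun n =>
    SimpleFunc.approxOn h hm (Set.range h ∪ {0}) 0 (by simp) n with hsdef
  have hs : ∀ n, MemLp (s n) 2 volume := SimpleFunc.memLp_approxOn_range hm hL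
  have hlim : Tendsto (fun n => eLpNorm (⇑(s n) - h) 2 volume) atTop (𝓝 0) :=
    SimpleFunc.tendsto_approxOn_range_Lp_eLpNorm ENNReal.ofNat_ne_top hm hL.2
  have hE := (Lp.tendsto_Lp_iff_tendsto_eLpNorm'' (fun n => ⇑(s n)) hs h hL).2 hlim
  have hC : CauchySeq fun n => (hW.memLp_simpleIntegral (hs n)).toLp (simpleIntegral W (s n)) := by
    have := hE.cauchySeq
    rw [Metric.cauchySeq_iff] at this ⊢
    simpa only [dist_eq_norm, hW.norm_toLp_simpleIntegral_sub (hs _) (hs _)] using this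
  obtain ⟨J, hJ⟩ := cauchySeq_tendsto_of_complete hC
  refine ⟨s, J, hs, hL, Lp.memLp J, hlim, ?_⟩
  rw [← Lp.toLp_coeFn J (Lp.memLp J)] at hJ
  exact (Lp.tendsto_Lp_iff_tendsto_eLpNorm'' (fun n => simpleIntegral W (s n))
    (fun n => hW.memLp_simpleIntegral (hs n)) J (Lp.memLp J)).1 hJ

lemma integral_mul_conj_of_approximates (hW : IsWhiteNoise P W) {h h' : ℝ → ℂ}
    {s s' : ℕ → SimpleFunc ℝ ℂ} {J J' : Ω → ℂ} (H : Approximates P W h s J)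
    (H' : Approximates P W h' s' J') :
    ∫ ω, J ω * (starRingEnd ℂ) (J' ω) ∂P = ∫ l, h l * (starRingEnd ℂ) (h' l) := by
  have h1 := tendsto_integral_mul_conj (fun n => hW.memLp_simpleIntegral (H.memLp_simple n))
    H.memLp_limit (fun n => hW.memLp_simpleIntegral (H'.memLp_simple n)) H'.memLp_limit
    H.tendsto_integral H'.tendsto_integral
  have h2 := tendsto_integral_mul_conj H.memLp_simple H.memLp_fun H'.memLp_simple H'.memLp_fun
    H.tendsto_simple H'.tendsto_simple
  refine tendsto_nhds_unique h1 (h2.congr fun n => ?_)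
  exact (hW.integral_simpleIntegral_mul_conj (H.memLp_simple n) (H'.memLp_simple n)).symm

lemma ae_eq_of_approximates (hW : IsWhiteNoise P W) {h : ℝ → ℂ} {s s' : ℕ → SimpleFunc ℝ ℂ}
    {J J' : Ω → ℂ} (H : Approximates P W h s J) (H' : Approximates P W h s' J') : J =ᵐ[P] J' := by
  have e := (Lp.tendsto_Lp_iff_tendsto_eLpNorm'' (fun n => ⇑(s n)) H.memLp_simple h
    H.memLp_fun).2 H.tendsto_simple
  have e' := (Lp.tendsto_Lp_iff_tendsto_eLpNorm'' (fun n => ⇑(s' n)) H'.memLp_simple h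
    H.memLp_fun).2 H'.tendsto_simple
  have j := (Lp.tendsto_Lp_iff_tendsto_eLpNorm'' (fun n => simpleIntegral W (s n))
    (fun n => hW.memLp_simpleIntegral (H.memLp_simple n)) J H.memLp_limit).2 H.tendsto_integral
  have j' := (Lp.tendsto_Lp_iff_tendsto_eLpNorm'' (fun n => simpleIntegral W (s' n))
    (fun n => hW.memLp_simpleIntegral (H'.memLp_simple n)) J' H'.memLp_limit).2 H'.tendsto_integral
  have h1 := (j.sub j').norm
  have h2 := (e.sub e').norm
  rw [sub_self, norm_zero] at h2
  have h3 := tendsto_nhds_unique h1 (h2.congr fun n =>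
    (hW.norm_toLp_simpleIntegral_sub (H.memLp_simple n) (H'.memLp_simple n)).symm)
  rw [norm_eq_zero, sub_eq_zero, MemLp.toLp_eq_toLp_iff] at h3
  exact h3

lemma integral_eq_zero_of_approximates [IsProbabilityMeasure P] (hW : IsWhiteNoise P W)
    {h : ℝ → ℂ} {s : ℕ → SimpleFunc ℝ ℂ} {J : Ω → ℂ} (H : Approximates P W h s J) :
    ∫ ω, J ω ∂P = 0 := by
  have h1 := tendsto_integral_mul_conj (fun n => hW.memLp_simpleIntegral (H.memLp_simple n))
    H.memLp_limit (Y := fun _ _ => (1 : ℂ)) (Y₀ := fun _ => (1 : ℂ)) (fun _ => memLp_const 1)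
    (memLp_const 1) H.tendsto_integral (by simp)
  simp only [map_one, mul_one] at h1
  refine tendsto_nhds_unique h1 (tendsto_const_nhds.congr fun n => ?_)
  have hs := H.memLp_simple n
  simp only [simpleIntegral_eq W hs]
  rw [integral_finsetSum _ fun z _ => ((hW.memLp _).integrable one_le_two).const_mul z]
  refine (Finset.sum_eq_zero fun z _ => ?_).symm
  rw [integral_const_mul, hW.mean_zero, mul_zero]

/-- The simple function `l ↦ conj (s (-l))`. -/
noncomputable def reflectConj (s : SimpleFunc ℝ ℂ) : SimpleFunc ℝ ℂ :=
  (s.comp Neg.neg measurable_neg).map (starRingEnd ℂ)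

lemma reflectConj_apply (s : SimpleFunc ℝ ℂ) (l : ℝ) :
    reflectConj s l = (starRingEnd ℂ) (s (-l)) := rfl

/-- The fibre of the reflected function over conj z is the reflection of the fibre over z, so
reindexing the range by conjugation exposes the symmetry of W. -/
lemma simpleIntegral_reflectConj (hW : IsWhiteNoise P W) {s : SimpleFunc ℝ ℂ}
    (hs : MemLp s 2 volume) :
    simpleIntegral W (reflectConj s) =ᵐ[P] fun ω => (starRingEnd ℂ) (simpleIntegral W s ω) := by
  have hsymm : ∀ z ∈ s.range, ∀ᵐ ω ∂P,
      W ((fun l : ℝ => -l) ⁻¹' (finiteFiber s hs z).1) ω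
        = (starRingEnd ℂ) (W (finiteFiber s hs z).1 ω) := fun z _ => hW.symm _
  filter_upwards [(Finset.eventually_all _).2 hsymm] with ω hω
  have hre : simpleIntegral W (reflectConj s) ω
      = ∑ z ∈ s.range, (starRingEnd ℂ) z * W ((fun l : ℝ => -l) ⁻¹' (s ⁻¹' {z})) ω := by
    refine Finset.sum_nbij' (starRingEnd ℂ) (starRingEnd ℂ) ?_ ?_ ?_ ?_ ?_
    · intro z hz
      obtain ⟨l, rfl⟩ := SimpleFunc.mem_range.1 hz
      rw [reflectConj_apply, Complex.conj_conj]
      exact SimpleFunc.mem_range.2 ⟨_, rfl⟩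
    · intro z hz
      obtain ⟨l, rfl⟩ := SimpleFunc.mem_range.1 hz
      exact SimpleFunc.mem_range.2 ⟨-l, by rw [reflectConj_apply, neg_neg]⟩
    · exact fun z _ => Complex.conj_conj z
    · exact fun z _ => Complex.conj_conj z
    · intro z _
      rw [Complex.conj_conj]
      congr 2
      ext l
      simp only [Set.mem_preimage, Set.mem_singleton_iff, reflectConj_apply]
      constructor
      · rintro rfl
        rw [Complex.conj_conj]
      · intro h
        rw [h, Complex.conj_conj]
  rw [hre, simpleIntegral_eq W hs, map_sum]
  refine Finset.sum_congr rfl fun z hz => ?_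
  rw [map_mul, ← hω z hz]
  by_cases h0 : z = 0
  · simp [h0]
  · simp [finiteFiber, h0]

lemma Approximates.reflectConj (hW : IsWhiteNoise P W) {h : ℝ → ℂ} {s : ℕ → SimpleFunc ℝ ℂ}
    {J : Ω → ℂ} (H : Approximates P W h s J) (hsymm : ∀ l, h (-l) = (starRingEnd ℂ) (h l)) :
    Approximates P W h (fun n => IsWhiteNoise.reflectConj (s n))
      fun ω => (starRingEnd ℂ) (J ω) where
  memLp_simple := fun n =>
    ((H.memLp_simple n).comp_measurePreserving (Measure.measurePreserving_neg volume)).star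
  memLp_fun := H.memLp_fun
  memLp_limit := H.memLp_limit.star
  tendsto_simple := by
    refine H.tendsto_simple.congr fun n => ?_
    rw [← eLpNorm_comp_measurePreserving ((H.memLp_simple n).sub H.memLp_fun).aestronglyMeasurable
      (Measure.measurePreserving_neg volume)]
    refine eLpNorm_congr_norm_ae (.of_forall fun l => ?_)
    simp only [Function.comp_apply, Pi.sub_apply, reflectConj_apply, hsymm]
    rw [← RCLike.norm_conj, map_sub, Complex.conj_conj]
  tendsto_integral := by
    refine H.tendsto_integral.congr fun n => ?_
    refine eLpNorm_congr_norm_ae ?_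
    filter_upwards [hW.simpleIntegral_reflectConj (H.memLp_simple n)] with ω hω
    rw [Pi.sub_apply, Pi.sub_apply, hω, ← map_sub, RCLike.norm_conj]

/-- A Hermitian h is also approximated by the reflected conjugate functions, whose integrals tend to
conj J; uniqueness of the Wiener integral forces J = conj J. -/
lemma ae_real_of_approximates (hW : IsWhiteNoise P W) {h : ℝ → ℂ} {s : ℕ → SimpleFunc ℝ ℂ}
    {J : Ω → ℂ} (H : Approximates P W h s J) (hsymm : ∀ l, h (-l) = (starRingEnd ℂ) (h l)) :
    ∀ᵐ ω ∂P, ((J ω).re : ℂ) = J ω := by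
  filter_upwards [hW.ae_eq_of_approximates H (H.reflectConj hW hsymm)] with ω hω
  exact Complex.conj_eq_iff_re.1 hω.symm

lemma isGaussianProcess_of_approximates [IsProbabilityMeasure P] (hW : IsWhiteNoise P W)
    {T : Type*} {h : T → ℝ → ℂ} {s : T → ℕ → SimpleFunc ℝ ℂ} {J : T → Ω → ℂ}
    (H : ∀ p, Approximates P W (h p) (s p) (J p)) :
    IsGaussianProcess (fun p ω => (J p ω).re) P := by
  classical
  refine isGaussianProcess_of_tendsto_L2
    (X := fun n p ω => (simpleIntegral W (s p n) ω).re) (fun n => ?_)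
    (fun p => (H p).memLp_limit.re) fun p => ?_
  · refine hW.gaussian.of_isGaussianProcess fun p => ?_
    have hs := (H p).memLp_simple n
    -- Real parts of complex multiples are real-linear in finitely many values of W, so these
    -- variables inherit joint Gaussianity from W.
    refine ⟨(s p n).range.image (finiteFiber (s p n) hs), ∑ z : (s p n).range,
      Complex.reCLM ∘L (ContinuousLinearMap.mul ℝ ℂ z.1 ∘L ContinuousLinearMap.proj
        ⟨finiteFiber (s p n) hs z.1, Finset.mem_image_of_mem _ z.2⟩), fun ω => ?_⟩
    rw [simpleIntegral_eq W hs, Complex.re_sum, ← Finset.sum_coe_sort]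
    simp [Finset.restrict]
  · refine tendsto_of_tendsto_of_tendsto_of_le_of_le tendsto_const_nhds (H p).tendsto_integral
      (fun _ => zero_le) fun n => eLpNorm_mono fun ω => ?_
    simp only [Pi.sub_apply, ← Complex.sub_re]
    exact Complex.abs_re_le_norm _

end IsWhiteNoise

end WhiteNoise

/-! ### Convergence in law of centred Gaussian vectors. -/

section GaussianConvergence

lemma ProbabilityTheory.IsGaussianProcess.hasGaussianLaw_pi {Ω T : Type*} [MeasurableSpace Ω] {P : Measure Ω}
    {X : T → Ω → ℝ} (hX : IsGaussianProcess X P) {n : ℕ} (p : Fin n → T) :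
    HasGaussianLaw (fun ω i => X (p i) ω) P := by
  let L : (↥(Finset.univ : Finset (Fin n)) → ℝ) →L[ℝ] (Fin n → ℝ) :=
    ContinuousLinearMap.pi fun i => ContinuousLinearMap.proj ⟨i, Finset.mem_univ i⟩
  exact ((hX.comp_right p).hasGaussianLaw Finset.univ).map L

lemma charFun_toLp_of_hasGaussianLaw {Ω : Type*} [MeasurableSpace Ω] {P : Measure Ω}
    [IsProbabilityMeasure P] {n : ℕ} {X : Fin n → Ω → ℝ}
    (hX : HasGaussianLaw (fun ω i => X i ω) P) (hmean : ∀ i, ∫ ω, X i ω ∂P = 0)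
    (v : EuclideanSpace ℝ (Fin n)) :
    charFun (P.map fun ω => WithLp.toLp 2 fun i => X i ω) v
      = Complex.exp (-((∑ i, ∑ j, v i * v j * cov[X i, X j; P] : ℝ) : ℂ) / 2) := by
  have hL : ∀ i, MemLp (X i) 2 P := fun i => (hX.eval i).memLp_two
  rw [(hX.toLp_pi 2).charFun_map_eq v]
  have hin : ∀ ω, inner ℝ v (WithLp.toLp 2 fun i => X i ω) = ∑ i, v i * X i ω := fun ω => by
    simp [PiLp.inner_apply, mul_comm]
  simp only [hin]
  rw [integral_finsetSum _ fun i _ => ((hL i).integrable one_le_two).const_mul _,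
    variance_fun_sum fun i => (hL i).const_mul (v i)]
  simp only [integral_const_mul, hmean, mul_zero, Finset.sum_const_zero, Complex.ofReal_zero,
    zero_mul, zero_sub, covariance_const_mul_left, covariance_const_mul_right]
  rw [neg_div]
  congr 4
  exact Finset.sum_congr rfl fun i _ => Finset.sum_congr rfl fun j _ => by ring

/-- Centred Gaussian vectors converge in distribution if their covariances converge. -/
lemma tendstoInDistribution_of_tendsto_covariance {Ω Ω' ι : Type*} [MeasurableSpace Ω]
    {P : Measure Ω} [IsProbabilityMeasure P] [MeasurableSpace Ω'] {P' : Measure Ω'}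
    [IsProbabilityMeasure P'] {f : Filter ι} [f.IsCountablyGenerated] {n : ℕ}
    {X : ι → Fin n → Ω → ℝ} {Z : Fin n → Ω' → ℝ}
    (hX : ∀ k, HasGaussianLaw (fun ω i => X k i ω) P) (hZ : HasGaussianLaw (fun ω i => Z i ω) P')
    (hXm : ∀ k i, ∫ ω, X k i ω ∂P = 0) (hZm : ∀ i, ∫ ω, Z i ω ∂P' = 0)
    (hcov : ∀ i j, Tendsto (fun k => cov[X k i, X k j; P]) f (𝓝 cov[Z i, Z j; P'])) :
    TendstoInDistribution (fun k ω i => X k i ω) f (fun ω i => Z i ω) (fun _ => P) P' := by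
  -- Characteristic functions require an inner product, so the argument runs in Euclidean space and
  -- is carried back by a continuous map.
  have hE : TendstoInDistribution (fun k ω => (WithLp.toLp 2 fun i => X k i ω :
      EuclideanSpace ℝ (Fin n))) f (fun ω => WithLp.toLp 2 fun i => Z i ω) (fun _ => P) P' := by
    refine ⟨fun k => ((hX k).toLp_pi 2).aemeasurable, (hZ.toLp_pi 2).aemeasurable, ?_⟩
    -- The characteristic function criterion is applied along sequences, enough because `f` is
    -- countably generated.
    refine tendsto_of_seq_tendsto fun u hu => ?_
    refine ProbabilityMeasure.tendsto_iff_tendsto_charFun.2 fun v => ?_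
    simp only [ProbabilityMeasure.coe_mk]
    rw [charFun_toLp_of_hasGaussianLaw hZ hZm v]
    refine Tendsto.congr
      (fun m => (charFun_toLp_of_hasGaussianLaw (hX (u m)) (hXm (u m)) v).symm) ?_
    refine (Complex.continuous_exp.tendsto _).comp (Tendsto.div_const (Tendsto.neg ?_) 2)
    refine (Complex.continuous_ofReal.tendsto _).comp ?_
    exact tendsto_finsetSum _ fun i _ => tendsto_finsetSum _ fun j _ =>
      ((hcov i j).comp hu).const_mul _
  exact hE.continuous_comp (g := fun v : EuclideanSpace ℝ (Fin n) => (fun i => v i : Fin n → ℝ))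
    (by fun_prop)

end GaussianConvergence

/-! ### Kernel and covariance of the limit field. -/

section LimitField

variable {β μ α : ℝ}

/-- The integrand `e^{ilx} E_β(-μ t^β |l|^α)` of the limit field. -/
noncomputable def limitKernel (β μ α t x l : ℝ) : ℂ :=
  Complex.exp (Complex.I * l * x) * (mittagLeffler β (-(μ * t ^ β * |l| ^ α)) : ℂ)

lemma continuous_limitKernel (hβ : 0 < β) (hα : 1 < α) (t x : ℝ) :
    Continuous (limitKernel β μ α t x) := by
  have h := continuous_limit_profile (μ := μ) hβ hα t
  simp only [mlDeriv_zero] at h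
  exact (by fun_prop : Continuous fun l : ℝ => Complex.exp (Complex.I * l * x)).mul
    (Complex.continuous_ofReal.comp h)

lemma limitKernel_neg (t x l : ℝ) :
    limitKernel β μ α t x (-l) = (starRingEnd ℂ) (limitKernel β μ α t x l) := by
  simp only [limitKernel, abs_neg, map_mul, Complex.conj_ofReal, ← Complex.exp_conj,
    Complex.conj_I]
  push_cast
  congr 2
  ring

lemma norm_limitKernel (hβ : 0 < β) (hβ' : β ≤ 1) (hμ : 0 < μ) {t : ℝ} (ht : 0 < t) (x l : ℝ) :
    ‖limitKernel β μ α t x l‖ = mlDeriv β 0 (μ * t ^ β * |l| ^ α) := by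
  rw [limitKernel, norm_mul, norm_exp_I_mul, one_mul, ← mlDeriv_zero, Complex.norm_real,
    Real.norm_of_nonneg (mlDeriv_nonneg hβ hβ' 0 (by positivity))]

lemma integrable_limit_profile_mul (hβ : 0 < β) (hβ' : β ≤ 1) (hμ : 0 < μ) (hα : 1 < α)
    {t t' : ℝ} (ht : 0 < t) (ht' : 0 < t') :
    Integrable fun l : ℝ => mlDeriv β 0 (μ * t ^ β * |l| ^ α) *
      mlDeriv β 0 (μ * t' ^ β * |l| ^ α) := by
  refine (limit_integrable hβ hβ' hμ hα ht').bdd_mul (c := 1)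
    (continuous_limit_profile hβ hα t).aestronglyMeasurable (.of_forall fun l => ?_)
  rw [Real.norm_of_nonneg (mlDeriv_nonneg hβ hβ' 0 (by positivity))]
  exact mlDeriv_zero_le_one hβ hβ' (by positivity)

lemma memLp_limitKernel (hβ : 0 < β) (hβ' : β ≤ 1) (hμ : 0 < μ) (hα : 1 < α) {t : ℝ}
    (ht : 0 < t) (x : ℝ) : MemLp (limitKernel β μ α t x) 2 volume := by
  rw [memLp_two_iff_integrable_sq_norm
    (continuous_limitKernel hβ hα t x).aestronglyMeasurable]
  simp only [norm_limitKernel hβ hβ' hμ ht, pow_two]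
  exact integrable_limit_profile_mul hβ hβ' hμ hα ht ht

/-- Only the phase e^(il(x-x')) is complex, and its sine part integrates to 0 against the even
profiles. -/
lemma integral_limitKernel_mul_conj (hβ : 0 < β) (hβ' : β ≤ 1) (hμ : 0 < μ) (hα : 1 < α)
    {t t' : ℝ} (ht : 0 < t) (ht' : 0 < t') (x x' : ℝ) :
    ∫ l, limitKernel β μ α t x l * (starRingEnd ℂ) (limitKernel β μ α t' x' l)
      = ((∫ l : ℝ, Real.cos (l * (x - x')) * mlDeriv β 0 (μ * t ^ β * |l| ^ α) *
        mlDeriv β 0 (μ * t' ^ β * |l| ^ α) : ℝ) : ℂ) := by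
  have h := integral_exp_mul_even (integrable_limit_profile_mul hβ hβ' hμ hα ht ht')
    (fun l => by simp only [abs_neg]) (x - x')
  simp only [mul_assoc] at h ⊢
  rw [← h]
  refine integral_congr_ae (.of_forall fun l => ?_)
  simp only [limitKernel, map_mul, Complex.conj_ofReal, ← Complex.exp_conj, Complex.conj_I,
    mlDeriv_zero]
  rw [show Complex.I * ((l : ℂ) * ((x - x' : ℝ) : ℂ))
    = Complex.I * l * x + -Complex.I * l * x' by push_cast; ring, Complex.exp_add]
  push_cast
  ring_nf

lemma integral_cos_mul_eq_two_mul (t t' z : ℝ) :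
    ∫ l : ℝ, Real.cos (l * z) * mlDeriv β 0 (μ * t ^ β * |l| ^ α) *
        mlDeriv β 0 (μ * t' ^ β * |l| ^ α)
      = 2 * ∫ l in Set.Ioi (0 : ℝ), Real.cos (l * z) * mlDeriv β 0 (μ * t ^ β * |l| ^ α) *
        mlDeriv β 0 (μ * t' ^ β * |l| ^ α) := by
  rw [← integral_comp_abs (f := fun l => Real.cos (l * z) * mlDeriv β 0 (μ * t ^ β * |l| ^ α) *
        mlDeriv β 0 (μ * t' ^ β * |l| ^ α))]
  refine integral_congr_ae (.of_forall fun l => ?_)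
  simp only [abs_abs]
  rcases abs_choice l with h | h <;> simp only [h, neg_mul, Real.cos_neg]

lemma integrable_cos_mul_limit_profile_mul (hβ : 0 < β) (hβ' : β ≤ 1) (hμ : 0 < μ) (hα : 1 < α)
    {t t' : ℝ} (ht : 0 < t) (ht' : 0 < t') (z : ℝ) :
    Integrable fun l : ℝ => Real.cos (l * z) * mlDeriv β 0 (μ * t ^ β * |l| ^ α) *
      mlDeriv β 0 (μ * t' ^ β * |l| ^ α) := by
  simp only [mul_assoc (Real.cos _)]
  exact (integrable_limit_profile_mul hβ hβ' hμ hα ht ht').bdd_mul (c := 1) (by fun_prop)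
    (.of_forall fun l => Real.abs_cos_le_one _)

end LimitField

/-! ### Gaussianity, mean and covariance of the rescaled solution. -/

section RescaledSolution

variable {β μ α γ κ w : ℝ} {Ω : Type*} [MeasurableSpace Ω] {P : Measure Ω} [IsProbabilityMeasure P]
  {η : ℝ → Ω → ℝ}

lemma isGaussianProcess_rescaledSolution (hβ : 0 < β) (hβ' : β ≤ 1) (hμ : 0 < μ) (hα : 1 < α)
    (hγ : 0 ≤ γ) (hη : IsCyclicInitialCondition P κ w η) {ε : ℝ} (hε : 0 < ε) :
    IsGaussianProcess (fun p : Set.Ioi (0 : ℝ) × ℝ => rescaledSolution β μ α γ η ε p.1 p.2) P :=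
  (hη.isGaussianProcess_integral (T := Set.Ioi (0 : ℝ) × ℝ)
    (h := fun p y => greenFunction β μ α γ (p.1 / ε) (p.2 / ε ^ (β / α) - y))
    (fun p => integrable_greenFunction_sub hβ hβ' hμ hα hγ (div_pos p.1.2 hε) _)).smul
      fun _ => (ε ^ (β / (2 * α)))⁻¹

lemma memLp_frbeSolution (hβ : 0 < β) (hβ' : β ≤ 1) (hμ : 0 < μ) (hα : 1 < α) (hγ : 0 ≤ γ)
    (hη : IsCyclicInitialCondition P κ w η) {t : ℝ} (ht : 0 < t) (x : ℝ) :
    MemLp (frbeSolution β μ α γ η t x) 2 P :=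
  hη.memLp_integral (integrable_greenFunction_sub hβ hβ' hμ hα hγ ht x)

lemma integral_frbeSolution (hβ : 0 < β) (hβ' : β ≤ 1) (hμ : 0 < μ) (hα : 1 < α) (hγ : 0 ≤ γ)
    (hη : IsCyclicInitialCondition P κ w η) {t : ℝ} (ht : 0 < t) (x : ℝ) :
    ∫ ω, frbeSolution β μ α γ η t x ω ∂P = 0 :=
  hη.integral_integral_eq_zero (integrable_greenFunction_sub hβ hβ' hμ hα hγ ht x)

lemma integral_rescaledSolution (hβ : 0 < β) (hβ' : β ≤ 1) (hμ : 0 < μ) (hα : 1 < α)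
    (hγ : 0 ≤ γ) (hη : IsCyclicInitialCondition P κ w η) {ε t : ℝ} (hε : 0 < ε) (ht : 0 < t)
    (x : ℝ) : ∫ ω, rescaledSolution β μ α γ η ε t x ω ∂P = 0 := by
  simp only [rescaledSolution]
  rw [integral_const_mul, integral_frbeSolution hβ hβ' hμ hα hγ hη (div_pos ht hε), mul_zero]

lemma covariance_rescaledSolution (hβ : 0 < β) (hβ' : β ≤ 1) (hμ : 0 < μ) (hα : 1 < α)
    (hγ : 0 ≤ γ) (hκ : 0 < κ) (hη : IsCyclicInitialCondition P κ w η) {ε t t' : ℝ} (hε : 0 < ε)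
    (ht : 0 < t) (ht' : 0 < t') (x x' : ℝ) :
    cov[rescaledSolution β μ α γ η ε t x, rescaledSolution β μ α γ η ε t' x'; P]
      = (ε ^ (β / α))⁻¹ * ∫ l : ℝ, Real.cos (l * ((x - x') / ε ^ (β / α))) *
        greenFourier β μ α γ (t / ε) l * greenFourier β μ α γ (t' / ε) l *
        cyclicDensity κ w l := by
  have ht1 := div_pos ht hε
  have ht2 := div_pos ht' hε
  have hsq : (ε ^ (β / (2 * α)))⁻¹ * (ε ^ (β / (2 * α)))⁻¹ = (ε ^ (β / α))⁻¹ := by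
    rw [← mul_inv, ← Real.rpow_add hε]
    congr 2
    ring
  have h1 : cov[rescaledSolution β μ α γ η ε t x, rescaledSolution β μ α γ η ε t' x'; P]
      = (ε ^ (β / (2 * α)))⁻¹ * ((ε ^ (β / (2 * α)))⁻¹ *
        cov[frbeSolution β μ α γ η (t / ε) (x / ε ^ (β / α)),
          frbeSolution β μ α γ η (t' / ε) (x' / ε ^ (β / α)); P]) := by
    rw [← covariance_const_mul_right, ← covariance_const_mul_left]
    rfl
  rw [h1, ← mul_assoc, hsq, covariance_eq_sub (memLp_frbeSolution hβ hβ' hμ hα hγ hη ht1 _)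
    (memLp_frbeSolution hβ hβ' hμ hα hγ hη ht2 _), integral_frbeSolution hβ hβ' hμ hα hγ hη ht1,
    zero_mul, sub_zero]
  simp only [Pi.mul_apply]
  rw [integral_frbeSolution_mul hβ hβ' hμ hα hγ hκ hη ht1 ht2, sub_div]

end RescaledSolution

/-! ### Construction of the limit field and the limit theorem. -/

theorem theorem4
    {Ω : Type*} [MeasurableSpace Ω] (P : Measure Ω) [IsProbabilityMeasure P]
    {Ω' : Type*} [MeasurableSpace Ω'] (P' : Measure Ω') [IsProbabilityMeasure P']
    (β μ α γ κ w : ℝ) (hβ : 0 < β) (hβ' : β ≤ 1) (hμ : 0 < μ) (hα : 1 < α) (hγ : 0 ≤ γ)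
    (hκ : 0 < κ) (hκ' : κ < 1) (hw : w ≠ 0)
    (η : ℝ → Ω → ℝ) (hη : IsCyclicInitialCondition P κ w η)
    (W : Set ℝ → Ω' → ℂ) (hW : IsWhiteNoise P' W) :
    -- the solution is well defined
    IsGreenFunction β μ α γ (greenFunction β μ α γ) ∧
    (∀ t x : ℝ, 0 < t →
      ∀ᵐ ω ∂P, Integrable (fun y : ℝ => greenFunction β μ α γ t (x - y) * η y ω)) ∧
    -- the limit field, as a stochastic integral
    ∃ U₀ : ℝ → ℝ → Ω' → ℝ,
      (∀ t x : ℝ, 0 < t → ∃ J : Ω' → ℂ,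
        IsWienerIntegral P' W
          (fun l : ℝ => Complex.exp (Complex.I * l * x) *
            (mittagLeffler β (-(μ * t ^ β * |l| ^ α)) : ℂ)) J ∧
        ∀ᵐ ω ∂P', (U₀ t x ω : ℂ) = (√(limitConst κ w) : ℂ) * J ω) ∧
      -- it is a zero-mean Gaussian field
      IsGaussianProcess (fun p : Set.Ioi (0 : ℝ) × ℝ => U₀ p.1 p.2) P' ∧
      (∀ t x : ℝ, 0 < t → ∫ ω, U₀ t x ω ∂P' = 0) ∧
      -- its covariance function
      (∀ t x t' x' : ℝ, 0 < t → 0 < t' →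
        IntegrableOn (fun l : ℝ => Real.cos (l * (x - x')) *
          mittagLeffler β (-(μ * t ^ β * |l| ^ α)) *
          mittagLeffler β (-(μ * t' ^ β * |l| ^ α))) (Set.Ioi 0) ∧
        covariance (U₀ t x) (U₀ t' x') P' =
          2 * c₂ κ * (1 - theta κ |w|) / |w| ^ (1 - κ) *
            ∫ l in Set.Ioi (0 : ℝ), Real.cos (l * (x - x')) *
              mittagLeffler β (-(μ * t ^ β * |l| ^ α)) *
              mittagLeffler β (-(μ * t' ^ β * |l| ^ α))) ∧
      -- convergence of the finite-dimensional distributions as `ε → 0+`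
      (∀ (n : ℕ) (p : Fin n → Set.Ioi (0 : ℝ) × ℝ),
        TendstoInDistribution
          (fun (ε : Set.Ioi (0 : ℝ)) (ω : Ω) (i : Fin n) =>
            rescaledSolution β μ α γ η ε (p i).1 (p i).2 ω)
          (comap Subtype.val (𝓝 (0 : ℝ)))
          (fun (ω : Ω') (i : Fin n) => U₀ (p i).1 (p i).2 ω)
          (fun _ => P) P') := by
  refine ⟨isGreenFunction_greenFunction hβ hβ' hμ hα hγ, fun t x ht =>
    hη.ae_integrable (integrable_greenFunction_sub hβ hβ' hμ hα hγ ht x), ?_⟩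
  have hc0 := limitConst_nonneg hκ hκ' hw
  have hex : ∀ p : Set.Ioi (0 : ℝ) × ℝ, ∃ s J,
      IsWhiteNoise.Approximates P' W (limitKernel β μ α p.1 p.2) s J := fun p =>
    hW.exists_approximates (continuous_limitKernel hβ hα _ _).measurable
      (memLp_limitKernel hβ hβ' hμ hα p.1.2 _)
  choose s J H using hex
  -- Taking the real part changes J only on a null set, since the kernel is Hermitian.
  set V : Set.Ioi (0 : ℝ) × ℝ → Ω' → ℝ := fun p ω => √(limitConst κ w) * (J p ω).re with hV
  have hreal : ∀ p, ∀ᵐ ω ∂P', ((J p ω).re : ℂ) = J p ω := fun p =>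
    hW.ae_real_of_approximates (H p) fun l => limitKernel_neg _ _ l
  have hVgauss : IsGaussianProcess V P' :=
    (hW.isGaussianProcess_of_approximates H).smul fun _ => √(limitConst κ w)
  have hJ0 : ∀ p, ∫ ω, (J p ω).re ∂P' = 0 := by
    intro p
    have h1 := integral_re ((H p).memLp_limit.integrable one_le_two)
    rw [hW.integral_eq_zero_of_approximates (H p)] at h1
    simpa using h1
  have hVmean : ∀ p, ∫ ω, V p ω ∂P' = 0 := by
    intro p
    simp only [hV]
    rw [integral_const_mul, hJ0, mul_zero]
  have hVcov : ∀ p q, cov[V p, V q; P'] = limitConst κ w *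
      ∫ l : ℝ, Real.cos (l * (p.2 - q.2)) * mlDeriv β 0 (μ * (p.1 : ℝ) ^ β * |l| ^ α) *
        mlDeriv β 0 (μ * (q.1 : ℝ) ^ β * |l| ^ α) := by
    intro p q
    have h1 : ∫ ω, (J p ω).re * (J q ω).re ∂P' = ∫ l : ℝ, Real.cos (l * (p.2 - q.2)) *
        mlDeriv β 0 (μ * (p.1 : ℝ) ^ β * |l| ^ α) * mlDeriv β 0 (μ * (q.1 : ℝ) ^ β * |l| ^ α) := by
      have h2 := hW.integral_mul_conj_of_approximates (H p) (H q)
      rw [integral_limitKernel_mul_conj hβ hβ' hμ hα p.1.2 q.1.2] at h2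
      rw [← Complex.ofReal_inj, ← h2, ← integral_complex_ofReal]
      refine integral_congr_ae ?_
      filter_upwards [hreal p, hreal q] with ω hp hq
      rw [Complex.ofReal_mul, hp, ← Complex.conj_ofReal (J q ω).re, hq]
    simp only [hV]
    rw [covariance_const_mul_left, covariance_const_mul_right, ← mul_assoc,
      Real.mul_self_sqrt hc0, covariance_eq_sub (X := fun ω => (J p ω).re)
        (Y := fun ω => (J q ω).re) (H p).memLp_limit.re (H q).memLp_limit.re, hJ0, zero_mul,
      sub_zero, ← h1]
    rfl
  refine ⟨fun t x ω => if ht : 0 < t then V (⟨t, ht⟩, x) ω else 0, ?_, ?_, ?_, ?_, ?_⟩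
  · intro t x ht
    refine ⟨J (⟨t, ht⟩, x), (H (⟨t, ht⟩, x)).isWienerIntegral, ?_⟩
    filter_upwards [hreal (⟨t, ht⟩, x)] with ω hω
    simp only [ht, dite_true, hV]
    rw [Complex.ofReal_mul, hω]
  · refine hVgauss.congr fun p => .of_forall fun ω => ?_
    simp [Set.mem_Ioi.1 p.1.2]
  · intro t x ht
    simpa [ht] using hVmean (⟨t, ht⟩, x)
  · intro t x t' x' ht ht'
    have h1 := hVcov (⟨t, ht⟩, x) (⟨t', ht'⟩, x')
    rw [integral_cos_mul_eq_two_mul] at h1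
    simp only [← mlDeriv_zero, ht, ht', dite_true]
    refine ⟨(integrable_cos_mul_limit_profile_mul hβ hβ' hμ hα ht ht' _).integrableOn, ?_⟩
    rw [h1, limitConst]
    ring
  · intro n p
    have hlim := tendstoInDistribution_of_tendsto_covariance
      (f := comap (Subtype.val : Set.Ioi (0 : ℝ) → ℝ) (𝓝 (0 : ℝ)))
      (X := fun (ε : Set.Ioi (0 : ℝ)) i => rescaledSolution β μ α γ η ε (p i).1 (p i).2)
      (Z := fun i => V (p i))
      (fun ε => (isGaussianProcess_rescaledSolution hβ hβ' hμ hα hγ hη ε.2).hasGaussianLaw_pi p)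
      (hVgauss.hasGaussianLaw_pi p)
      (fun ε i => integral_rescaledSolution hβ hβ' hμ hα hγ hη ε.2 (p i).1.2 _)
      (fun i => hVmean (p i)) fun i j => ?_
    · have : (fun (ω : Ω') (i : Fin n) =>
          (if ht : 0 < ((p i).1 : ℝ) then V (⟨(p i).1, ht⟩, (p i).2) ω else 0))
          = fun ω i => V (p i) ω := by
        ext ω i
        simp [Set.mem_Ioi.1 (p i).1.2]
      rw [this]
      exact hlim
    -- The constant of the limit field is recognized as the spectral density of η at frequency 0.
    · rw [hVcov, ← cyclicDensity_zero hκ hκ' hw]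
      have h1 := tendsto_scaled_integral hβ hβ' hμ hα hγ hκ hw (p i).1.2 (p j).1.2
        ((p i).2 - (p j).2)
      have h2 : Tendsto (Subtype.val : Set.Ioi (0 : ℝ) → ℝ) (comap Subtype.val (𝓝 0))
          (𝓝[>] 0) :=
        tendsto_nhdsWithin_iff.2 ⟨tendsto_comap, .of_forall fun ε => ε.2⟩
      refine (h1.comp h2).congr fun ε => ?_
      exact (covariance_rescaledSolution hβ hβ' hμ hα hγ hκ hη ε.2 (p i).1.2 (p j).1.2 _ _).symm
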